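/- Let $n\ge 2$, $0\le R<1$ and $\varepsilon>0$. For every $\tau\in(-\varepsilon,\varepsilon)$ let $c_\tau\colon[R,1]\to(0,\infty)$ be a $C^{1,1}$ function (differentiable with Lipschitz derivative), and suppose that $c_\tau$ depends $C^1$-smoothly on $\tau$ in the sense that $(\tau,r)\mapsto c_\tau(r)$ is $C^1$ on $(-\varepsilon,\varepsilon)\times[R,1]$. If $R=0$, suppose that $c_\tau'(0)=0$ for all $\tau$. Suppose that every $c=c_\tau$ satisfies * the Herglotz condition: $\frac{\mathrm d}{\mathrm dr}\left(\frac{r}{c(r)}\right)>0$ for all $r\in[R,1]$; * the countable conjugacy condition: for at most countably many $r\in(R,1)$ the endpoints of the maximal geodesic of radius $r$ are conjugate along that geodesic. Here geodesics, lengths and conjugate points are those of the metric $c(|x|)^{-2}e$ on the annulus $\{x\in\mathbb R^n: R\le|x|\le 1\}$ (the closed unit ball if $R=0$), where $e$ is the Euclidean metric. A maximal geodesic is a unit speed geodesic of positive length with both endpoints on the outer boundary $|x|=1$ whose other points satisfy $R<|x|<1$ (only $|x|<1$ if $R=0$). Its radius is its Euclidean distance to the origin; for each $r\in(R,1)$ the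 maximal geodesic of radius $r$ is unique up to rotations and reversal. Two endpoints are conjugate if a nontrivial Jacobi field along the geodesic vanishes at both; since $c$ is only $C^{1,1}$, a Jacobi field is a $C^1$ field with Lipschitz derivative that satisfies the Jacobi equation (the linearized geodesic equation) at almost every time. Let $\operatorname{lsp}(c)$ be the set of lengths of all periodic broken rays without inner reflections, that is, of finite cyclic concatenations of maximal geodesics in which each one starts where the preceding one ends, with the velocity reflected by the usual law of reflection. If $R>0$, let $\operatorname{lsp}'(c)$ be the set of lengths of all periodic broken rays that may also reflect at the inner boundary: finite cyclic concatenations, by the same rule, of unit speed geodesics of positive length that have each endpoint on $|x|=R$ or on $|x|=1$ and otherwise lie in $R<|x|<1$. Periodic broken rays need not be traversed only once, so multiples of primitive lengths are included. 1. If $\operatorname{lsp}(c_\tau)=\operatorname{lsp}(c_0)$ for all $\tau\in(-\varepsilon,\varepsilon)$, then $c_\tau=c_0$ on $[R,1]$ for all $\tau\in(-\varepsilon,\varepsilon)$. 2. If $R>0$ and $\operatorname{lsp}'(c_\tau)=\operatorname{lsp}'(c_0)$ for all $\tau\in(-\varepsilon,\varepsilon)$, then $c_\tau=c_0$ on $[R,1]$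 for all $\tau\in(-\varepsilon,\varepsilon)$. -/

import Mathlib

open Set MeasureTheory

open scoped NNReal ContDiff

noncomputable section

namespace RadialSpeed

/-- Euclidean space of dimension `n`, in which the ball or annulus lies. -/
abbrev E (n : ℕ) : Type := EuclideanSpace ℝ (Fin n)

/-- `f` is of class `C^{1,1}` on `s` (one-sided derivatives at end points): differentiable with
Lipschitz derivative. -/
def IsC11On (f : ℝ → ℝ) (s : Set ℝ) : Prop :=
  DifferentiableOn ℝ f s ∧ ∃ K : ℝ≥0, LipschitzOnWith K (derivWithin f s) s

/-- The Herglotz condition for a sound speed `c` on `[R, 1]`. -/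
def Herglotz (R : ℝ) (c : ℝ → ℝ) : Prop :=
  ∀ r ∈ Icc R 1, 0 < derivWithin (fun s => s / c s) (Icc R 1) r

/-- Acceleration in the geodesic equation of the metric `g = c(|x|)⁻² e`, where `e` is the
Euclidean metric. For a conformal metric `exp(2φ) e` the geodesic equation in Cartesian
coordinates is `x'' = -2 ⟨∇φ, x'⟩ x' + |x'|² ∇φ`, and here `φ = -log c(|x|)`, so that
`∇φ(x) = -(c'(|x|) / c(|x|)) x / |x|`. At the origin of a ball `∇φ` vanishes, since `c'(0) = 0`. -/
def accel {n : ℕ} (R : ℝ) (c : ℝ → ℝ) (x v : E n) : E n :=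
  (derivWithin c (Icc R 1) ‖x‖ / (c ‖x‖ * ‖x‖)) •
    ((2 * inner ℝ x v) • v - ‖v‖ ^ 2 • x)

/-- `x : [0, T] → ℝⁿ`, with velocity `v`, is a unit speed geodesic of the metric `c(|x|)⁻² e` on
`R ≤ |x| ≤ 1`; its Riemannian length is `T`. -/
structure IsUnitGeodesic {n : ℕ} (R : ℝ) (c : ℝ → ℝ) (T : ℝ) (x v : ℝ → E n) : Prop where
  pos : 0 < T
  mem : ∀ t ∈ Icc 0 T, ‖x t‖ ∈ Icc R 1
  hasDeriv : ∀ t ∈ Icc 0 T, HasDerivWithinAt x (v t) (Icc 0 T) t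
  geodesic : ∀ t ∈ Icc 0 T, HasDerivWithinAt v (accel R c (x t) (v t)) (Icc 0 T) t
  unit_speed : ∀ t ∈ Icc 0 T, ‖v t‖ = c ‖x t‖

/-- A maximal geodesic: a unit speed geodesic with both end points on the outer boundary, which
between them stays in the interior of `{R < |x| ≤ 1}` if `R > 0`, of the closed unit ball if
`R = 0` (then it may pass through the origin). -/
structure IsMaximalGeodesic {n : ℕ} (R : ℝ) (c : ℝ → ℝ) (T : ℝ) (x v : ℝ → E n) : Prop
    extends IsUnitGeodesic R c T x v where
  start_outer : ‖x 0‖ = 1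
  end_outer : ‖x T‖ = 1
  interior_outer : ∀ t ∈ Ioo 0 T, ‖x t‖ < 1
  interior_inner : ∀ t ∈ Ioo 0 T, R = 0 ∨ R < ‖x t‖

/-- A geodesic segment in the closed annulus `{R ≤ |x| ≤ 1}`, from boundary to boundary. Each end
point may lie on either boundary component. -/
structure IsBoundarySegment {n : ℕ} (R : ℝ) (c : ℝ → ℝ) (T : ℝ) (x v : ℝ → E n) : Prop
    extends IsUnitGeodesic R c T x v where
  start_boundary : ‖x 0‖ = R ∨ ‖x 0‖ = 1
  end_boundary : ‖x T‖ = R ∨ ‖x T‖ = 1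
  interior : ∀ t ∈ Ioo 0 T, ‖x t‖ ∈ Ioo R 1

/-- `w` is the reflection of the velocity `v` at the boundary point `y` (law of reflection on the
sphere through `y` centred at the origin; angles of `c⁻² e` are Euclidean angles). -/
def IsReflection {n : ℕ} (y v w : E n) : Prop :=
  w = v - (2 * inner ℝ v y / ‖y‖ ^ 2) • y

/-- A cyclic concatenation of `k + 1` curves: every curve ends where the next one starts, with the
velocity reflected there. Here `i + 1` is taken modulo `k + 1`, so the last curve is followed by
the first one. -/
def IsClosedBroken {n k : ℕ} (T : Fin (k + 1) → ℝ) (x v : Fin (k + 1) → ℝ → E n) : Prop :=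
  ∀ i, x (i + 1) 0 = x i (T i) ∧ IsReflection (x i (T i)) (v i (T i)) (v (i + 1) 0)

/-- The length spectrum `lsp(c)`: lengths of all periodic broken rays that reflect only at the outer
boundary. -/
def lsp (n : ℕ) (R : ℝ) (c : ℝ → ℝ) : Set ℝ :=
  {l | ∃ (k : ℕ) (T : Fin (k + 1) → ℝ) (x v : Fin (k + 1) → ℝ → E n),
    (∀ i, IsMaximalGeodesic R c (T i) (x i) (v i)) ∧ IsClosedBroken T x v ∧ l = ∑ i, T i}

/-- The length spectrum `lsp'(c)`: lengths of all periodic broken rays, where reflections at the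
inner boundary are allowed too. -/
def lspInner (n : ℕ) (R : ℝ) (c : ℝ → ℝ) : Set ℝ :=
  {l | ∃ (k : ℕ) (T : Fin (k + 1) → ℝ) (x v : Fin (k + 1) → ℝ → E n),
    (∀ i, IsBoundarySegment R c (T i) (x i) (v i)) ∧ IsClosedBroken T x v ∧ l = ∑ i, T i}

/-- `J`, with derivative `J'`, is a Jacobi field along the geodesic `x` with velocity `v`. The Jacobi
equation is written in Cartesian coordinates, where it is the linearization of the geodesic equation
`x'' = accel x x'`. As `c'` is only Lipschitz, it is required for almost every time, and `J'` is
required to be Lipschitz. -/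
structure IsJacobiField {n : ℕ} (R : ℝ) (c : ℝ → ℝ) (T : ℝ) (x v J J' : ℝ → E n) : Prop where
  hasDeriv : ∀ t ∈ Icc 0 T, HasDerivWithinAt J (J' t) (Icc 0 T) t
  lipschitz : ∃ K : ℝ≥0, LipschitzOnWith K J' (Icc 0 T)
  jacobi : ∀ᵐ t : ℝ, t ∈ Ioo 0 T →
    HasDerivAt J' (fderiv ℝ (fun q : E n × E n => accel R c q.1 q.2) (x t, v t) (J t, J' t)) t

/-- The end points of the geodesic `x : [0, T] → ℝⁿ` are conjugate along it: some nontrivial Jacobi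
field vanishes at both of them. -/
def EndpointsConjugate {n : ℕ} (R : ℝ) (c : ℝ → ℝ) (T : ℝ) (x v : ℝ → E n) : Prop :=
  ∃ J J' : ℝ → E n, IsJacobiField R c T x v J J' ∧
    J 0 = 0 ∧ J T = 0 ∧ ∃ t ∈ Icc 0 T, J t ≠ 0

/-- The radius of a curve on `[0, T]`, its Euclidean distance to the origin, is `r`. -/
def HasRadius {n : ℕ} (T : ℝ) (x : ℝ → E n) (r : ℝ) : Prop :=
  IsLeast ((fun t => ‖x t‖) '' Icc 0 T) r

/-- The countable conjugacy condition: only for countably many `r ∈ (R, 1)` the end points of the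
maximal geodesic of radius `r` (unique up to rotations and reversal) are conjugate along it. -/
def CountableConjugacy (n : ℕ) (R : ℝ) (c : ℝ → ℝ) : Prop :=
  {r : ℝ | r ∈ Ioo R 1 ∧ ∃ (T : ℝ) (x v : ℝ → E n),
    IsMaximalGeodesic R c T x v ∧ HasRadius T x r ∧ EndpointsConjugate R c T x v}.Countable

end RadialSpeed

end

open Set MeasureTheory Filter Topology
open scoped NNReal ContDiff

namespace RadialSpeed

/-! Put ρ(r) = r / c(r). Along a unit speed geodesic the slant y = ⟨x, v⟩ / c² has derivative c ρ',
which is positive by the Herglotz condition, and p² = ρ² - y², the squared angular momentum, is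
conserved. Hence the radius can only decrease and then increase, and a segment between boundary
points consists of one or two monotone halves. Each half has length L(p)/2 and, for p > 0, sweeps
the angle α(p)/2, where L is `travelTime` and α is `openingAngle`. Reflections preserve p and the
plane of motion, so for p > 0 the length of a periodic broken ray is (j/2) L(p) with (j/2) α(p) =
2πm.

The intercept time I(p) = 2 ∫ √(ρ² - p²) ds/s satisfies I' = -α and L = I + pα. The lengths with p >
0 are therefore critical values of the functions (j/2) I(p) + 2πmp, those with p = 0 are countably
many, and the spectrum is a null set by the one-dimensional Sard theorem
(`Admissible.volume_lengths_eq_zero`). Conversely, each p in (ρ(R), ρ(1)) with (k+1) α(p) = 2πm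
gives the length (k+1) L(p) (`Admissible.mem_lsp`).

The conjugacy condition prevents α from being constant on an interval
(`Admissible.exists_openingAngle_ne`). Otherwise L would be constant there too, the geodesics from
one boundary point would meet again at one point at one time, and differentiation in p would give a
Jacobi field vanishing at both ends for almost every p.

Now let the speed vary. On any interval of p one can therefore choose k, m and a sign such that Φ(τ,
p) = ±((k+1) I(τ, p) + 2πmp) has its maximum over a subinterval in the interior. For τ near a given
τ₀ the maximum value is, up to sign, a length of the spectrum. It is continuous in τ with values in
a null set, hence constant, and so at a maximizing p for τ₀ the derivative of I in τ vanishes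
(`exists_isLocalMax_param`). This derivative is the Abel-type transform of -s ∂c/∂τ / c³. It
vanishes for a dense set of p, hence for all p by continuity, and injectivity of the transform
(`Admissible.eq_zero_of_abel`) gives ∂c/∂τ = 0. -/

/-! ### Admissible sound speeds and the Herglotz function -/

/-- The hypotheses on a single sound speed on `[R, 1]` which do not involve conjugate points. -/
structure Admissible (R : ℝ) (c : ℝ → ℝ) : Prop where
  R_nonneg : 0 ≤ R
  R_lt_one : R < 1
  pos : ∀ r ∈ Icc R 1, 0 < c r
  c11 : IsC11On c (Icc R 1)
  herglotz : Herglotz R c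
  deriv_zero : R = 0 → derivWithin c (Icc R 1) 0 = 0

/-- The Herglotz function `r / c r`. -/
noncomputable def rho (c : ℝ → ℝ) (r : ℝ) : ℝ := r / c r

/-- The derivative of the Herglotz function on `[R, 1]`. -/
noncomputable def rhoDeriv (R : ℝ) (c : ℝ → ℝ) (r : ℝ) : ℝ :=
  (c r - r * derivWithin c (Icc R 1) r) / c r ^ 2

namespace Admissible

variable {R : ℝ} {c : ℝ → ℝ}

theorem hasDeriv (h : Admissible R c) {r : ℝ} (hr : r ∈ Icc R 1) :
    HasDerivWithinAt c (derivWithin c (Icc R 1) r) (Icc R 1) r :=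
  (h.c11.1 r hr).hasDerivWithinAt

theorem uniqueDiff (h : Admissible R c) : UniqueDiffOn ℝ (Icc R 1) := uniqueDiffOn_Icc h.R_lt_one

theorem continuousOn (h : Admissible R c) : ContinuousOn c (Icc R 1) := h.c11.1.continuousOn

theorem continuousOn_deriv (h : Admissible R c) :
    ContinuousOn (derivWithin c (Icc R 1)) (Icc R 1) := by
  obtain ⟨K, hK⟩ := h.c11.2
  exact hK.continuousOn

theorem hasDeriv_rho (h : Admissible R c) {r : ℝ} (hr : r ∈ Icc R 1) :
    HasDerivWithinAt (rho c) (rhoDeriv R c r) (Icc R 1) r := by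
  have := (hasDerivWithinAt_id r (Icc R 1)).div (h.hasDeriv hr) (h.pos r hr).ne'
  exact this.congr_deriv (by simp [rhoDeriv])

theorem rhoDeriv_pos (h : Admissible R c) {r : ℝ} (hr : r ∈ Icc R 1) : 0 < rhoDeriv R c r := by
  have := h.herglotz r hr
  rwa [show (fun s => s / c s) = rho c from rfl,
    (h.hasDeriv_rho hr).derivWithin (h.uniqueDiff r hr)] at this

theorem continuousOn_rhoDeriv (h : Admissible R c) : ContinuousOn (rhoDeriv R c) (Icc R 1) :=
  (h.continuousOn.sub (continuousOn_id.mul h.continuousOn_deriv)).div (h.continuousOn.pow 2)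
    fun r hr => pow_ne_zero _ (h.pos r hr).ne'

theorem continuousOn_rho (h : Admissible R c) : ContinuousOn (rho c) (Icc R 1) :=
  fun _ hr => (h.hasDeriv_rho hr).continuousWithinAt

theorem exists_slope (h : Admissible R c) : ∃ δ > 0, ∀ r ∈ Icc R 1, δ ≤ rhoDeriv R c r := by
  obtain ⟨r, hr, hmin⟩ := isCompact_Icc.exists_isMinOn (nonempty_Icc.2 h.R_lt_one.le)
    h.continuousOn_rhoDeriv
  exact ⟨_, h.rhoDeriv_pos hr, hmin⟩

/-- This linear bound is what later compares the singularity of 1/√(ρ² - p²) with that of 1/√|s -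
r₀|. -/
theorem exists_rho_sub_ge (h : Admissible R c) :
    ∃ δ > 0, ∀ r ∈ Icc R 1, ∀ s ∈ Icc R 1, r ≤ s → δ * (s - r) ≤ rho c s - rho c r := by
  obtain ⟨δ, hδ, hle⟩ := h.exists_slope
  refine ⟨δ, hδ, fun r hr s hs hrs => ?_⟩
  have hmono : MonotoneOn (fun x => rho c x - δ * x) (Icc R 1) := by
    refine monotoneOn_of_hasDerivWithinAt_nonneg (f' := fun x => rhoDeriv R c x - δ)
      (convex_Icc _ _) (h.continuousOn_rho.sub (by fun_prop)) ?_ ?_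
    · intro x hx
      have hx' := interior_subset hx
      have := (h.hasDeriv_rho hx').sub (((hasDerivWithinAt_id x (Icc R 1)).const_mul δ))
      exact (this.mono interior_subset).congr_deriv (by simp)
    · intro x hx
      exact sub_nonneg.2 (hle x (interior_subset hx))
  have := hmono hr hs hrs
  simp only at this
  linarith

theorem strictMonoOn_rho (h : Admissible R c) : StrictMonoOn (rho c) (Icc R 1) := by
  obtain ⟨δ, hδ, hle⟩ := h.exists_rho_sub_ge
  intro r hr s hs hrs
  have := hle r hr s hs hrs.le
  nlinarith [mul_pos hδ (sub_pos.2 hrs)]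

theorem rho_nonneg (h : Admissible R c) {r : ℝ} (hr : r ∈ Icc R 1) : 0 ≤ rho c r :=
  div_nonneg (h.R_nonneg.trans hr.1) (h.pos r hr).le

theorem left_mem (h : Admissible R c) : R ∈ Icc R 1 := left_mem_Icc.2 h.R_lt_one.le
theorem right_mem (h : Admissible R c) : 1 ∈ Icc R 1 := right_mem_Icc.2 h.R_lt_one.le

theorem nonneg_of_mem (h : Admissible R c) {r : ℝ} (hr : r ∈ Icc R 1) : 0 ≤ r :=
  h.R_nonneg.trans hr.1

theorem one_sub_eq (h : Admissible R c) {r : ℝ} (hr : r ∈ Icc R 1) :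
    1 - derivWithin c (Icc R 1) r * r / c r = c r * rhoDeriv R c r := by
  have := (h.pos r hr).ne'
  unfold rhoDeriv
  field_simp

end Admissible

/-! ### Slant and angular momentum along a geodesic -/

/-- The variable `⟨x, v⟩ / c²`, the signed square root of `rho² - p²` along a geodesic. -/
noncomputable def slantY {n : ℕ} (c : ℝ → ℝ) (x v : E n) : ℝ := inner ℝ x v / c ‖x‖ ^ 2

/-- The conserved quantity of a unit speed geodesic, the square of its angular momentum. -/
noncomputable def momSq {n : ℕ} (c : ℝ → ℝ) (x v : E n) : ℝ := rho c ‖x‖ ^ 2 - slantY c x v ^ 2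

namespace IsUnitGeodesic

variable {n : ℕ} {R : ℝ} {c : ℝ → ℝ} {T : ℝ} {x v : ℝ → E n}

theorem pos_speed (hx : IsUnitGeodesic R c T x v) (h : Admissible R c) {t : ℝ}
    (ht : t ∈ Icc 0 T) : 0 < c ‖x t‖ := h.pos _ (hx.mem t ht)

theorem continuousOn_x (hx : IsUnitGeodesic R c T x v) : ContinuousOn x (Icc 0 T) :=
  fun t ht => (hx.hasDeriv t ht).continuousWithinAt

theorem hasDeriv_norm (hx : IsUnitGeodesic R c T x v) {t : ℝ} (ht : t ∈ Icc 0 T)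
    (h0 : x t ≠ 0) :
    HasDerivWithinAt (fun s => ‖x s‖) (inner ℝ (x t) (v t) / ‖x t‖) (Icc 0 T) t := by
  have h1 := (hx.hasDeriv t ht).inner ℝ (hx.hasDeriv t ht)
  have hne : (inner ℝ (x t) (x t) : ℝ) ≠ 0 := by simpa using h0
  have h2 := h1.sqrt hne
  have e : ∀ s, √(inner ℝ (x s) (x s) : ℝ) = ‖x s‖ := fun s => by
    rw [real_inner_self_eq_norm_sq, Real.sqrt_sq (norm_nonneg _)]
  simp only [e] at h2
  refine h2.congr_deriv ?_
  rw [real_inner_comm (x t) (v t)]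
  ring

/-- At the origin |x| need not be differentiable, but c'(0) = 0 and |x(s)| = O(s - t) still give
derivative 0. The formula agrees, since division by zero gives zero. -/
theorem hasDeriv_speed (hx : IsUnitGeodesic R c T x v) (h : Admissible R c) {t : ℝ}
    (ht : t ∈ Icc 0 T) :
    HasDerivWithinAt (fun s => c ‖x s‖)
      (derivWithin c (Icc R 1) ‖x t‖ * (inner ℝ (x t) (v t) / ‖x t‖)) (Icc 0 T) t := by
  by_cases h0 : x t = 0
  · have hR : R = 0 := by
      have := (hx.mem t ht).1
      rw [h0, norm_zero] at this
      exact le_antisymm this h.R_nonneg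
    have hd := h.hasDeriv (hx.mem t ht)
    rw [h0, norm_zero, h.deriv_zero hR] at hd
    rw [h0]
    simp only [norm_zero, inner_zero_left, zero_div, mul_zero]
    rw [hasDerivWithinAt_iff_isLittleO] at hd ⊢
    simp only [sub_zero, smul_zero] at hd ⊢
    have hcont : Tendsto (fun s => ‖x s‖) (𝓝[Icc 0 T] t) (𝓝[Icc R 1] 0) := by
      refine tendsto_nhdsWithin_iff.2 ⟨?_, ?_⟩
      · have := (hx.hasDeriv t ht).continuousWithinAt.norm
        rw [ContinuousWithinAt, h0, norm_zero] at this
        exact this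
      · filter_upwards [self_mem_nhdsWithin] with s hs using hx.mem s hs
    have h1 := hd.comp_tendsto hcont
    have h2 : (fun s => ‖x s‖) =O[𝓝[Icc 0 T] t] fun s => s - t := by
      have := (hx.hasDeriv t ht).hasFDerivWithinAt.isBigO_sub
      simpa [h0] using this.norm_left
    simpa [Function.comp_def, h0] using h1.trans_isBigO h2
  · exact (h.hasDeriv (hx.mem t ht)).comp t (hx.hasDeriv_norm ht h0) fun s hs => hx.mem s hs

theorem hasDeriv_inner (hx : IsUnitGeodesic R c T x v) {t : ℝ} (ht : t ∈ Icc 0 T) :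
    HasDerivWithinAt (fun s => (inner ℝ (x s) (v s) : ℝ))
      (c ‖x t‖ ^ 2 + derivWithin c (Icc R 1) ‖x t‖ / (c ‖x t‖ * ‖x t‖) *
        (2 * inner ℝ (x t) (v t) ^ 2 - c ‖x t‖ ^ 2 * ‖x t‖ ^ 2)) (Icc 0 T) t := by
  have h1 := (hx.hasDeriv t ht).inner ℝ (hx.geodesic t ht)
  refine h1.congr_deriv ?_
  rw [accel, inner_smul_right, inner_sub_right, inner_smul_right, inner_smul_right,
    real_inner_self_eq_norm_sq, real_inner_self_eq_norm_sq, hx.unit_speed t ht]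
  ring

/-- The derivative is positive by the Herglotz condition, so the slant changes sign at most once: a
geodesic has at most one turning point. -/
theorem hasDeriv_slantY (hx : IsUnitGeodesic R c T x v) (h : Admissible R c) {t : ℝ}
    (ht : t ∈ Icc 0 T) :
    HasDerivWithinAt (fun s => slantY c (x s) (v s)) (c ‖x t‖ * rhoDeriv R c ‖x t‖)
      (Icc 0 T) t := by
  have hc := hx.pos_speed h ht
  have h1 := (hx.hasDeriv_inner ht).div ((hx.hasDeriv_speed h ht).pow 2) (pow_ne_zero 2 hc.ne')
  refine HasDerivWithinAt.congr_deriv h1 ?_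
  rw [← h.one_sub_eq (hx.mem t ht)]
  by_cases h0 : ‖x t‖ = 0
  · rw [h0] at hc
    simp [h0]
    field_simp
  · simp only [Nat.cast_ofNat, Nat.add_one_sub_one, pow_one, Pi.pow_apply]
    field_simp
    ring

/-- This quantity is |x ∧ v|² / c⁴, conserved by rotational symmetry. The derivative is checked
directly, also at a passage through the origin. -/
theorem momSq_eq (hx : IsUnitGeodesic R c T x v) (h : Admissible R c) {t : ℝ}
    (ht : t ∈ Icc 0 T) : momSq c (x t) (v t) = momSq c (x 0) (v 0) := by
  have hd : ∀ s ∈ Icc 0 T, HasDerivWithinAt (fun s => momSq c (x s) (v s)) 0 (Icc 0 T) s := by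
    intro s hs
    have hc := hx.pos_speed h hs
    have h1 := ((hx.hasDeriv s hs).inner ℝ (hx.hasDeriv s hs)).div
      ((hx.hasDeriv_speed h hs).pow 2) (pow_ne_zero 2 hc.ne')
    have h2 := h1.sub ((hx.hasDeriv_slantY h hs).pow 2)
    refine (h2.congr_of_mem (fun u _ => ?_) hs).congr_deriv ?_
    · simp [momSq, rho, div_pow]
    · rw [← h.one_sub_eq (hx.mem s hs), real_inner_comm (x s) (v s)]
      simp only [Nat.cast_ofNat, Nat.add_one_sub_one, pow_one, Pi.pow_apply,
        real_inner_self_eq_norm_sq, slantY]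
      by_cases h0 : ‖x s‖ = 0
      · have : x s = 0 := by simpa using h0
        simp [this]
      · field_simp
        ring
  exact constant_of_has_deriv_right_zero (fun s hs => (hd s hs).continuousWithinAt)
    (fun s hs => ((hd s (Ico_subset_Icc_self hs)).mono_of_mem_nhdsWithin
      (Icc_mem_nhdsGE_of_mem hs))) t ht

end IsUnitGeodesic

/-! ### Travel time and opening angle as integrals over the radius -/

/-- Length of the maximal geodesic of angular momentum `p` (twice the time needed to cross the
annulus if `p` is too small for a turning point). -/
noncomputable def travelTime (R : ℝ) (c : ℝ → ℝ) (p : ℝ) : ℝ :=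
  2 * ∫ s in Ioo R 1, rho c s ^ 2 / (s * √(rho c s ^ 2 - p ^ 2))

/-- Opening angle of the maximal geodesic of angular momentum `p`. -/
noncomputable def openingAngle (R : ℝ) (c : ℝ → ℝ) (p : ℝ) : ℝ :=
  2 * ∫ s in Ioo R 1, p / (s * √(rho c s ^ 2 - p ^ 2))

theorem image_Ioo_of_strictMonoOn {f : ℝ → ℝ} {a b : ℝ} (hab : a < b)
    (hf : ContinuousOn f (Icc a b)) (hm : StrictMonoOn f (Icc a b)) :
    f '' Ioo a b = Ioo (f a) (f b) := by
  apply Subset.antisymm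
  · rintro _ ⟨t, ht, rfl⟩
    exact ⟨hm (left_mem_Icc.2 hab.le) (Ioo_subset_Icc_self ht) ht.1,
      hm (Ioo_subset_Icc_self ht) (right_mem_Icc.2 hab.le) ht.2⟩
  · exact intermediate_value_Ioo hab.le hf

theorem image_Ioo_of_strictAntiOn {f : ℝ → ℝ} {a b : ℝ} (hab : a < b)
    (hf : ContinuousOn f (Icc a b)) (hm : StrictAntiOn f (Icc a b)) :
    f '' Ioo a b = Ioo (f b) (f a) := by
  apply Subset.antisymm
  · rintro _ ⟨t, ht, rfl⟩
    exact ⟨hm (Ioo_subset_Icc_self ht) (right_mem_Icc.2 hab.le) ht.2,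
      hm (left_mem_Icc.2 hab.le) (Ioo_subset_Icc_self ht) ht.1⟩
  · exact intermediate_value_Ioo' hab.le hf

/-- Below the turning radius the square root of a negative number is 0, and division by it gives 0.
The integrals can thus be taken over all of (R, 1) without reference to the turning point. -/
theorem Admissible.setIntegral_eq {R : ℝ} {c : ℝ → ℝ} (h : Admissible R c) {p r₀ : ℝ}
    (hr₀ : r₀ ∈ Icc R 1) (hr : r₀ = R ∨ rho c r₀ ^ 2 ≤ p ^ 2) (f : ℝ → ℝ) :
    ∫ s in Ioo R 1, f s / (s * √(rho c s ^ 2 - p ^ 2)) =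
      ∫ s in Ioo r₀ 1, f s / (s * √(rho c s ^ 2 - p ^ 2)) := by
  refine setIntegral_eq_of_subset_of_forall_sdiff_eq_zero measurableSet_Ioo
    (Ioo_subset_Ioo_left hr₀.1) fun s hs => ?_
  have hs1 := hs.1
  have hsr : s ≤ r₀ := by
    by_contra! hlt
    exact hs.2 ⟨hlt, hs1.2⟩
  rcases hr with rfl | hr
  · exact absurd hs1.1 hsr.not_gt
  · have hmono := h.strictMonoOn_rho.monotoneOn (Ioo_subset_Icc_self hs1) hr₀ hsr
    have h0 := h.rho_nonneg (Ioo_subset_Icc_self hs1)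
    rw [Real.sqrt_eq_zero_of_nonpos (by nlinarith)]
    simp

namespace IsUnitGeodesic

variable {n : ℕ} {R : ℝ} {c : ℝ → ℝ} {T : ℝ} {x v : ℝ → E n}

theorem inner_eq (hx : IsUnitGeodesic R c T x v) (h : Admissible R c) {t : ℝ}
    (ht : t ∈ Icc 0 T) : inner ℝ (x t) (v t) = c ‖x t‖ ^ 2 * slantY c (x t) (v t) := by
  have := hx.pos_speed h ht
  unfold slantY
  field_simp

theorem slantY_strictMonoOn (hx : IsUnitGeodesic R c T x v) (h : Admissible R c) :
    StrictMonoOn (fun t => slantY c (x t) (v t)) (Icc 0 T) := by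
  refine strictMonoOn_of_hasDerivWithinAt_pos
    (f' := fun t => c ‖x t‖ * rhoDeriv R c ‖x t‖) (convex_Icc _ _)
    (fun t ht => (hx.hasDeriv_slantY h ht).continuousWithinAt) ?_ ?_
  · exact fun t ht => (hx.hasDeriv_slantY h (interior_subset ht)).mono interior_subset
  · intro t ht
    have ht' := interior_subset ht
    exact mul_pos (hx.pos_speed h ht') (h.rhoDeriv_pos (hx.mem t ht'))

theorem continuousOn_slantY (hx : IsUnitGeodesic R c T x v) (h : Admissible R c) :
    ContinuousOn (fun t => slantY c (x t) (v t)) (Icc 0 T) :=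
  fun _ ht => (hx.hasDeriv_slantY h ht).continuousWithinAt

/-- Conservation of angular momentum. -/
theorem sq_sub_sq (hx : IsUnitGeodesic R c T x v) (h : Admissible R c) {p : ℝ}
    (hp : momSq c (x 0) (v 0) = p ^ 2) {t : ℝ} (ht : t ∈ Icc 0 T) :
    rho c ‖x t‖ ^ 2 - p ^ 2 = slantY c (x t) (v t) ^ 2 := by
  have := hx.momSq_eq h ht
  rw [hp, momSq] at this
  linarith

theorem ne_zero_of_slantY_ne {t : ℝ} (h0 : slantY c (x t) (v t) ≠ 0) : x t ≠ 0 := by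
  intro hx0
  simp [slantY, hx0] at h0

theorem hasDeriv_norm' (hx : IsUnitGeodesic R c T x v) (h : Admissible R c) {t : ℝ}
    (ht : t ∈ Icc 0 T) (h0 : x t ≠ 0) :
    HasDerivWithinAt (fun s => ‖x s‖) (c ‖x t‖ ^ 2 * slantY c (x t) (v t) / ‖x t‖)
      (Icc 0 T) t := by
  rw [← hx.inner_eq h ht]
  exact hx.hasDeriv_norm ht h0

/-- Substitution s = |x(t)|: the factor |y| in ds/dt = c² y / r cancels √(ρ² - p²) = |y|. With f =
ρ² the right side is elapsed time, with f = p it is the swept angle. -/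
theorem setIntegral_of_image (hx : IsUnitGeodesic R c T x v) (h : Admissible R c) {p : ℝ}
    (hp : momSq c (x 0) (v 0) = p ^ 2) {a b r₀ : ℝ} (hsub : Ioo a b ⊆ Icc 0 T)
    (hne : ∀ t ∈ Ioo a b, slantY c (x t) (v t) ≠ 0)
    (hinj : InjOn (fun t => ‖x t‖) (Ioo a b))
    (himg : (fun t => ‖x t‖) '' Ioo a b = Ioo r₀ 1) (f : ℝ → ℝ) :
    ∫ s in Ioo r₀ 1, f s / (s * √(rho c s ^ 2 - p ^ 2)) =
      ∫ t in Ioo a b, f ‖x t‖ * (c ‖x t‖ ^ 2 / ‖x t‖ ^ 2) := by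
  rw [← himg, integral_image_eq_integral_abs_deriv_smul measurableSet_Ioo
    (fun t ht => (hx.hasDeriv_norm' h (hsub ht)
      (ne_zero_of_slantY_ne (hne t ht))).mono hsub) hinj]
  refine setIntegral_congr_fun measurableSet_Ioo fun t ht => ?_
  have hpos : 0 < ‖x t‖ := norm_pos_iff.2 (ne_zero_of_slantY_ne (hne t ht))
  have hy := abs_pos.2 (hne t ht)
  simp only [smul_eq_mul]
  rw [hx.sq_sub_sq h hp (hsub ht), Real.sqrt_sq_eq_abs, abs_div, abs_mul, abs_of_pos hpos,
    abs_of_nonneg (sq_nonneg (c ‖x t‖))]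
  field_simp

theorem continuousOn_norm (hx : IsUnitGeodesic R c T x v) :
    ContinuousOn (fun t => ‖x t‖) (Icc 0 T) := hx.continuousOn_x.norm

theorem setIntegral_outgoing (hx : IsUnitGeodesic R c T x v) (h : Admissible R c) {p : ℝ}
    (hp : momSq c (x 0) (v 0) = p ^ 2) {a b : ℝ} (ha : 0 ≤ a) (hab : a < b) (hb : b ≤ T)
    (hy : ∀ t ∈ Ioo a b, 0 < slantY c (x t) (v t)) (hb1 : ‖x b‖ = 1)
    (ha1 : ‖x a‖ = R ∨ slantY c (x a) (v a) = 0) (f : ℝ → ℝ) :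
    ∫ s in Ioo R 1, f s / (s * √(rho c s ^ 2 - p ^ 2)) =
      ∫ t in Ioo a b, f ‖x t‖ * (c ‖x t‖ ^ 2 / ‖x t‖ ^ 2) := by
  have hsub : Icc a b ⊆ Icc 0 T := Icc_subset_Icc ha hb
  have hIoo := Ioo_subset_Icc_self.trans hsub
  have hne := fun t ht => (hy t ht).ne'
  have hmono : StrictMonoOn (fun t => ‖x t‖) (Icc a b) := by
    refine strictMonoOn_of_hasDerivWithinAt_pos
      (f' := fun t => c ‖x t‖ ^ 2 * slantY c (x t) (v t) / ‖x t‖) (convex_Icc _ _)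
      (hx.continuousOn_norm.mono hsub) ?_ ?_
    · rw [interior_Icc]
      exact fun t ht => (hx.hasDeriv_norm' h (hIoo ht)
        (ne_zero_of_slantY_ne (hne t ht))).mono hIoo
    · rw [interior_Icc]
      intro t ht
      have := hx.pos_speed h (hIoo ht)
      have := norm_pos_iff.2 (ne_zero_of_slantY_ne (hne t ht))
      have := hy t ht
      positivity
  have haI := hsub (left_mem_Icc.2 hab.le)
  rw [h.setIntegral_eq (hx.mem a haI) (ha1.imp id fun h0 => ?_) f]
  · refine hx.setIntegral_of_image h hp hIoo hne (hmono.injOn.mono Ioo_subset_Icc_self) ?_ f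
    rw [image_Ioo_of_strictMonoOn hab (hx.continuousOn_norm.mono hsub) hmono, hb1]
  · have := hx.sq_sub_sq h hp haI
    rw [h0] at this
    linarith

theorem setIntegral_ingoing (hx : IsUnitGeodesic R c T x v) (h : Admissible R c) {p : ℝ}
    (hp : momSq c (x 0) (v 0) = p ^ 2) {a b : ℝ} (ha : 0 ≤ a) (hab : a < b) (hb : b ≤ T)
    (hy : ∀ t ∈ Ioo a b, slantY c (x t) (v t) < 0) (ha1 : ‖x a‖ = 1)
    (hb1 : ‖x b‖ = R ∨ slantY c (x b) (v b) = 0) (f : ℝ → ℝ) :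
    ∫ s in Ioo R 1, f s / (s * √(rho c s ^ 2 - p ^ 2)) =
      ∫ t in Ioo a b, f ‖x t‖ * (c ‖x t‖ ^ 2 / ‖x t‖ ^ 2) := by
  have hsub : Icc a b ⊆ Icc 0 T := Icc_subset_Icc ha hb
  have hIoo := Ioo_subset_Icc_self.trans hsub
  have hne := fun t ht => (hy t ht).ne
  have hmono : StrictAntiOn (fun t => ‖x t‖) (Icc a b) := by
    refine strictAntiOn_of_hasDerivWithinAt_neg
      (f' := fun t => c ‖x t‖ ^ 2 * slantY c (x t) (v t) / ‖x t‖) (convex_Icc _ _)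
      (hx.continuousOn_norm.mono hsub) ?_ ?_
    · rw [interior_Icc]
      exact fun t ht => (hx.hasDeriv_norm' h (hIoo ht)
        (ne_zero_of_slantY_ne (hne t ht))).mono hIoo
    · rw [interior_Icc]
      intro t ht
      have := hx.pos_speed h (hIoo ht)
      have := norm_pos_iff.2 (ne_zero_of_slantY_ne (hne t ht))
      exact div_neg_of_neg_of_pos (mul_neg_of_pos_of_neg (by positivity) (hy t ht)) this
  have hbI := hsub (right_mem_Icc.2 hab.le)
  rw [h.setIntegral_eq (hx.mem b hbI) (hb1.imp id fun h0 => ?_) f]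
  · refine hx.setIntegral_of_image h hp hIoo hne (hmono.injOn.mono Ioo_subset_Icc_self) ?_ f
    rw [image_Ioo_of_strictAntiOn hab (hx.continuousOn_norm.mono hsub) hmono, ha1]
  · have := hx.sq_sub_sq h hp hbI
    rw [h0] at this
    linarith

end IsUnitGeodesic

/-- The direction `x / |x|`. -/
noncomputable def radialDir {n : ℕ} (x : E n) : E n := ‖x‖⁻¹ • x

/-- The angular part of the velocity, scaled to the length of the angular momentum. -/
noncomputable def angularDir {n : ℕ} (c : ℝ → ℝ) (x v : E n) : E n :=
  (‖x‖ / c ‖x‖ ^ 2) • v - (slantY c x v / ‖x‖) • x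

namespace IsUnitGeodesic

variable {n : ℕ} {R : ℝ} {c : ℝ → ℝ} {T : ℝ} {x v : ℝ → E n}

theorem continuousOn_speed (hx : IsUnitGeodesic R c T x v) (h : Admissible R c) :
    ContinuousOn (fun t => c ‖x t‖) (Icc 0 T) :=
  fun _ ht => (hx.hasDeriv_speed h ht).continuousWithinAt

theorem norm_pos (hx : IsUnitGeodesic R c T x v) (h : Admissible R c) {p : ℝ} (hp0 : 0 < p)
    (hp : momSq c (x 0) (v 0) = p ^ 2) {t : ℝ} (ht : t ∈ Icc 0 T) : 0 < ‖x t‖ := by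
  rw [norm_pos_iff]
  intro h0
  have := hx.sq_sub_sq h hp ht
  rw [h0] at this
  simp only [rho, norm_zero, zero_div] at this
  nlinarith [sq_nonneg (slantY c (x t) (v t))]

theorem setIntegral_sq_rho (hx : IsUnitGeodesic R c T x v) (h : Admissible R c) {a b : ℝ}
    (hab : a < b) (hsub : Ioo a b ⊆ Icc 0 T)
    (hne : ∀ t ∈ Ioo a b, slantY c (x t) (v t) ≠ 0) :
    ∫ t in Ioo a b, rho c ‖x t‖ ^ 2 * (c ‖x t‖ ^ 2 / ‖x t‖ ^ 2) = b - a := by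
  have : ∀ t ∈ Ioo a b, rho c ‖x t‖ ^ 2 * (c ‖x t‖ ^ 2 / ‖x t‖ ^ 2) = 1 := by
    intro t ht
    have h1 := hx.pos_speed h (hsub ht)
    have h2 := norm_pos_iff.2 (ne_zero_of_slantY_ne (hne t ht))
    unfold rho
    field_simp
  rw [setIntegral_congr_fun measurableSet_Ioo this]
  simp [hab.le]

theorem continuousOn_angularSpeed (hx : IsUnitGeodesic R c T x v) (h : Admissible R c) {p : ℝ}
    (hp0 : 0 < p) (hp : momSq c (x 0) (v 0) = p ^ 2) :
    ContinuousOn (fun t => p * (c ‖x t‖ ^ 2 / ‖x t‖ ^ 2)) (Icc 0 T) :=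
  continuousOn_const.mul (((hx.continuousOn_speed h).pow 2).div (hx.continuousOn_norm.pow 2)
    fun _ ht => pow_ne_zero 2 (hx.norm_pos h hp0 hp ht).ne')

/-! ### Decomposition of boundary segments into monotone halves -/

/-- A geodesic consisting of `j` halves (from the turning point, or the inner boundary, to the outer
boundary or conversely) of a geodesic of angular momentum `p`. -/
structure ConsistsOfHalves (R : ℝ) (c : ℝ → ℝ) (p T : ℝ) (x : ℝ → E n) (j : ℕ) : Prop where
  time : T = j / 2 * travelTime R c p
  angle : 0 < p → ∫ t in (0 : ℝ)..T, p * (c ‖x t‖ ^ 2 / ‖x t‖ ^ 2) = j / 2 * openingAngle R c p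

theorem half_outgoing (hx : IsUnitGeodesic R c T x v) (h : Admissible R c) {p : ℝ}
    (hp : momSq c (x 0) (v 0) = p ^ 2) {a b : ℝ} (ha : 0 ≤ a) (hab : a < b) (hb : b ≤ T)
    (hy : ∀ t ∈ Ioo a b, 0 < slantY c (x t) (v t)) (hb1 : ‖x b‖ = 1)
    (ha1 : ‖x a‖ = R ∨ slantY c (x a) (v a) = 0) :
    b - a = travelTime R c p / 2 ∧
      ∫ t in a..b, p * (c ‖x t‖ ^ 2 / ‖x t‖ ^ 2) = openingAngle R c p / 2 := by
  have hsub := Ioo_subset_Icc_self.trans (Icc_subset_Icc ha hb)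
  have key := hx.setIntegral_outgoing h hp ha hab hb hy hb1 ha1
  constructor
  · rw [← hx.setIntegral_sq_rho h hab hsub fun t ht => (hy t ht).ne',
      ← key (fun s => rho c s ^ 2), travelTime]
    ring
  · rw [intervalIntegral.integral_of_le hab.le, integral_Ioc_eq_integral_Ioo,
      ← key (fun _ => p), openingAngle]
    ring

theorem half_ingoing (hx : IsUnitGeodesic R c T x v) (h : Admissible R c) {p : ℝ}
    (hp : momSq c (x 0) (v 0) = p ^ 2) {a b : ℝ} (ha : 0 ≤ a) (hab : a < b) (hb : b ≤ T)
    (hy : ∀ t ∈ Ioo a b, slantY c (x t) (v t) < 0) (ha1 : ‖x a‖ = 1)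
    (hb1 : ‖x b‖ = R ∨ slantY c (x b) (v b) = 0) :
    b - a = travelTime R c p / 2 ∧
      ∫ t in a..b, p * (c ‖x t‖ ^ 2 / ‖x t‖ ^ 2) = openingAngle R c p / 2 := by
  have hsub := Ioo_subset_Icc_self.trans (Icc_subset_Icc ha hb)
  have key := hx.setIntegral_ingoing h hp ha hab hb hy ha1 hb1
  constructor
  · rw [← hx.setIntegral_sq_rho h hab hsub fun t ht => (hy t ht).ne,
      ← key (fun s => rho c s ^ 2), travelTime]
    ring
  · rw [intervalIntegral.integral_of_le hab.le, integral_Ioc_eq_integral_Ioo,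
      ← key (fun _ => p), openingAngle]
    ring

theorem slantY_lt (hx : IsUnitGeodesic R c T x v) (h : Admissible R c) :
    slantY c (x 0) (v 0) < slantY c (x T) (v T) :=
  hx.slantY_strictMonoOn h (left_mem_Icc.2 hx.pos.le) (right_mem_Icc.2 hx.pos.le) hx.pos

/-- A geodesic from the outer boundary to itself. -/
theorem outer_outer (hx : IsUnitGeodesic R c T x v) (h : Admissible R c) {p : ℝ} (hp0 : 0 ≤ p)
    (hp : momSq c (x 0) (v 0) = p ^ 2) (h0 : ‖x 0‖ = 1) (hT : ‖x T‖ = 1)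
    (hin : ∀ t ∈ Ioo 0 T, R = 0 ∨ R < ‖x t‖) :
    ConsistsOfHalves R c p T x 2 ∧ (R = 0 ∨ rho c R < p) ∧ p < rho c 1 := by
  have hlt := hx.slantY_lt h
  have m0 : (0 : ℝ) ∈ Icc 0 T := left_mem_Icc.2 hx.pos.le
  have mT : T ∈ Icc 0 T := right_mem_Icc.2 hx.pos.le
  have e0 := hx.sq_sub_sq h hp m0
  have eT := hx.sq_sub_sq h hp mT
  rw [h0] at e0
  rw [hT] at eT
  set y0 := slantY c (x 0) (v 0) with hy0
  set yT := slantY c (x T) (v T) with hyT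
  -- The two end points have the same ρ, so the slants agree up to sign; being strictly increasing,
  -- the slant must change sign.
  have hsum : y0 = -yT := by
    have : (y0 - yT) * (y0 + yT) = 0 := by nlinarith
    rcases mul_eq_zero.1 this with h1 | h1 <;> linarith
  have hyTpos : 0 < yT := by linarith
  obtain ⟨t₀, ht₀, hyt₀⟩ : (0 : ℝ) ∈ (fun t => slantY c (x t) (v t)) '' Ioo 0 T :=
    intermediate_value_Ioo hx.pos.le (hx.continuousOn_slantY h)
      ⟨by linarith, by linarith⟩
  simp only at hyt₀
  have mt₀ := Ioo_subset_Icc_self ht₀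
  have hmono := hx.slantY_strictMonoOn h
  have et := hx.sq_sub_sq h hp mt₀
  rw [hyt₀] at et
  have hρ : rho c ‖x t₀‖ = p := by
    have := h.rho_nonneg (hx.mem t₀ mt₀)
    nlinarith [sq_nonneg (rho c ‖x t₀‖ - p)]
  obtain ⟨i1, i2⟩ := hx.half_ingoing h hp le_rfl ht₀.1 ht₀.2.le
    (fun t ht => by
      have := hmono ⟨ht.1.le, (ht.2.trans ht₀.2).le⟩ mt₀ ht.2
      simp only at this
      linarith) h0 (Or.inr hyt₀)
  obtain ⟨o1, o2⟩ := hx.half_outgoing h hp ht₀.1.le ht₀.2 le_rfl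
    (fun t ht => by
      have := hmono mt₀ ⟨(ht₀.1.trans ht.1).le, ht.2.le⟩ ht.1
      simp only at this
      linarith) hT (Or.inr hyt₀)
  refine ⟨⟨by push_cast; linarith, fun hpp => ?_⟩, ?_, ?_⟩
  · have hc := hx.continuousOn_angularSpeed h hpp hp
    rw [← intervalIntegral.integral_add_adjacent_intervals (b := t₀), i2, o2]
    · push_cast; ring
    · exact (hc.mono (by rw [uIcc_of_le ht₀.1.le]; exact Icc_subset_Icc_right ht₀.2.le))
        |>.intervalIntegrable
    · exact (hc.mono (by rw [uIcc_of_le ht₀.2.le]; exact Icc_subset_Icc_left ht₀.1.le))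
        |>.intervalIntegrable
  · exact (hin t₀ ht₀).imp id fun hlt => hρ ▸ h.strictMonoOn_rho h.left_mem (hx.mem t₀ mt₀) hlt
  · have := h.rho_nonneg h.right_mem
    nlinarith

theorem outer_inner (hx : IsUnitGeodesic R c T x v) (h : Admissible R c) {p : ℝ} (hp0 : 0 ≤ p)
    (hp : momSq c (x 0) (v 0) = p ^ 2) (h0 : ‖x 0‖ = 1) (hT : ‖x T‖ = R)
    (hin : ∀ t ∈ Ioo 0 T, R < ‖x t‖) :
    ConsistsOfHalves R c p T x 1 ∧ p ≤ rho c R ∧ p < rho c 1 := by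
  have hlt := hx.slantY_lt h
  have m0 : (0 : ℝ) ∈ Icc 0 T := left_mem_Icc.2 hx.pos.le
  have mT : T ∈ Icc 0 T := right_mem_Icc.2 hx.pos.le
  have e0 := hx.sq_sub_sq h hp m0
  have eT := hx.sq_sub_sq h hp mT
  rw [h0] at e0
  rw [hT] at eT
  have hρ := h.strictMonoOn_rho h.left_mem h.right_mem h.R_lt_one
  have hρR := h.rho_nonneg h.left_mem
  set y0 := slantY c (x 0) (v 0) with hy0
  set yT := slantY c (x T) (v T) with hyT
  have hy0neg : y0 < 0 := by
    by_contra! hge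
    nlinarith
  have hsq : yT ^ 2 < y0 ^ 2 := by nlinarith
  -- If yT were positive, the slant would already have taken the value -yT, and there ρ would equal
  -- ρ(R): the geodesic would have met the inner boundary earlier.
  have hyTle : yT ≤ 0 := by
    by_contra! hpos
    obtain ⟨t, ht, hyt⟩ : -yT ∈ (fun t => slantY c (x t) (v t)) '' Ioo 0 T :=
      intermediate_value_Ioo hx.pos.le (hx.continuousOn_slantY h)
        ⟨by nlinarith, by linarith⟩
    simp only at hyt
    have et := hx.sq_sub_sq h hp (Ioo_subset_Icc_self ht)
    have := h.strictMonoOn_rho h.left_mem (hx.mem t (Ioo_subset_Icc_self ht)) (hin t ht)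
    rw [hyt] at et
    nlinarith
  obtain ⟨i1, i2⟩ := hx.half_ingoing h hp le_rfl hx.pos le_rfl
    (fun t ht => by
      have := hx.slantY_strictMonoOn h (Ioo_subset_Icc_self ht) mT ht.2
      simp only at this
      linarith) h0 (Or.inl hT)
  refine ⟨⟨by push_cast; linarith, fun _ => by rw [i2]; push_cast; ring⟩, ?_, ?_⟩
  · by_contra! hlt
    nlinarith [sq_nonneg yT]
  · nlinarith

/-- Time reversal of `outer_inner`. -/
theorem inner_outer (hx : IsUnitGeodesic R c T x v) (h : Admissible R c) {p : ℝ} (hp0 : 0 ≤ p)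
    (hp : momSq c (x 0) (v 0) = p ^ 2) (h0 : ‖x 0‖ = R) (hT : ‖x T‖ = 1)
    (hin : ∀ t ∈ Ioo 0 T, R < ‖x t‖) :
    ConsistsOfHalves R c p T x 1 ∧ p ≤ rho c R ∧ p < rho c 1 := by
  have hlt := hx.slantY_lt h
  have m0 : (0 : ℝ) ∈ Icc 0 T := left_mem_Icc.2 hx.pos.le
  have mT : T ∈ Icc 0 T := right_mem_Icc.2 hx.pos.le
  have e0 := hx.sq_sub_sq h hp m0
  have eT := hx.sq_sub_sq h hp mT
  rw [h0] at e0
  rw [hT] at eT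
  have hρ := h.strictMonoOn_rho h.left_mem h.right_mem h.R_lt_one
  have hρR := h.rho_nonneg h.left_mem
  set y0 := slantY c (x 0) (v 0) with hy0
  set yT := slantY c (x T) (v T) with hyT
  have hyTpos : 0 < yT := by
    by_contra! hge
    nlinarith
  have hsq : y0 ^ 2 < yT ^ 2 := by nlinarith
  have hy0ge : 0 ≤ y0 := by
    by_contra! hneg
    obtain ⟨t, ht, hyt⟩ : -y0 ∈ (fun t => slantY c (x t) (v t)) '' Ioo 0 T :=
      intermediate_value_Ioo hx.pos.le (hx.continuousOn_slantY h)
        ⟨by linarith, by nlinarith⟩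
    simp only at hyt
    have et := hx.sq_sub_sq h hp (Ioo_subset_Icc_self ht)
    have := h.strictMonoOn_rho h.left_mem (hx.mem t (Ioo_subset_Icc_self ht)) (hin t ht)
    rw [hyt] at et
    nlinarith
  obtain ⟨i1, i2⟩ := hx.half_outgoing h hp le_rfl hx.pos le_rfl
    (fun t ht => by
      have := hx.slantY_strictMonoOn h m0 (Ioo_subset_Icc_self ht) ht.1
      simp only at this
      linarith) hT (Or.inl h0)
  refine ⟨⟨by push_cast; linarith, fun _ => by rw [i2]; push_cast; ring⟩, ?_, ?_⟩
  · by_contra! hlt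
    nlinarith [sq_nonneg y0]
  · nlinarith

/-- Equal end radii force a zero of the slant in between. There ρ² = p² ≤ ρ(R)², although the radius
exceeds R and ρ is increasing. -/
theorem not_inner_inner (hx : IsUnitGeodesic R c T x v) (h : Admissible R c)
    (h0 : ‖x 0‖ = R) (hT : ‖x T‖ = R) (hin : ∀ t ∈ Ioo 0 T, R < ‖x t‖) : False := by
  have hlt := hx.slantY_lt h
  have e0 : momSq c (x 0) (v 0) = rho c R ^ 2 - slantY c (x 0) (v 0) ^ 2 := by rw [momSq, h0]
  have eT : momSq c (x 0) (v 0) = rho c R ^ 2 - slantY c (x T) (v T) ^ 2 := by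
    rw [← hx.momSq_eq h (right_mem_Icc.2 hx.pos.le), momSq, hT]
  set y0 := slantY c (x 0) (v 0) with hy0
  set yT := slantY c (x T) (v T) with hyT
  have hsum : y0 = -yT := by
    have : (y0 - yT) * (y0 + yT) = 0 := by nlinarith
    rcases mul_eq_zero.1 this with h1 | h1 <;> linarith
  obtain ⟨t, ht, hyt⟩ : (0 : ℝ) ∈ (fun t => slantY c (x t) (v t)) '' Ioo 0 T :=
    intermediate_value_Ioo hx.pos.le (hx.continuousOn_slantY h)
      ⟨by linarith, by linarith⟩
  simp only at hyt
  have et := hx.momSq_eq h (Ioo_subset_Icc_self ht)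
  rw [momSq, hyt] at et
  have hρR := h.rho_nonneg h.left_mem
  have := h.strictMonoOn_rho h.left_mem (hx.mem t (Ioo_subset_Icc_self ht)) (hin t ht)
  nlinarith

/-! ### Rotation of the direction in the plane of motion -/

theorem hasDeriv_radialDir (hx : IsUnitGeodesic R c T x v) (h : Admissible R c) {t : ℝ}
    (ht : t ∈ Icc 0 T) (h0 : x t ≠ 0) :
    HasDerivWithinAt (fun s => radialDir (x s))
      ((c ‖x t‖ ^ 2 / ‖x t‖ ^ 2) • angularDir c (x t) (v t)) (Icc 0 T) t := by
  have hr := norm_pos_iff.2 h0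
  have hc := hx.pos_speed h ht
  have h1 := ((hx.hasDeriv_norm' h ht h0).inv hr.ne').smul (hx.hasDeriv t ht)
  refine HasDerivWithinAt.congr_deriv h1 ?_
  simp only [angularDir, Pi.inv_apply]
  match_scalars <;> field_simp

/-- Together with `hasDeriv_radialDir` this says that the pair (radial direction, angular direction
/ p) rotates with angular speed p c² / r². No choice of a plane in n-space is needed. -/
theorem hasDeriv_angularDir (hx : IsUnitGeodesic R c T x v) (h : Admissible R c) {p : ℝ}
    (hp : momSq c (x 0) (v 0) = p ^ 2) {t : ℝ} (ht : t ∈ Icc 0 T) (h0 : x t ≠ 0) :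
    HasDerivWithinAt (fun s => angularDir c (x s) (v s))
      (-(p ^ 2 * (c ‖x t‖ ^ 2 / ‖x t‖ ^ 2)) • radialDir (x t)) (Icc 0 T) t := by
  have hr := norm_pos_iff.2 h0
  have hc := hx.pos_speed h ht
  have hrd := hx.hasDeriv_norm' h ht h0
  have h1 := ((hrd.div ((hx.hasDeriv_speed h ht).pow 2) (pow_ne_zero 2 hc.ne')).smul
    (hx.geodesic t ht)).sub
    (((hx.hasDeriv_slantY h ht).div hrd hr.ne').smul (hx.hasDeriv t ht))
  refine HasDerivWithinAt.congr_deriv h1 ?_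
  have hp2 : p ^ 2 = ‖x t‖ ^ 2 / c ‖x t‖ ^ 2 - slantY c (x t) (v t) ^ 2 := by
    have := hx.sq_sub_sq h hp ht
    rw [rho, div_pow] at this
    linarith
  rw [hp2, ← h.one_sub_eq (hx.mem t ht)]
  simp only [radialDir, accel, Pi.pow_apply, Pi.div_apply, hx.unit_speed t ht,
    hx.inner_eq h ht]
  match_scalars <;> field_simp <;> ring

/-- In the plane of motion a geodesic rotates about the origin. -/
theorem rotation (hx : IsUnitGeodesic R c T x v) (h : Admissible R c) {p φ : ℝ} (hp0 : 0 < p)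
    (hp : momSq c (x 0) (v 0) = p ^ 2)
    (hφ : ∫ t in (0 : ℝ)..T, p * (c ‖x t‖ ^ 2 / ‖x t‖ ^ 2) = φ) :
    radialDir (x T) = Real.cos φ • radialDir (x 0) +
      (Real.sin φ / p) • angularDir c (x 0) (v 0) ∧
    angularDir c (x T) (v T) = (-p * Real.sin φ) • radialDir (x 0) +
      Real.cos φ • angularDir c (x 0) (v 0) := by
  have hcont := hx.continuousOn_angularSpeed h hp0 hp
  set k : ℝ → ℝ := fun t => p * (c ‖x t‖ ^ 2 / ‖x t‖ ^ 2) with hk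
  have hΘ : ∀ t ∈ Icc 0 T, HasDerivWithinAt (fun t => ∫ s in (0 : ℝ)..t, k s) (k t)
      (Icc 0 T) t := by
    intro t ht
    have hcont' : Continuous (IccExtend hx.pos.le ((Icc 0 T).domRestrict k)) :=
      hcont.domRestrict.Icc_extend'
    have h1 := (hcont'.integral_hasStrictDerivAt 0 t).hasDerivAt.hasDerivWithinAt (s := Icc 0 T)
    have e : ∀ s ∈ Icc 0 T, IccExtend hx.pos.le ((Icc 0 T).domRestrict k) s = k s := fun s hs => by
      rw [IccExtend_of_mem _ _ hs, domRestrict_apply]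
    rw [e t ht] at h1
    refine h1.congr_of_mem (fun u hu => ?_) ht
    refine intervalIntegral.integral_congr fun s hs => (e s ?_).symm
    rw [uIcc_of_le hu.1] at hs
    exact ⟨hs.1, hs.2.trans hu.2⟩
  set Θ : ℝ → ℝ := fun t => ∫ s in (0 : ℝ)..t, k s with hΘdef
  have hΘ0 : Θ 0 = 0 := by simp [hΘdef]
  have hΘT : Θ T = φ := hφ
  have const : ∀ (f : ℝ → E n), (∀ t ∈ Icc 0 T, HasDerivWithinAt f 0 (Icc 0 T) t) →
      f T = f 0 := fun f hf =>
    constant_of_has_deriv_right_zero (fun s hs => (hf s hs).continuousWithinAt)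
      (fun s hs => ((hf s (Ico_subset_Icc_self hs)).mono_of_mem_nhdsWithin
        (Icc_mem_nhdsGE_of_mem hs))) T (right_mem_Icc.2 hx.pos.le)
  -- Rotating the moving pair back by the accumulated angle Θ gives constant vectors.
  have hU := const (fun t => Real.cos (Θ t) • radialDir (x t) -
      (Real.sin (Θ t) / p) • angularDir c (x t) (v t)) (fun t ht => by
    have h0 := norm_pos_iff.1 (hx.norm_pos h hp0 hp ht)
    have h1 := ((hΘ t ht).cos.smul (hx.hasDeriv_radialDir h ht h0)).sub
      (((hΘ t ht).sin.div_const p).smul (hx.hasDeriv_angularDir h hp ht h0))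
    refine HasDerivWithinAt.congr_deriv h1 ?_
    have hr := hx.norm_pos h hp0 hp ht
    simp only [hk]
    match_scalars <;> field_simp <;> ring)
  have hV := const (fun t => (p * Real.sin (Θ t)) • radialDir (x t) +
      Real.cos (Θ t) • angularDir c (x t) (v t)) (fun t ht => by
    have h0 := norm_pos_iff.1 (hx.norm_pos h hp0 hp ht)
    have h1 := (((hΘ t ht).sin.const_mul p).smul (hx.hasDeriv_radialDir h ht h0)).add
      ((hΘ t ht).cos.smul (hx.hasDeriv_angularDir h hp ht h0))
    refine HasDerivWithinAt.congr_deriv h1 ?_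
    have hr := hx.norm_pos h hp0 hp ht
    simp only [hk]
    match_scalars <;> field_simp <;> ring)
  simp only [hΘ0, hΘT, Real.cos_zero, Real.sin_zero, one_smul, zero_div, zero_smul, sub_zero,
    mul_zero, zero_add] at hU hV
  rw [← hU, ← hV]
  have hcs : Real.cos φ ^ 2 = 1 - Real.sin φ ^ 2 := Real.cos_sq' φ
  constructor <;> match_scalars <;> field_simp <;> (try rw [hcs]) <;> ring

end IsUnitGeodesic

theorem momSq_nonneg {n : ℕ} {R : ℝ} {c : ℝ → ℝ} {T : ℝ} {x v : ℝ → E n}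
    (hx : IsUnitGeodesic R c T x v) (h : Admissible R c) : 0 ≤ momSq c (x 0) (v 0) := by
  have m0 : (0 : ℝ) ∈ Icc 0 T := left_mem_Icc.2 hx.pos.le
  have hc := hx.pos_speed h m0
  have hcs := abs_real_inner_le_norm (x 0) (v 0)
  rw [hx.unit_speed 0 m0] at hcs
  have hsq : (inner ℝ (x 0) (v 0) : ℝ) ^ 2 ≤ (‖x 0‖ * c ‖x 0‖) ^ 2 :=
    sq_le_sq.2 (by rwa [abs_of_nonneg (mul_nonneg (norm_nonneg (x 0)) hc.le)])
  have : momSq c (x 0) (v 0) =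
      ((‖x 0‖ * c ‖x 0‖) ^ 2 - (inner ℝ (x 0) (v 0) : ℝ) ^ 2) / c ‖x 0‖ ^ 4 := by
    unfold momSq rho slantY
    field_simp
  rw [this]
  exact div_nonneg (sub_nonneg.2 hsq) (by positivity)

/-! ### Reflections and closed broken rays -/

section Reflection

variable {n : ℕ} {c : ℝ → ℝ} {X V W : E n}

theorem slantY_of_isReflection (hr : IsReflection X V W) (h0 : X ≠ 0) :
    slantY c X W = -slantY c X V := by
  have : (inner ℝ X W : ℝ) = -inner ℝ X V := by
    have := norm_pos_iff.2 h0
    rw [hr, inner_sub_right, inner_smul_right, real_inner_self_eq_norm_sq, real_inner_comm X V]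
    field_simp
    ring
  rw [slantY, slantY, this, neg_div]

theorem momSq_of_isReflection (hr : IsReflection X V W) (h0 : X ≠ 0) :
    momSq c X W = momSq c X V := by
  rw [momSq, momSq, slantY_of_isReflection hr h0, neg_sq]

/-- Only the radial part of the velocity changes sign, so the rotation continues through a
reflection in the same plane and sense. -/
theorem angularDir_of_isReflection (hr : IsReflection X V W) (h0 : X ≠ 0) (hc : c ‖X‖ ≠ 0) :
    angularDir c X W = angularDir c X V := by
  have hX := norm_pos_iff.2 h0
  rw [angularDir, angularDir, slantY_of_isReflection hr h0, hr, slantY, real_inner_comm X V]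
  match_scalars <;> field_simp
  ring

theorem inner_radialDir_angularDir (h0 : X ≠ 0) :
    (inner ℝ (radialDir X) (angularDir c X V) : ℝ) = 0 := by
  have hX := norm_pos_iff.2 h0
  rw [radialDir, angularDir, inner_smul_left, inner_sub_right, inner_smul_right, inner_smul_right,
    real_inner_self_eq_norm_sq, slantY]
  simp only [conj_trivial]
  field_simp
  ring

theorem inner_radialDir_self (h0 : X ≠ 0) : (inner ℝ (radialDir X) (radialDir X) : ℝ) = 1 := by
  have hX := norm_pos_iff.2 h0
  rw [real_inner_self_eq_norm_sq, radialDir, norm_smul, norm_inv, norm_norm,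
    inv_mul_cancel₀ hX.ne', one_pow]

end Reflection

theorem finOfNat_succ (k m : ℕ) :
    Fin.ofNat (k + 1) (m + 1) = Fin.ofNat (k + 1) m + 1 := by
  ext
  simp [Fin.val_add, Nat.add_mod]

theorem finOfNat_self (k : ℕ) : Fin.ofNat (k + 1) (k + 1) = 0 := by
  ext
  simp

section Closed

variable {n k : ℕ} {R : ℝ} {c : ℝ → ℝ} {T : Fin (k + 1) → ℝ} {x v : Fin (k + 1) → ℝ → E n}

theorem momSq_of_isClosedBroken (h : Admissible R c)
    (hx : ∀ i, IsUnitGeodesic R c (T i) (x i) (v i)) (hcl : IsClosedBroken T x v)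
    (hne : ∀ i, x i (T i) ≠ 0) (i : Fin (k + 1)) :
    momSq c (x i 0) (v i 0) = momSq c (x 0 0) (v 0 0) := by
  have key : ∀ m : ℕ, momSq c (x (Fin.ofNat (k + 1) m) 0) (v (Fin.ofNat (k + 1) m) 0) =
      momSq c (x 0 0) (v 0 0) := by
    intro m
    induction m with
    | zero => simp
    | succ m ih =>
      obtain ⟨h1, h2⟩ := hcl (Fin.ofNat (k + 1) m)
      rw [finOfNat_succ, h1, momSq_of_isReflection h2 (hne _), ← ih]
      exact (hx _).momSq_eq h (right_mem_Icc.2 (hx _).pos.le)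
  simpa using key (i : ℕ)

/-- After all k + 1 segments the initial direction has been rotated by (k + 1)φ and must have
returned. The inner product with itself isolates the cosine, because the angular direction is
orthogonal to it. -/
theorem cos_eq_one_of_isClosedBroken (h : Admissible R c)
    (hx : ∀ i, IsUnitGeodesic R c (T i) (x i) (v i)) (hcl : IsClosedBroken T x v)
    (hne : ∀ i, x i (T i) ≠ 0) {p φ : ℝ} (hp0 : 0 < p)
    (hp : momSq c (x 0 0) (v 0 0) = p ^ 2)
    (hφ : ∀ i, ∫ t in (0 : ℝ)..T i, p * (c ‖x i t‖ ^ 2 / ‖x i t‖ ^ 2) = φ) :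
    Real.cos ((k + 1 : ℕ) * φ) = 1 := by
  have key : ∀ m : ℕ,
      radialDir (x (Fin.ofNat (k + 1) m) 0) = Real.cos (m * φ) • radialDir (x 0 0) +
        (Real.sin (m * φ) / p) • angularDir c (x 0 0) (v 0 0) ∧
      angularDir c (x (Fin.ofNat (k + 1) m) 0) (v (Fin.ofNat (k + 1) m) 0) =
        (-p * Real.sin (m * φ)) • radialDir (x 0 0) +
        Real.cos (m * φ) • angularDir c (x 0 0) (v 0 0) := by
    intro m
    induction m with
    | zero => simp
    | succ m ih =>
      obtain ⟨h1, h2⟩ := hcl (Fin.ofNat (k + 1) m)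
      have hm := momSq_of_isClosedBroken h hx hcl hne (Fin.ofNat (k + 1) m)
      obtain ⟨r1, r2⟩ := (hx _).rotation h hp0 (hm.trans hp) (hφ _)
      have hc := (hx (Fin.ofNat (k + 1) m)).pos_speed h (right_mem_Icc.2 (hx _).pos.le)
      rw [finOfNat_succ, h1, angularDir_of_isReflection h2 (hne _) hc.ne', r1, r2, ih.1, ih.2,
        Nat.cast_succ, add_mul, one_mul, Real.cos_add, Real.sin_add]
      constructor <;> match_scalars <;> field_simp <;> ring
  have h0 : x 0 0 ≠ 0 := norm_pos_iff.1
    ((hx 0).norm_pos h hp0 hp (left_mem_Icc.2 (hx 0).pos.le))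
  have h1 := (key (k + 1)).1
  rw [finOfNat_self] at h1
  have h2 := congrArg (fun u => (inner ℝ (radialDir (x 0 0)) u : ℝ)) h1
  simp only [inner_add_right, inner_smul_right, inner_radialDir_self h0,
    inner_radialDir_angularDir h0] at h2
  linarith

/-- A closed broken ray of segments that consist of the same number of halves. -/
theorem exists_of_isClosedBroken (h : Admissible R c)
    (hx : ∀ i, IsUnitGeodesic R c (T i) (x i) (v i)) (hcl : IsClosedBroken T x v)
    (hne : ∀ i, x i (T i) ≠ 0)
    (hhalf : ∀ p, 0 ≤ p → ∃ j : ℕ, ∀ i, momSq c (x i 0) (v i 0) = p ^ 2 →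
      IsUnitGeodesic.ConsistsOfHalves R c p (T i) (x i) j ∧ p < rho c 1) :
    ∃ (j : ℕ) (p : ℝ), 0 ≤ p ∧ p < rho c 1 ∧ ∑ i, T i = j / 2 * travelTime R c p ∧
      (0 < p → Real.cos (j / 2 * openingAngle R c p) = 1) := by
  set p := √(momSq c (x 0 0) (v 0 0)) with hpdef
  have hp : momSq c (x 0 0) (v 0 0) = p ^ 2 := (Real.sq_sqrt (momSq_nonneg (hx 0) h)).symm
  have hp0 : 0 ≤ p := Real.sqrt_nonneg _
  obtain ⟨j, hj⟩ := hhalf p hp0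
  have hall : ∀ i, momSq c (x i 0) (v i 0) = p ^ 2 := fun i =>
    (momSq_of_isClosedBroken h hx hcl hne i).trans hp
  refine ⟨(k + 1) * j, p, hp0, (hj 0 hp).2, ?_, fun hpp => ?_⟩
  · rw [Finset.sum_congr rfl fun i _ => (hj i (hall i)).1.time]
    simp only [Finset.sum_const, Finset.card_univ, Fintype.card_fin, nsmul_eq_mul]
    push_cast
    ring
  · have := cos_eq_one_of_isClosedBroken h hx hcl hne hpp hp
      fun i => (hj i (hall i)).1.angle hpp
    rw [← this]
    congr 1
    push_cast
    ring

end Closed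

/-! ### Necessary form of the lengths in the spectra -/

/-- The angle condition is dropped at p = 0, where the integral formula for the opening angle gives
0 even for a diameter of the ball; this single p contributes only countably many lengths. -/
theorem exists_of_mem_lsp {n : ℕ} {R : ℝ} {c : ℝ → ℝ} (h : Admissible R c) {l : ℝ}
    (hl : l ∈ lsp n R c) : ∃ (j : ℕ) (p : ℝ), 0 ≤ p ∧ p < rho c 1 ∧
      l = j / 2 * travelTime R c p ∧ (0 < p → Real.cos (j / 2 * openingAngle R c p) = 1) := by
  obtain ⟨k, T, x, v, hx, hcl, rfl⟩ := hl
  refine exists_of_isClosedBroken h (fun i => (hx i).toIsUnitGeodesic) hcl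
    (fun i => norm_pos_iff.1 (by rw [(hx i).end_outer]; exact one_pos)) fun p hp => ⟨2, fun i hi => ?_⟩
  obtain ⟨h1, -, h2⟩ := (hx i).toIsUnitGeodesic.outer_outer h hp hi (hx i).start_outer
    (hx i).end_outer (hx i).interior_inner
  exact ⟨h1, h2⟩

/-- All segments share p, and the comparison of p with ρ(R) decides for all of them at once whether
a segment has a turning point (two halves) or joins the two boundaries (one half). -/
theorem exists_of_mem_lspInner {n : ℕ} {R : ℝ} {c : ℝ → ℝ} (h : Admissible R c) (hR : 0 < R) {l : ℝ}
    (hl : l ∈ lspInner n R c) : ∃ (j : ℕ) (p : ℝ), 0 ≤ p ∧ p < rho c 1 ∧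
      l = j / 2 * travelTime R c p ∧ (0 < p → Real.cos (j / 2 * openingAngle R c p) = 1) := by
  obtain ⟨k, T, x, v, hx, hcl, rfl⟩ := hl
  refine exists_of_isClosedBroken h (fun i => (hx i).toIsUnitGeodesic) hcl
    (fun i => norm_pos_iff.1 ?_) fun p hp => ⟨if rho c R < p then 2 else 1, fun i hi => ?_⟩
  · rcases (hx i).end_boundary with h1 | h1 <;> rw [h1]
    exacts [hR, one_pos]
  · have hin : ∀ t ∈ Ioo 0 (T i), R < ‖x i t‖ := fun t ht => ((hx i).interior t ht).1
    have hu := (hx i).toIsUnitGeodesic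
    rcases (hx i).start_boundary with h0 | h0 <;> rcases (hx i).end_boundary with hT | hT
    · exact (hu.not_inner_inner h h0 hT hin).elim
    · obtain ⟨h1, h2, h3⟩ := hu.inner_outer h hp hi h0 hT hin
      rw [if_neg h2.not_gt]
      exact ⟨h1, h3⟩
    · obtain ⟨h1, h2, h3⟩ := hu.outer_inner h hp hi h0 hT hin
      rw [if_neg h2.not_gt]
      exact ⟨h1, h3⟩
    · obtain ⟨h1, h2, h3⟩ := hu.outer_outer h hp hi h0 hT fun t ht => Or.inr (hin t ht)
      rw [if_pos (h2.resolve_left hR.ne')]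
      exact ⟨h1, h3⟩

theorem lsp_subset_lspInner {n : ℕ} {R : ℝ} {c : ℝ → ℝ} (hR : 0 < R) :
    lsp n R c ⊆ lspInner n R c := by
  rintro l ⟨k, T, x, v, hx, hcl, rfl⟩
  exact ⟨k, T, x, v, fun i => ⟨(hx i).toIsUnitGeodesic, Or.inr (hx i).start_outer,
    Or.inr (hx i).end_outer, fun t ht =>
      ⟨((hx i).interior_inner t ht).resolve_left hR.ne', (hx i).interior_outer t ht⟩⟩, hcl, rfl⟩

/-! ### Square root singularities and differentiation under the integral -/

/-- The bound is singular only in the base point a, while b may have either sign. It supplies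
dominating functions when a parameter moves the turning point across s. -/
theorem abs_sqrt_sub_sqrt_le {a : ℝ} (ha : a ≠ 0) (b : ℝ) : |√b - √a| ≤ |b - a| / √|a| := by
  have hs : 0 < √|a| := Real.sqrt_pos.2 (abs_pos.2 ha)
  rw [le_div_iff₀ hs]
  rcases lt_or_gt_of_ne ha with hneg | hpos
  · rw [Real.sqrt_eq_zero_of_nonpos hneg.le, sub_zero, abs_of_nonneg (Real.sqrt_nonneg b)]
    rcases le_total b 0 with hb | hb
    · rw [Real.sqrt_eq_zero_of_nonpos hb, zero_mul]
      positivity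
    · have h1 := Real.sq_sqrt hb
      have h2 := Real.sq_sqrt (abs_nonneg a)
      rw [abs_of_neg hneg] at h2 ⊢
      rw [abs_of_nonneg (by linarith)]
      nlinarith [sq_nonneg (√b - √(-a))]
  · rw [abs_of_pos hpos]
    have h1 := Real.sq_sqrt hpos.le
    rcases le_total b 0 with hb | hb
    · rw [Real.sqrt_eq_zero_of_nonpos hb, zero_sub, abs_neg, abs_of_nonneg (Real.sqrt_nonneg a),
        abs_of_nonpos (by linarith)]
      nlinarith
    · have h2 := Real.sq_sqrt hb
      have : b - a = (√b - √a) * (√b + √a) := by nlinarith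
      rw [this, abs_mul, abs_of_nonneg (add_nonneg (Real.sqrt_nonneg b) (Real.sqrt_nonneg a))]
      gcongr
      linarith [Real.sqrt_nonneg b]

/-- The Lipschitz bound is required only against the base parameter. A bound between arbitrary
nearby parameters would fail here, since the singularity moves with the parameter. -/
theorem hasDerivAt_integral_of_lip {α : Type*} [MeasurableSpace α] {μ : Measure α}
    {F : ℝ → α → ℝ} {F' bound : α → ℝ} {x₀ : ℝ} {s : Set ℝ} (hs : s ∈ 𝓝 x₀)
    (hF_meas : ∀ x ∈ s, AEStronglyMeasurable (F x) μ) (hF_int : Integrable (F x₀) μ)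
    (hF'_meas : AEStronglyMeasurable F' μ)
    (h_lip : ∀ᵐ a ∂μ, ∀ x ∈ s, |F x a - F x₀ a| ≤ bound a * |x - x₀|)
    (hb : Integrable bound μ) (h_diff : ∀ᵐ a ∂μ, HasDerivAt (F · a) (F' a) x₀) :
    Integrable F' μ ∧ HasDerivAt (fun x => ∫ a, F x a ∂μ) (∫ a, F' a ∂μ) x₀ := by
  have hm : AEStronglyMeasurable (fun a => ContinuousLinearMap.toSpanSingleton ℝ (F' a)) μ :=
    (ContinuousLinearMap.toSpanSingletonCLE (𝕜 := ℝ) (E := ℝ)).continuous.comp_aestronglyMeasurable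
      hF'_meas
  obtain ⟨h1, h2⟩ := hasFDerivAt_integral_of_dominated_loc_of_lip' hs hF_meas hF_int hm h_lip hb
    (by filter_upwards [h_diff] with a ha using ha.hasFDerivAt)
  have hF' : Integrable F' μ := by
    have := h1.apply_continuousLinearMap 1
    simpa using this
  refine ⟨hF', ?_⟩
  have h3 := h2.hasDerivAt
  refine h3.congr_deriv ?_
  rw [ContinuousLinearMap.integral_apply h1]
  simp

/-- For negative x both sides are 0: the real power carries the factor cos(π/2). -/
theorem inv_sqrt_eq_rpow (x : ℝ) : (√x)⁻¹ = x ^ (-(1 / 2) : ℝ) := by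
  rcases lt_trichotomy x 0 with hx | rfl | hx
  · rw [Real.sqrt_eq_zero_of_nonpos hx.le, Real.rpow_def_of_neg hx,
      show -(1 / 2 : ℝ) * Real.pi = -(Real.pi / 2) by ring, Real.cos_neg, Real.cos_pi_div_two]
    simp
  · rw [Real.zero_rpow (by norm_num)]
    simp
  · rw [Real.rpow_neg hx.le, Real.sqrt_eq_rpow]

theorem intervalIntegrable_inv_sqrt_abs (r₀ a b : ℝ) :
    IntervalIntegrable (fun s => (√|s - r₀|)⁻¹) volume a b := by
  have h1 : ∀ u w : ℝ, IntervalIntegrable (fun x : ℝ => (√x)⁻¹) volume u w := fun u w => by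
    rw [funext inv_sqrt_eq_rpow]
    exact intervalIntegral.intervalIntegrable_rpow' (by norm_num)
  have h2 : ∀ u w : ℝ, IntervalIntegrable (fun x : ℝ => (√|x|)⁻¹) volume u w := fun u w => by
    have h3 : IntervalIntegrable (fun x : ℝ => (√(-x))⁻¹) volume u w := by
      rw [IntervalIntegrable.iff_comp_neg]
      simpa using h1 (-u) (-w)
    refine ((h1 u w).add h3).congr fun x _ => ?_
    rcases le_total 0 x with hx | hx
    · rw [abs_of_nonneg hx, Real.sqrt_eq_zero_of_nonpos (neg_nonpos.2 hx)]
      simp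
    · rw [abs_of_nonpos hx, Real.sqrt_eq_zero_of_nonpos hx]
      simp
  simpa using (h2 (a - r₀) (b - r₀)).comp_sub_right r₀

/-- Integrability of an inverse square root singularity. -/
theorem integrableOn_inv_sqrt_abs (r₀ a b : ℝ) :
    IntegrableOn (fun s => (√|s - r₀|)⁻¹) (Ioo a b) := by
  rcases le_total a b with hab | hab
  · exact (intervalIntegrable_iff_integrableOn_Ioo_of_le hab).1
      (intervalIntegrable_inv_sqrt_abs r₀ a b)
  · rw [Ioo_eq_empty hab.not_gt]
    exact integrableOn_empty

namespace Admissible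

variable {R : ℝ} {c : ℝ → ℝ}

theorem pos_of_mem_Ioo (h : Admissible R c) {s : ℝ} (hs : s ∈ Ioo R 1) : 0 < s :=
  h.R_nonneg.trans_lt hs.1

/-- The point r₀ is the radius with ρ(r₀) = p, or the nearer end point of [R, 1] if p is not a value
of ρ. -/
theorem exists_abs_rho_sub_ge (h : Admissible R c) : ∃ δ > 0, ∀ p : ℝ, ∃ r₀ : ℝ,
    ∀ s ∈ Icc R 1, δ * |s - r₀| ≤ |rho c s - p| := by
  obtain ⟨δ, hδ, hle⟩ := h.exists_rho_sub_ge
  refine ⟨δ, hδ, fun p => ?_⟩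
  rcases le_total p (rho c R) with hp | hp
  · refine ⟨R, fun s hs => ?_⟩
    have := hle R h.left_mem s hs hs.1
    rw [abs_of_nonneg (sub_nonneg.2 hs.1)]
    exact le_trans (by linarith) (le_abs_self _)
  rcases le_total (rho c 1) p with hp1 | hp1
  · refine ⟨1, fun s hs => ?_⟩
    have := hle s hs 1 h.right_mem hs.2
    rw [abs_sub_comm, abs_of_nonneg (sub_nonneg.2 hs.2), abs_sub_comm]
    exact le_trans (by linarith) (le_abs_self _)
  obtain ⟨r₀, hr₀, rfl⟩ := intermediate_value_Icc h.R_lt_one.le h.continuousOn_rho ⟨hp, hp1⟩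
  refine ⟨r₀, fun s hs => ?_⟩
  rcases le_total r₀ s with hrs | hrs
  · have := hle r₀ hr₀ s hs hrs
    rw [abs_of_nonneg (sub_nonneg.2 hrs)]
    exact le_trans (by linarith) (le_abs_self _)
  · have := hle s hs r₀ hr₀ hrs
    rw [abs_sub_comm, abs_of_nonneg (sub_nonneg.2 hrs), abs_sub_comm]
    exact le_trans (by linarith) (le_abs_self _)

theorem aestronglyMeasurable_of_continuousOn_Icc {f : ℝ → ℝ} (hf : ContinuousOn f (Icc R 1)) :
    AEStronglyMeasurable f (volume.restrict (Ioo R 1)) :=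
  (hf.mono Ioo_subset_Icc_self).aestronglyMeasurable measurableSet_Ioo

theorem integrableOn_inv_sqrt (h : Admissible R c) {p : ℝ} (hp : 0 < p) :
    IntegrableOn (fun s => (√|rho c s ^ 2 - p ^ 2|)⁻¹) (Ioo R 1) := by
  obtain ⟨δ, hδ, hle⟩ := h.exists_abs_rho_sub_ge
  obtain ⟨r₀, hr₀⟩ := hle p
  refine Integrable.mono' ((integrableOn_inv_sqrt_abs r₀ R 1).const_mul (√(δ * p))⁻¹) ?_ ?_
  · exact (aestronglyMeasurable_of_continuousOn_Icc (((h.continuousOn_rho.pow 2).sub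
      continuousOn_const).abs.sqrt)).inv₀
  · have hae : ∀ᵐ s ∂volume.restrict (Ioo R 1), s ≠ r₀ :=
      ae_restrict_of_ae (by simp [ae_iff, measure_singleton])
    filter_upwards [ae_restrict_mem measurableSet_Ioo, hae] with s hs hne
    have hs' := Ioo_subset_Icc_self hs
    have h1 := hr₀ s hs'
    have h2 := h.rho_nonneg hs'
    have h3 : 0 < |s - r₀| := abs_pos.2 (sub_ne_zero.2 hne)
    rw [Real.norm_of_nonneg (by positivity), ← mul_inv, ← Real.sqrt_mul (by positivity)]
    have h4 : δ * p * |s - r₀| ≤ |rho c s ^ 2 - p ^ 2| := by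
      rw [show rho c s ^ 2 - p ^ 2 = (rho c s - p) * (rho c s + p) by ring, abs_mul,
        abs_of_nonneg (by linarith : 0 ≤ rho c s + p)]
      calc δ * p * |s - r₀| = δ * |s - r₀| * p := by ring
        _ ≤ |rho c s - p| * (rho c s + p) := by gcongr; linarith
    gcongr

theorem ae_rho_sq_ne (h : Admissible R c) {p : ℝ} (hp : 0 < p) :
    ∀ᵐ s ∂volume.restrict (Ioo R 1), rho c s ^ 2 - p ^ 2 ≠ 0 := by
  obtain ⟨δ, hδ, hle⟩ := h.exists_abs_rho_sub_ge
  obtain ⟨r₀, hr₀⟩ := hle p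
  have hae : ∀ᵐ s ∂volume.restrict (Ioo R 1), s ≠ r₀ :=
    ae_restrict_of_ae (by simp [ae_iff, measure_singleton])
  filter_upwards [ae_restrict_mem measurableSet_Ioo, hae] with s hs hne h0
  have h1 := hr₀ s (Ioo_subset_Icc_self hs)
  have h2 := h.rho_nonneg (Ioo_subset_Icc_self hs)
  have h3 : 0 < |s - r₀| := abs_pos.2 (sub_ne_zero.2 hne)
  have h4 : rho c s - p = 0 := by
    have : (rho c s - p) * (rho c s + p) = 0 := by linarith
    rcases mul_eq_zero.1 this with h5 | h5 <;> linarith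
  rw [h4, abs_zero] at h1
  nlinarith [mul_pos hδ h3]

theorem exists_speed_ge (h : Admissible R c) : ∃ m > 0, ∀ r ∈ Icc R 1, m ≤ c r := by
  obtain ⟨r, hr, hmin⟩ := isCompact_Icc.exists_isMinOn (nonempty_Icc.2 h.R_lt_one.le)
    h.continuousOn
  exact ⟨_, h.pos r hr, hmin⟩

end Admissible

/-! ### The intercept time and nullity of the spectrum -/

/-- The intercept time `∫ √(rho² - p²) ds / s`, twice, of the geodesic of angular momentum `p`; its
derivative is minus the opening angle. -/
noncomputable def interceptTime (R : ℝ) (c : ℝ → ℝ) (p : ℝ) : ℝ :=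
  2 * ∫ s in Ioo R 1, √(rho c s ^ 2 - p ^ 2) / s

namespace Admissible

variable {R : ℝ} {c : ℝ → ℝ}

theorem continuousOn_intercept (h : Admissible R c) (p : ℝ) :
    ContinuousOn (fun s => √(rho c s ^ 2 - p ^ 2) / s) (Ioo R 1) :=
  ((((h.continuousOn_rho.mono Ioo_subset_Icc_self).pow 2).sub continuousOn_const).sqrt).div
    continuousOn_id fun _ hs => (h.pos_of_mem_Ioo hs).ne'

theorem integrableOn_intercept (h : Admissible R c) (p : ℝ) :
    IntegrableOn (fun s => √(rho c s ^ 2 - p ^ 2) / s) (Ioo R 1) := by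
  obtain ⟨m, hm, hle⟩ := h.exists_speed_ge
  refine Integrable.of_bound
    ((h.continuousOn_intercept p).aestronglyMeasurable measurableSet_Ioo) m⁻¹ ?_
  filter_upwards [ae_restrict_mem measurableSet_Ioo] with s hs
  have hs0 := h.pos_of_mem_Ioo hs
  have hs' := Ioo_subset_Icc_self hs
  have hc := h.pos s hs'
  rw [Real.norm_of_nonneg (by positivity)]
  calc √(rho c s ^ 2 - p ^ 2) / s ≤ rho c s / s := by
        gcongr
        exact Real.sqrt_le_iff.2 ⟨h.rho_nonneg hs', by nlinarith⟩
    _ = (c s)⁻¹ := by unfold rho; field_simp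
    _ ≤ m⁻¹ := by gcongr; exact hle s hs'

theorem hasDerivAt_interceptTime (h : Admissible R c) {p : ℝ} (hp : 0 < p) :
    IntegrableOn (fun s => p / (s * √(rho c s ^ 2 - p ^ 2))) (Ioo R 1) ∧
    HasDerivAt (interceptTime R c) (-openingAngle R c p) p := by
  obtain ⟨m, hm, hle⟩ := h.exists_speed_ge
  have key := hasDerivAt_integral_of_lip (μ := volume.restrict (Ioo R 1))
    (F := fun q s => √(rho c s ^ 2 - q ^ 2) / s)
    (F' := fun s => -(p / (s * √(rho c s ^ 2 - p ^ 2))))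
    -- For |q - p| < p/2 one has q + p ≤ 5p/2, and s = ρ c ≥ (p/2) m wherever ρ > p/2.
    (bound := fun s => (5 * p / 2 / (p / 2 * m)) * (√|rho c s ^ 2 - p ^ 2|)⁻¹)
    (x₀ := p) (s := Ioo (p / 2) (3 * p / 2)) (Ioo_mem_nhds (by linarith) (by linarith))
    (fun q _ => (h.continuousOn_intercept q).aestronglyMeasurable measurableSet_Ioo)
    (h.integrableOn_intercept p) ?_ ?_ ((h.integrableOn_inv_sqrt hp).const_mul _) ?_
  · refine ⟨by simpa [IntegrableOn] using key.1.neg, ?_⟩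
    refine (key.2.const_mul 2).congr_deriv ?_
    rw [openingAngle, integral_neg]
    ring
  · refine ((aestronglyMeasurable_const (b := p)).div₀ ?_).neg
    exact aestronglyMeasurable_of_continuousOn_Icc (continuousOn_id.mul
      ((h.continuousOn_rho.pow 2).sub continuousOn_const).sqrt)
  · filter_upwards [ae_restrict_mem measurableSet_Ioo, h.ae_rho_sq_ne hp] with s hs hne q hq
    have hs0 := h.pos_of_mem_Ioo hs
    have hs' := Ioo_subset_Icc_self hs
    have hρ := h.rho_nonneg hs'
    have hc := hle s hs'
    have hcp := h.pos s hs'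
    -- Where ρ ≤ p/2 both square roots vanish because q > p/2. This removes the factor 1/s near the
    -- origin when R = 0.
    by_cases hsmall : rho c s ≤ p / 2
    · rw [Real.sqrt_eq_zero_of_nonpos (by nlinarith [hq.1] : rho c s ^ 2 - q ^ 2 ≤ 0),
        Real.sqrt_eq_zero_of_nonpos (by nlinarith : rho c s ^ 2 - p ^ 2 ≤ 0)]
      simp only [zero_div, sub_zero, abs_zero]
      positivity
    · have hsm : p / 2 * m ≤ s := by
        have : s = rho c s * c s := by unfold rho; field_simp
        rw [this]
        gcongr
        exact (not_le.1 hsmall).le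
      rw [← sub_div, abs_div, abs_of_pos hs0]
      calc |√(rho c s ^ 2 - q ^ 2) - √(rho c s ^ 2 - p ^ 2)| / s
          ≤ (|(rho c s ^ 2 - q ^ 2) - (rho c s ^ 2 - p ^ 2)| / √|rho c s ^ 2 - p ^ 2|) /
              (p / 2 * m) := by
            gcongr
            exact abs_sqrt_sub_sqrt_le hne _
        _ ≤ ((5 * p / 2) * |q - p| / √|rho c s ^ 2 - p ^ 2|) / (p / 2 * m) := by
            gcongr
            rw [show (rho c s ^ 2 - q ^ 2) - (rho c s ^ 2 - p ^ 2) = -((q + p) * (q - p)) by ring,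
              abs_neg, abs_mul]
            gcongr
            rw [abs_of_pos (by linarith [hq.1])]
            linarith [hq.2]
        _ = _ := by ring
  · filter_upwards [ae_restrict_mem measurableSet_Ioo, h.ae_rho_sq_ne hp] with s hs hne
    have hs0 := h.pos_of_mem_Ioo hs
    have h1 := ((((hasDerivAt_id p).pow 2).const_sub (rho c s ^ 2)).sqrt hne).div_const s
    refine h1.congr_deriv ?_
    simp only [id, Nat.cast_ofNat, Nat.add_one_sub_one, pow_one, mul_one, neg_div, Pi.pow_apply]
    congr 1
    rw [mul_div_mul_left _ _ (two_ne_zero), div_div, mul_comm s]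

/-- Pointwise, ρ² / √(ρ² - p²) = √(ρ² - p²) + p² / √(ρ² - p²). With I' = -α this makes the length a
Legendre-type transform of the intercept time. -/
theorem travelTime_eq (h : Admissible R c) {p : ℝ} (hp : 0 < p) :
    travelTime R c p = interceptTime R c p + p * openingAngle R c p := by
  have h1 := (h.hasDerivAt_interceptTime hp).1.const_mul p
  have h2 := h.integrableOn_intercept p
  rw [travelTime, interceptTime, openingAngle, mul_left_comm p, ← mul_add,
    ← integral_const_mul p, ← integral_add h2 h1]
  congr 1
  refine setIntegral_congr_fun measurableSet_Ioo fun s hs => ?_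
  have hs0 := h.pos_of_mem_Ioo hs
  rcases le_or_gt (rho c s ^ 2 - p ^ 2) 0 with h0 | h0
  · rw [Real.sqrt_eq_zero_of_nonpos h0]
    simp
  · have := Real.sqrt_pos.2 h0
    have hsq := Real.sq_sqrt h0.le
    field_simp
    rw [hsq]
    ring

/-- A set of lengths given by critical values is a null set. -/
theorem volume_lengths_eq_zero (h : Admissible R c) :
    volume {l : ℝ | ∃ (j : ℕ) (p : ℝ), 0 ≤ p ∧ p < rho c 1 ∧
      l = j / 2 * travelTime R c p ∧ (0 < p → Real.cos (j / 2 * openingAngle R c p) = 1)} = 0 := by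
  -- If 2πm = (j/2) α(p), then (j/2) L(p) = F j m p, and p is a critical point of F j m because I' =
  -- -α.
  set F : ℕ → ℤ → ℝ → ℝ := fun j m p => j / 2 * interceptTime R c p + m * (2 * Real.pi) * p
  set D : ℕ → ℤ → Set ℝ := fun j m =>
    {p | 0 < p ∧ m * (2 * Real.pi) = j / 2 * openingAngle R c p}
  refine measure_mono_null (t := (⋃ j : ℕ, {(j : ℝ) / 2 * travelTime R c 0}) ∪
    ⋃ j : ℕ, ⋃ m : ℤ, F j m '' D j m) ?_ ?_
  · rintro l ⟨j, p, hp0, -, rfl, hcos⟩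
    rcases hp0.eq_or_lt with rfl | hp
    · exact Or.inl (mem_iUnion.2 ⟨j, rfl⟩)
    · obtain ⟨m, hm⟩ := (Real.cos_eq_one_iff _).1 (hcos hp)
      refine Or.inr (mem_iUnion.2 ⟨j, mem_iUnion.2 ⟨m, p, ⟨hp, hm⟩, ?_⟩⟩)
      simp only [F]
      rw [hm, h.travelTime_eq hp]
      ring
  · refine measure_union_null ?_ ?_
    · exact (countable_iUnion fun j => countable_singleton _).measure_zero _
    · refine measure_iUnion_null fun j => measure_iUnion_null fun m => ?_
      -- Sard's theorem in one variable: the image of a set on which the derivative vanishes is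
      -- null. Mere differentiability suffices.
      refine addHaar_image_eq_zero_of_det_fderivWithin_eq_zero volume (f' := fun _ => 0)
        (fun p hp => ?_) (fun p _ => by simp)
      have h1 := ((h.hasDerivAt_interceptTime hp.1).2.const_mul ((j : ℝ) / 2)).add
        ((hasDerivAt_id p).const_mul (m * (2 * Real.pi)))
      have h2 : HasDerivAt (F j m) 0 p := by
        refine HasDerivAt.congr_deriv h1 ?_
        rw [hp.2]
        ring
      have h3 := h2.hasFDerivAt.hasFDerivWithinAt (s := D j m)
      simpa using h3

end Admissible

/-! ### Construction of maximal geodesics and closed broken rays -/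

/-- A primitive of a continuous function with a positive lower bound is a diffeomorphism of the
line. -/
theorem exists_primitive_inverse {f : ℝ → ℝ} (hf : Continuous f) {δ : ℝ} (hδ : 0 < δ)
    (hle : ∀ x, δ ≤ f x) (a b : ℝ) :
    ∃ F G : ℝ → ℝ, F a = b ∧ StrictMono F ∧ StrictMono G ∧ (∀ x, HasDerivAt F (f x) x) ∧
      (∀ x, G (F x) = x) ∧ (∀ u, F (G u) = u) ∧ ∀ u, HasDerivAt G (f (G u))⁻¹ u := by
  set F : ℝ → ℝ := fun x => b + ∫ s in a..x, f s with hF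
  have hder : ∀ x, HasDerivAt F (f x) x := fun x =>
    (hf.integral_hasStrictDerivAt a x).hasDerivAt.const_add b
  have hmono : StrictMono F := strictMono_of_hasDerivAt_pos hder fun x => hδ.trans_le (hle x)
  have hcont : Continuous F := continuous_iff_continuousAt.2 fun x => (hder x).continuousAt
  have hmono2 : Monotone fun x => F x - δ * x :=
    monotone_of_hasDerivAt_nonneg (f' := fun x => f x - δ)
      (fun x => ((hder x).sub ((hasDerivAt_id x).const_mul δ)).congr_deriv (by simp))
      fun x => sub_nonneg.2 (hle x)
  have htop : Tendsto F atTop atTop := by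
    refine tendsto_atTop_mono' _ (f₁ := fun x => δ * x + (F 0 - δ * 0)) ?_ ?_
    · filter_upwards [eventually_ge_atTop 0] with x hx
      have := hmono2 hx
      simp only at this
      linarith
    · exact tendsto_atTop_add_const_right _ _ (tendsto_id.const_mul_atTop hδ)
  have hbot : Tendsto F atBot atBot := by
    refine tendsto_atBot_mono' _ (f₁ := fun x => δ * x + (F 0 - δ * 0)) ?_ ?_
    · filter_upwards [eventually_le_atBot 0] with x hx
      have := hmono2 hx
      simp only at this
      linarith
    · exact tendsto_atBot_add_const_right _ _ (tendsto_id.const_mul_atBot hδ)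
  set e := hmono.orderIsoOfSurjective F (hcont.surjective htop hbot) with he
  have hGF : ∀ x, e.symm (F x) = x := fun x => e.symm_apply_apply x
  have hFG : ∀ u, F (e.symm u) = u := fun u => e.apply_symm_apply u
  refine ⟨F, e.symm, by simp [hF], hmono, e.symm.strictMono, hder, hGF, hFG, fun u => ?_⟩
  exact HasDerivAt.of_local_left_inverse e.symm.continuous.continuousAt (hder _)
    (hδ.trans_le (hle _)).ne' (Eventually.of_forall hFG)

/-- The radial and angular coordinates of a maximal geodesic as functions of time. -/
structure Profile (R : ℝ) (c : ℝ → ℝ) (p T : ℝ) (r y φ : ℝ → ℝ) : Prop where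
  T_pos : 0 < T
  mem : ∀ t ∈ Icc 0 T, r t ∈ Icc R 1
  rho_sq : ∀ t ∈ Icc 0 T, rho c (r t) ^ 2 = p ^ 2 + y t ^ 2
  hasDeriv_y : ∀ t ∈ Icc 0 T, HasDerivAt y (c (r t) * rhoDeriv R c (r t)) t
  hasDeriv_r : ∀ t ∈ Icc 0 T, HasDerivAt r (y t * r t / (p ^ 2 + y t ^ 2)) t
  hasDeriv_φ : ∀ t ∈ Icc 0 T, HasDerivAt φ (p / (p ^ 2 + y t ^ 2)) t
  φ_zero : φ 0 = 0
  start : r 0 = 1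
  finish : r T = 1
  y_zero : y 0 = -√(rho c 1 ^ 2 - p ^ 2)
  y_stop : y T = √(rho c 1 ^ 2 - p ^ 2)
  y_strictMono : StrictMono y
  interior : ∀ t ∈ Ioo 0 T, r t < 1
  turning : ∃ t ∈ Icc 0 T, rho c (r t) = p

/-- The slant serves as the independent variable: the radius is the inverse of ρ at √(p² + y²), and
time is the primitive of 1/(c ρ') in y, which is then inverted. The geodesic is thus obtained by
quadratures. -/
theorem Admissible.exists_profile {R : ℝ} {c : ℝ → ℝ} (h : Admissible R c) {p : ℝ}
    (hp0 : 0 < p) (hpR : rho c R < p) (hp1 : p < rho c 1) :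
    ∃ (T : ℝ) (r y φ : ℝ → ℝ), Profile R c p T r y φ := by
  have hR1 := h.R_lt_one.le
  -- Clamping to [R, 1] extends the coefficients continuously to the line with the same bounds, so
  -- that the primitives and their inverses are defined globally.
  set pr : ℝ → ℝ := fun s => (projIcc R 1 hR1 s : ℝ) with hpr
  have hprc : Continuous pr := continuous_subtype_val.comp continuous_projIcc
  have hprm : ∀ s, pr s ∈ Icc R 1 := fun s => (projIcc R 1 hR1 s).2
  have hpre : ∀ s ∈ Icc R 1, pr s = s := fun s hs => by simp [hpr, projIcc_of_mem hR1 hs]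
  obtain ⟨δ, hδ, hδle⟩ := h.exists_slope
  obtain ⟨P, σ, hPR, hPm, hσm, hPd, hσP, hPσ, hσd⟩ := exists_primitive_inverse
    (f := fun s => rhoDeriv R c (pr s))
    (h.continuousOn_rhoDeriv.comp_continuous hprc hprm) hδ (fun s => hδle _ (hprm s)) R (rho c R)
  have hPeq : ∀ s ∈ Icc R 1, P s = rho c s := by
    have := constant_of_has_deriv_right_zero (f := fun s => P s - rho c s) (a := R) (b := 1)
      ((continuous_iff_continuousAt.2 fun x => (hPd x).continuousAt).continuousOn.sub
        h.continuousOn_rho) (fun s hs => by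
        have hs' := Ico_subset_Icc_self hs
        have h1 := (hPd s).hasDerivWithinAt.sub ((h.hasDeriv_rho hs').mono_of_mem_nhdsWithin
          (Icc_mem_nhdsGE_of_mem hs))
        exact h1.congr_deriv (by rw [hpre s hs', sub_self]))
    intro s hs
    have h2 := this s hs
    rw [hPR, sub_self] at h2
    linarith
  have hσρ : ∀ s ∈ Icc R 1, σ (rho c s) = s := fun s hs => by rw [← hPeq s hs, hσP]
  have hσmem : ∀ u ∈ Icc (rho c R) (rho c 1), σ u ∈ Icc R 1 := fun u hu =>
    ⟨by rw [← hσρ R h.left_mem]; exact hσm.monotone hu.1,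
      by rw [← hσρ 1 h.right_mem]; exact hσm.monotone hu.2⟩
  have hρσ : ∀ u ∈ Icc (rho c R) (rho c 1), rho c (σ u) = u := fun u hu => by
    rw [← hPeq _ (hσmem u hu), hPσ]
  have hσc : Continuous σ := continuous_iff_continuousAt.2 fun x => (hσd x).continuousAt
  have hu0 : ∀ y : ℝ, 0 < p ^ 2 + y ^ 2 := fun y => by positivity
  -- the equation of motion of `y`
  set g : ℝ → ℝ := fun s => c s * rhoDeriv R c s with hg
  have hgc : ContinuousOn g (Icc R 1) := h.continuousOn.mul h.continuousOn_rhoDeriv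
  have hgpos : ∀ s ∈ Icc R 1, 0 < g s := fun s hs => mul_pos (h.pos s hs) (h.rhoDeriv_pos hs)
  obtain ⟨s₁, hs₁, hmax⟩ := isCompact_Icc.exists_isMaxOn (nonempty_Icc.2 hR1) hgc
  set ry : ℝ → ℝ := fun y => σ (√(p ^ 2 + y ^ 2)) with hry
  have hryc : Continuous ry := hσc.comp (by fun_prop)
  set Y := √(rho c 1 ^ 2 - p ^ 2) with hY
  have hρ1 := h.rho_nonneg h.right_mem
  have hYpos : 0 < Y := Real.sqrt_pos.2 (by nlinarith)
  have hYsq : Y ^ 2 = rho c 1 ^ 2 - p ^ 2 := Real.sq_sqrt (by nlinarith)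
  obtain ⟨Tf, y, hT0, hTm, hym, hTd, hyT, hTy, hyd⟩ := exists_primitive_inverse
    (f := fun y => (g (pr (ry y)))⁻¹)
    ((hgc.comp_continuous (hprc.comp hryc) fun y => hprm _).inv₀
      fun y => (hgpos _ (hprm _)).ne')
    (inv_pos.2 (hgpos s₁ hs₁))
    (fun y => inv_anti₀ (hgpos _ (hprm _)) (hmax (hprm _))) (-Y) 0
  simp only [inv_inv] at hyd
  have hyc : Continuous y := continuous_iff_continuousAt.2 fun x => (hyd x).continuousAt
  set T := Tf Y with hT
  have hTpos : 0 < T := by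
    rw [← hT0]
    exact hTm (by linarith)
  have hy0 : y 0 = -Y := by rw [← hT0, hyT]
  have hyTT : y T = Y := hyT Y
  have hyI : ∀ t ∈ Icc 0 T, y t ^ 2 ≤ Y ^ 2 := fun t ht => by
    have h1 := hym.monotone ht.1
    have h2 := hym.monotone ht.2
    rw [hy0] at h1
    rw [hyTT] at h2
    nlinarith
  have huI : ∀ t ∈ Icc 0 T, √(p ^ 2 + y t ^ 2) ∈ Icc (rho c R) (rho c 1) := fun t ht =>
    ⟨hpR.le.trans (Real.le_sqrt_of_sq_le (by nlinarith [sq_nonneg (y t)])),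
      Real.sqrt_le_iff.2 ⟨hρ1, by nlinarith [hyI t ht]⟩⟩
  refine ⟨T, fun t => ry (y t), y, fun t => ∫ s in (0 : ℝ)..t, p / (p ^ 2 + y s ^ 2), hTpos,
    fun t ht => hσmem _ (huI t ht), fun t ht => ?_, fun t ht => ?_, fun t ht => ?_,
    fun t _ => ?_, by simp, ?_, ?_, hy0, hyTT, hym, fun t ht => ?_, ?_⟩
  · rw [hρσ _ (huI t ht), Real.sq_sqrt (hu0 _).le]
  · have := hyd t
    rwa [hpre _ (hσmem _ (huI t ht))] at this
  · have hm := hσmem _ (huI t ht)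
    have h1 := (hσd (√(p ^ 2 + y t ^ 2))).comp t
      ((((hyd t).pow 2).const_add (p ^ 2)).sqrt (hu0 _).ne')
    refine HasDerivAt.congr_deriv h1 ?_
    have hsq : 0 < √(p ^ 2 + y t ^ 2) := Real.sqrt_pos.2 (hu0 _)
    have hsq2 : p ^ 2 + y t ^ 2 = √(p ^ 2 + y t ^ 2) ^ 2 := (Real.sq_sqrt (hu0 _).le).symm
    have hd := h.rhoDeriv_pos hm
    have hcpos := h.pos _ hm
    have hcr : ry (y t) = √(p ^ 2 + y t ^ 2) * c (ry (y t)) := by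
      have := hρσ _ (huI t ht)
      rw [rho, div_eq_iff hcpos.ne'] at this
      exact this
    rw [hpre _ hm]
    simp only [hg, Pi.pow_apply, Nat.cast_ofNat, Nat.add_one_sub_one, pow_one]
    conv_rhs => rw [hcr, hsq2]
    rw [hry] at hcr ⊢
    field_simp
    rw [Real.sqrt_sq hsq.le]
  · exact (Continuous.integral_hasStrictDerivAt
      (continuous_const.div (by fun_prop) fun s => (hu0 (y s)).ne') 0 t).hasDerivAt
  · simp only [hry, hy0, neg_sq, hYsq, add_sub_cancel]
    rw [Real.sqrt_sq hρ1, hσρ 1 h.right_mem]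
  · simp only [hry, hyTT, hYsq, add_sub_cancel]
    rw [Real.sqrt_sq hρ1, hσρ 1 h.right_mem]
  · have h1 := hym ht.1
    have h2 := hym ht.2
    rw [hy0] at h1
    rw [hyTT] at h2
    rw [← hσρ 1 h.right_mem]
    refine hσm ((Real.sqrt_lt' (hp0.trans hp1)).2 ?_)
    nlinarith
  · have hz : y (Tf 0) = 0 := hyT 0
    have hm : Tf 0 ∈ Icc 0 T := ⟨by rw [← hT0]; exact hTm.monotone (by linarith),
      hTm.monotone hYpos.le⟩
    refine ⟨Tf 0, hm, ?_⟩
    have := hρσ _ (huI _ hm)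
    rw [hz] at this
    simp only [hry, hz]
    rw [this, zero_pow two_ne_zero, add_zero, Real.sqrt_sq hp0.le]

/-- An orthonormal pair. -/
structure OrthoPair {n : ℕ} (e f : E n) : Prop where
  left : inner ℝ e e = (1 : ℝ)
  right : inner ℝ f f = (1 : ℝ)
  cross : inner ℝ e f = (0 : ℝ)

/-- The pair rotated by the angle `θ`: first vector. -/
noncomputable def radialVec {n : ℕ} (e f : E n) (θ : ℝ) : E n := Real.cos θ • e + Real.sin θ • f
/-- The pair rotated by the angle `θ`: second vector. -/
noncomputable def angularVec {n : ℕ} (e f : E n) (θ : ℝ) : E n :=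
  -Real.sin θ • e + Real.cos θ • f

namespace OrthoPair

variable {n : ℕ} {e f : E n}

theorem rotate (h : OrthoPair e f) (θ : ℝ) :
    OrthoPair (radialVec e f θ) (angularVec e f θ) := by
  have h1 : inner ℝ f e = (0 : ℝ) := by rw [real_inner_comm]; exact h.cross
  have hcs := Real.sin_sq_add_cos_sq θ
  constructor <;>
  · simp only [radialVec, angularVec, inner_add_left, inner_add_right, inner_smul_left,
      inner_smul_right, h.left, h.right, h.cross, h1, conj_trivial]
    linarith

theorem norm_left (h : OrthoPair e f) : ‖e‖ = 1 := by
  have := h.left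
  rw [real_inner_self_eq_norm_sq] at this
  nlinarith [norm_nonneg e]

theorem inner_combo (h : OrthoPair e f) (a b : ℝ) : inner ℝ e (a • e + b • f) = a := by
  rw [inner_add_right, inner_smul_right, inner_smul_right, h.left, h.cross]
  ring

theorem norm_sq_combo (h : OrthoPair e f) (a b : ℝ) : ‖a • e + b • f‖ ^ 2 = a ^ 2 + b ^ 2 := by
  have h1 : inner ℝ f e = (0 : ℝ) := by rw [real_inner_comm]; exact h.cross
  rw [← real_inner_self_eq_norm_sq]
  simp only [inner_add_left, inner_add_right, inner_smul_left,
      inner_smul_right, h.left, h.right, h.cross, h1, conj_trivial]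
  ring

end OrthoPair

theorem exists_orthoPair {n : ℕ} (hn : 2 ≤ n) : ∃ e f : E n, OrthoPair e f := by
  refine ⟨EuclideanSpace.single ⟨0, by omega⟩ 1, EuclideanSpace.single ⟨1, by omega⟩ 1, ?_, ?_, ?_⟩
  · simp
  · simp
  · rw [EuclideanSpace.inner_single_left]
    simp

theorem hasDerivAt_radialVec {n : ℕ} (e f : E n) (θ : ℝ) :
    HasDerivAt (radialVec e f) (angularVec e f θ) θ :=
  ((Real.hasDerivAt_cos θ).smul_const e).add ((Real.hasDerivAt_sin θ).smul_const f)

theorem hasDerivAt_angularVec {n : ℕ} (e f : E n) (θ : ℝ) :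
    HasDerivAt (angularVec e f) (-radialVec e f θ) θ := by
  refine (((Real.hasDerivAt_sin θ).neg.smul_const e).add
    ((Real.hasDerivAt_cos θ).smul_const f)).congr_deriv ?_
  simp only [radialVec]
  module

/-- Position of the geodesic with a given profile, starting from the angle `θ`. -/
noncomputable def position {n : ℕ} (e f : E n) (r φ : ℝ → ℝ) (θ t : ℝ) : E n :=
  r t • radialVec e f (φ t + θ)

/-- Velocity of the geodesic with a given profile, starting from the angle `θ`. -/
noncomputable def velocity {n : ℕ} (e f : E n) (p : ℝ) (r y φ : ℝ → ℝ) (θ t : ℝ) : E n :=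
  (r t / (p ^ 2 + y t ^ 2)) •
    (y t • radialVec e f (φ t + θ) + p • angularVec e f (φ t + θ))

namespace Profile

variable {n : ℕ} {e f : E n} {R : ℝ} {c : ℝ → ℝ} {p T : ℝ} {r y φ : ℝ → ℝ}

theorem norm_position (hP : Profile R c p T r y φ) (h : Admissible R c) (ho : OrthoPair e f)
    (θ : ℝ) {t : ℝ} (ht : t ∈ Icc 0 T) : ‖position e f r φ θ t‖ = r t := by
  rw [position, norm_smul, (ho.rotate _).norm_left, mul_one,
    Real.norm_of_nonneg (h.nonneg_of_mem (hP.mem t ht))]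

theorem r_pos (hP : Profile R c p T r y φ) (h : Admissible R c) (hp : 0 < p) {t : ℝ}
    (ht : t ∈ Icc 0 T) : 0 < r t := by
  refine lt_of_le_of_ne (h.nonneg_of_mem (hP.mem t ht)) fun h0 => ?_
  have := hP.rho_sq t ht
  rw [← h0, rho, zero_div] at this
  nlinarith [sq_nonneg (y t)]

theorem speed_sq (hP : Profile R c p T r y φ) (h : Admissible R c) (hp : 0 < p) {t : ℝ}
    (ht : t ∈ Icc 0 T) : c (r t) ^ 2 = r t ^ 2 / (p ^ 2 + y t ^ 2) := by
  have hc := h.pos _ (hP.mem t ht)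
  have hr := hP.r_pos h hp ht
  rw [← hP.rho_sq t ht, rho]
  field_simp

theorem isMaximalGeodesic (hP : Profile R c p T r y φ) (h : Admissible R c) (ho : OrthoPair e f)
    (hp : 0 < p) (hpR : rho c R < p) (θ : ℝ) :
    IsMaximalGeodesic R c T (position e f r φ θ) (velocity e f p r y φ θ) := by
  have hnorm := fun {t : ℝ} (ht : t ∈ Icc 0 T) => hP.norm_position h ho θ ht
  have hu0 : ∀ y : ℝ, 0 < p ^ 2 + y ^ 2 := fun y => by positivity
  have m0 : (0 : ℝ) ∈ Icc 0 T := left_mem_Icc.2 hP.T_pos.le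
  have mT : T ∈ Icc 0 T := right_mem_Icc.2 hP.T_pos.le
  have her : ∀ t ∈ Icc 0 T, HasDerivAt (fun t => radialVec e f (φ t + θ))
      ((p / (p ^ 2 + y t ^ 2)) • angularVec e f (φ t + θ)) t := fun t ht =>
    HasDerivAt.scomp (g₁ := radialVec e f) (h := fun t => φ t + θ) t
      (hasDerivAt_radialVec e f (φ t + θ)) ((hP.hasDeriv_φ t ht).add_const θ)
  have heθ : ∀ t ∈ Icc 0 T, HasDerivAt (fun t => angularVec e f (φ t + θ))
      ((p / (p ^ 2 + y t ^ 2)) • -radialVec e f (φ t + θ)) t := fun t ht =>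
    HasDerivAt.scomp (g₁ := angularVec e f) (h := fun t => φ t + θ) t
      (hasDerivAt_angularVec e f (φ t + θ)) ((hP.hasDeriv_φ t ht).add_const θ)
  have hspeed : ∀ t ∈ Icc 0 T, ‖velocity e f p r y φ θ t‖ = c (r t) := fun t ht => by
    have h2 : ‖velocity e f p r y φ θ t‖ ^ 2 = c (r t) ^ 2 := by
      have hu := hu0 (y t)
      rw [velocity, norm_smul, mul_pow, (ho.rotate _).norm_sq_combo, hP.speed_sq h hp ht,
        Real.norm_eq_abs, sq_abs]
      field_simp
      ring
    have h3 := h.pos _ (hP.mem t ht)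
    exact (pow_left_inj₀ (norm_nonneg _) h3.le two_ne_zero).1 h2
  refine ⟨⟨hP.T_pos, fun t ht => ?_, fun t ht => ?_, fun t ht => ?_, fun t ht => ?_⟩, ?_, ?_,
    fun t ht => ?_, fun t ht => ?_⟩
  · rw [hnorm ht]
    exact hP.mem t ht
  · refine (((hP.hasDeriv_r t ht).smul (her t ht)).hasDerivWithinAt).congr_deriv ?_
    rw [velocity]
    match_scalars <;> ring
  · have h1 := ((hP.hasDeriv_r t ht).div (((hP.hasDeriv_y t ht).pow 2).const_add (p ^ 2))
      (hu0 (y t)).ne').smul (((hP.hasDeriv_y t ht).smul (her t ht)).add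
        ((heθ t ht).const_smul p))
    refine (HasDerivAt.hasDerivWithinAt h1).congr_deriv ?_
    have hr := hP.r_pos h hp ht
    have hc := h.pos _ (hP.mem t ht)
    have hu := hu0 (y t)
    have hinner : inner ℝ (position e f r φ θ t) (velocity e f p r y φ θ t) =
        r t * (r t / (p ^ 2 + y t ^ 2) * y t) := by
      rw [position, velocity, inner_smul_left, inner_smul_right, (ho.rotate _).inner_combo]
      simp
    have hcoef : derivWithin c (Icc R 1) (r t) / (c (r t) * r t) =
        (1 - c (r t) * rhoDeriv R c (r t)) / r t ^ 2 := by
      rw [← h.one_sub_eq (hP.mem t ht)]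
      field_simp
      ring
    rw [accel, hnorm ht, hspeed t ht, hinner, hcoef, hP.speed_sq h hp ht, position, velocity]
    simp only [Pi.smul_apply, Pi.add_apply, Pi.pow_apply, Pi.div_apply, Pi.smul_apply']
    match_scalars <;> field_simp <;> ring
  · rw [hspeed t ht, hnorm ht]
  · rw [hnorm m0, hP.start]
  · rw [hnorm mT, hP.finish]
  · rw [hnorm (Ioo_subset_Icc_self ht)]
    exact hP.interior t ht
  · rw [hnorm (Ioo_subset_Icc_self ht)]
    have hm := hP.mem t (Ioo_subset_Icc_self ht)
    refine Or.inr (lt_of_le_of_ne hm.1 fun heq => ?_)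
    have h1 := hP.rho_sq t (Ioo_subset_Icc_self ht)
    rw [← heq] at h1
    have := h.rho_nonneg h.left_mem
    nlinarith [sq_nonneg (y t)]

theorem momSq_eq (hP : Profile R c p T r y φ) (h : Admissible R c) (ho : OrthoPair e f)
    (hp : 0 < p) (θ : ℝ) :
    momSq c (position e f r φ θ 0) (velocity e f p r y φ θ 0) = p ^ 2 := by
  have m0 : (0 : ℝ) ∈ Icc 0 T := left_mem_Icc.2 hP.T_pos.le
  have hu0 : 0 < p ^ 2 + y 0 ^ 2 := by positivity
  have hr := hP.r_pos h hp m0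
  rw [momSq, slantY, hP.norm_position h ho θ m0, hP.rho_sq 0 m0, hP.speed_sq h hp m0, position,
    velocity, inner_smul_left, inner_smul_right, (ho.rotate _).inner_combo]
  simp only [conj_trivial]
  field_simp
  ring

/-- The constructed curve is itself an outer-to-outer geodesic, so its duration and angle are given
by the general decomposition into two halves. -/
theorem time_eq (hP : Profile R c p T r y φ) (h : Admissible R c) (ho : OrthoPair e f)
    (hp : 0 < p) (hpR : rho c R < p) : T = travelTime R c p ∧ φ T = openingAngle R c p := by
  have hm := hP.isMaximalGeodesic h ho hp hpR 0
  obtain ⟨⟨h1, h2⟩, -, -⟩ := hm.toIsUnitGeodesic.outer_outer h hp.le (hP.momSq_eq h ho hp 0)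
    hm.start_outer hm.end_outer hm.interior_inner
  refine ⟨by push_cast at h1; linarith, ?_⟩
  have h3 := h2 hp
  have h4 : ∀ t ∈ uIcc 0 T, HasDerivAt φ
      (p * (c ‖position e f r φ 0 t‖ ^ 2 / ‖position e f r φ 0 t‖ ^ 2)) t := fun t ht => by
    rw [uIcc_of_le hP.T_pos.le] at ht
    refine (hP.hasDeriv_φ t ht).congr_deriv ?_
    have hr := hP.r_pos h hp ht
    have hu0 : 0 < p ^ 2 + y t ^ 2 := by positivity
    rw [hP.norm_position h ho 0 ht, hP.speed_sq h hp ht]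
    field_simp
  rw [intervalIntegral.integral_eq_sub_of_hasDerivAt h4, hP.φ_zero] at h3
  · push_cast at h3
    linarith
  · have hc := hm.toIsUnitGeodesic.continuousOn_angularSpeed h hp (hP.momSq_eq h ho hp 0)
    rw [← uIcc_of_le hP.T_pos.le] at hc
    exact hc.intervalIntegrable

end Profile

/-- If the opening angle is a rational multiple of `2π`, then there is a closed broken ray. -/
theorem Admissible.mem_lsp {n : ℕ} (hn : 2 ≤ n) {R : ℝ} {c : ℝ → ℝ} (h : Admissible R c) {p : ℝ}
    (hp0 : 0 < p) (hpR : rho c R < p) (hp1 : p < rho c 1) {k : ℕ} {m : ℤ}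
    (hA : (k + 1) * openingAngle R c p = m * (2 * Real.pi)) :
    (k + 1) * travelTime R c p ∈ lsp n R c := by
  obtain ⟨e, f, ho⟩ := exists_orthoPair hn
  obtain ⟨T, r, y, φ, hP⟩ := h.exists_profile hp0 hpR hp1
  obtain ⟨hT, hφ⟩ := hP.time_eq h ho hp0 hpR
  set A := openingAngle R c p with hAdef
  have hm := fun i : Fin (k + 1) => hP.isMaximalGeodesic h ho hp0 hpR ((i : ℕ) * A)
  refine ⟨k, fun _ => T, fun i => position e f r φ ((i : ℕ) * A),
    fun i => velocity e f p r y φ ((i : ℕ) * A), hm, fun i => ?_, ?_⟩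
  · have m0 : (0 : ℝ) ∈ Icc 0 T := left_mem_Icc.2 hP.T_pos.le
    have mT : T ∈ Icc 0 T := right_mem_Icc.2 hP.T_pos.le
    -- Segment i runs from angle iA to (i + 1)A. Only after the last segment, where the index wraps
    -- to 0, do the angles differ, and then by (k + 1)A = 2πm.
    have hang : ∃ N : ℤ, ((i + 1 : Fin (k + 1)) : ℕ) * A = A + (i : ℕ) * A - N * (2 * Real.pi) := by
      by_cases hi : i = Fin.last k
      · refine ⟨m, ?_⟩
        rw [hi, Fin.last_add_one]
        simp only [Fin.val_zero, Fin.val_last]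
        push_cast
        linarith
      · refine ⟨0, ?_⟩
        rw [Fin.val_add_one_of_lt (lt_of_le_of_ne (Fin.le_last i) hi)]
        push_cast
        ring
    obtain ⟨N, hN⟩ := hang
    have hr1 : radialVec e f (((i + 1 : Fin (k + 1)) : ℕ) * A) = radialVec e f (A + (i : ℕ) * A) := by
      rw [hN, radialVec, radialVec, Real.cos_sub_int_mul_two_pi, Real.sin_sub_int_mul_two_pi]
    have hr2 : angularVec e f (((i + 1 : Fin (k + 1)) : ℕ) * A) =
        angularVec e f (A + (i : ℕ) * A) := by
      rw [hN, angularVec, angularVec, Real.cos_sub_int_mul_two_pi, Real.sin_sub_int_mul_two_pi]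
    have hyy : y T = -y 0 := by rw [hP.y_zero, hP.y_stop, neg_neg]
    simp only [IsReflection, position, velocity, hP.start, hP.finish, hP.φ_zero, hφ, zero_add, hr1,
      hr2, one_smul]
    refine ⟨trivial, ?_⟩
    have ho' := ho.rotate (A + (i : ℕ) * A)
    rw [ho'.norm_left, real_inner_comm, inner_smul_right, ho'.inner_combo, hyy]
    match_scalars <;> ring
  · rw [← hT]
    simp

/-! ### Differentiating a Lipschitz flow in a parameter, almost everywhere -/

section Variation

variable {Z : Type*} [NormedAddCommGroup Z] [NormedSpace ℝ Z] [FiniteDimensional ℝ Z]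

/-- A one-parameter family of solutions of an autonomous equation with Lipschitz right-hand side is
differentiable with respect to the parameter for almost every value of it, and the derivative solves
the linearized equation at almost every time if the right-hand side is differentiable at almost
every point of the trajectories. -/
theorem ae_exists_variation {G : Z → Z} {K : Set Z} {LG L₀ : ℝ≥0} {B : ℝ}
    (hG : LipschitzOnWith LG G K) (hB : ∀ q ∈ K, ‖G q‖ ≤ B) {a b T : ℝ} (hab : a < b)
    (hT : 0 < T) {z : ℝ → ℝ → Z} (hzK : ∀ p ∈ Icc a b, ∀ t ∈ Icc 0 T, z p t ∈ K)
    (hz : ∀ p ∈ Icc a b, ∀ t ∈ Icc 0 T, HasDerivWithinAt (z p) (G (z p t)) (Icc 0 T) t)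
    (hz0 : LipschitzOnWith L₀ (fun p => z p 0) (Icc a b))
    (hz0d : ∀ p ∈ Ioo a b, DifferentiableAt ℝ (fun p => z p 0) p)
    (hGd : ∀ p ∈ Ioo a b, ∀ᵐ t, t ∈ Ioo 0 T → DifferentiableAt ℝ G (z p t)) :
    ∀ᵐ p, p ∈ Ioo a b → ∃ W F : ℝ → Z,
      (∀ t ∈ Icc 0 T, HasDerivAt (fun q => z q t) (W t) p) ∧
      (∃ C : ℝ≥0, LipschitzOnWith C W (Icc 0 T)) ∧
      (∀ t, IntervalIntegrable F volume 0 t) ∧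
      (∀ t ∈ Icc 0 T, W t = W 0 + ∫ s in (0 : ℝ)..t, F s) ∧
      (∀ᵐ t, t ∈ Ioo 0 T → DifferentiableAt ℝ G (z p t) ∧
        F t = fderiv ℝ G (z p t) (W t) ∧ HasDerivAt W (F t) t) := by
  have hab' := hab.le
  have hB0 : 0 ≤ B := (norm_nonneg _).trans (hB _ (hzK a (left_mem_Icc.2 hab') 0
    (left_mem_Icc.2 hT.le)))
  have hzt : ∀ p ∈ Icc a b, LipschitzOnWith B.toNNReal (z p) (Icc 0 T) := fun p hp =>
    (convex_Icc 0 T).lipschitzOnWith_of_nnnorm_hasDerivWithin_le (hz p hp) fun t ht => by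
      rw [← NNReal.coe_le_coe, coe_nnnorm, Real.coe_toNNReal _ hB0]
      exact hB _ (hzK p hp t ht)
  set C : ℝ≥0 := L₀ * (Real.exp (LG * T)).toNNReal with hC
  have hCcoe : (C : ℝ) = L₀ * Real.exp (LG * T) := by
    rw [hC, NNReal.coe_mul, Real.coe_toNNReal _ (Real.exp_pos _).le]
  -- Grönwall's inequality makes the solutions Lipschitz in the parameter, uniformly in time.
  have hzp : ∀ t ∈ Icc 0 T, LipschitzOnWith C (fun p => z p t) (Icc a b) := fun t ht => by
    refine LipschitzOnWith.of_dist_le_mul fun p hp q hq => ?_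
    have hd : ∀ p ∈ Icc a b, ∀ t ∈ Ico 0 T, HasDerivWithinAt (z p) (G (z p t)) (Ici t) t :=
      fun p hp t ht => (hz p hp t (Ico_subset_Icc_self ht)).mono_of_mem_nhdsWithin
        (Icc_mem_nhdsGE_of_mem ht)
    have h1 := dist_le_of_trajectories_ODE_of_mem (v := fun _ => G) (s := fun _ => K)
      (fun _ _ => hG) (hzt p hp).continuousOn (hd p hp)
      (fun t ht => hzK p hp t (Ico_subset_Icc_self ht)) (hzt q hq).continuousOn (hd q hq)
      (fun t ht => hzK q hq t (Ico_subset_Icc_self ht)) (hz0.dist_le_mul p hp q hq) t ht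
    refine h1.trans ?_
    rw [hCcoe, mul_right_comm, sub_zero]
    gcongr
    exact ht.2
  -- the family with clamped parameters
  set pa : ℝ → ℝ := fun p => (projIcc a b hab' p : ℝ) with hpa
  set pt : ℝ → ℝ := fun t => (projIcc 0 T hT.le t : ℝ) with hpt
  have hpam : ∀ p, pa p ∈ Icc a b := fun p => (projIcc a b hab' p).2
  have hptm : ∀ t, pt t ∈ Icc 0 T := fun t => (projIcc 0 T hT.le t).2
  have hpae : ∀ p ∈ Icc a b, pa p = p := fun p hp => by simp [hpa, projIcc_of_mem hab' hp]
  have hpte : ∀ t ∈ Icc 0 T, pt t = t := fun t ht => by simp [hpt, projIcc_of_mem hT.le ht]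
  have hpal : LipschitzWith 1 pa := (LipschitzWith.projIcc hab')
  have hptl : LipschitzWith 1 pt := (LipschitzWith.projIcc hT.le)
  set y : ℝ → ℝ → Z := fun t p => z (pa p) (pt t) with hy
  have hyK : ∀ t p, y t p ∈ K := fun t p => hzK _ (hpam p) _ (hptm t)
  have hyp : ∀ t, LipschitzWith C (y t) := fun t => by
    refine LipschitzWith.of_dist_le_mul fun p q => ?_
    refine ((hzp _ (hptm t)).dist_le_mul _ (hpam p) _ (hpam q)).trans ?_
    gcongr
    simpa using hpal.dist_le_mul p q
  have hyc : Continuous (Function.uncurry y) := by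
    refine continuous_iff_continuousAt.2 fun ⟨t, p⟩ => ?_
    have : Tendsto (fun w : ℝ × ℝ => C * dist w.2 p + B * dist w.1 t) (𝓝 (t, p)) (𝓝 0) := by
      have h : Continuous (fun w : ℝ × ℝ => C * dist w.2 p + B * dist w.1 t) := by fun_prop
      simpa using h.tendsto (t, p)
    refine tendsto_iff_dist_tendsto_zero.2 (squeeze_zero (fun _ => dist_nonneg) (fun w => ?_) this)
    calc dist (y w.1 w.2) (y t p) ≤ dist (y w.1 w.2) (y w.1 p) + dist (y w.1 p) (y t p) :=
          dist_triangle _ _ _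
      _ ≤ C * dist w.2 p + B * dist w.1 t := by
          gcongr
          · exact (hyp w.1).dist_le_mul _ _
          · refine ((hzt _ (hpam p)).dist_le_mul _ (hptm _) _ (hptm _)).trans ?_
            rw [Real.coe_toNNReal _ hB0]
            gcongr
            simpa using hptl.dist_le_mul w.1 t
  have hGyc : Continuous (Function.uncurry fun t p => G (y t p)) :=
    hG.continuousOn.comp_continuous hyc fun w => hyK w.1 w.2
  have hGyp : ∀ t, LipschitzWith (LG * C) fun p => G (y t p) := fun t => by
    refine LipschitzWith.of_dist_le_mul fun p q => ?_
    refine (hG.dist_le_mul _ (hyK t p) _ (hyK t q)).trans ?_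
    rw [NNReal.coe_mul, mul_assoc]
    gcongr
    exact (hyp t).dist_le_mul _ _
  -- Rademacher's theorem in p for each t, followed by Fubini: for almost every p the family is
  -- differentiable in p at almost every t.
  have hae : ∀ᵐ p : ℝ, ∀ᵐ t : ℝ, DifferentiableAt ℝ (y t) p := by
    refine (Measure.ae_ae_comm (p := fun t p => DifferentiableAt ℝ (y t) p) ?_).1 ?_
    · exact measurableSet_of_differentiableAt_with_param ℝ hyc
    · exact Eventually.of_forall fun t => (hyp t).ae_differentiableAt_real
  filter_upwards [hae] with p hp hpI
  have hpI' := Ioo_subset_Icc_self hpI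
  have hnear : ∀ᶠ q in 𝓝 p, q ∈ Ioo a b := Ioo_mem_nhds hpI.1 hpI.2
  have hyz : ∀ t ∈ Icc 0 T, y t =ᶠ[𝓝 p] fun q => z q t := fun t ht => by
    filter_upwards [hnear] with q hq
    simp only [hy, hpae q (Ioo_subset_Icc_self hq), hpte t ht]
  have hypz : ∀ t ∈ Icc 0 T, y t p = z p t := fun t ht => (hyz t ht).self_of_nhds
  set F : ℝ → Z := fun s => deriv (fun q => G (y s q)) p with hF
  set W : ℝ → Z := fun t => deriv (y t) p with hW
  have hFm : StronglyMeasurable F :=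
    (stronglyMeasurable_deriv_with_param hGyc).comp_measurable
      (measurable_id.prodMk measurable_const)
  have hFb : ∀ s, ‖F s‖ ≤ (LG * C : ℝ≥0) := fun s => norm_deriv_le_of_lipschitz (hGyp s)
  have hFint : ∀ u w : ℝ, IntervalIntegrable F volume u w := fun u w =>
    (intervalIntegrable_const (c := ((LG * C : ℝ≥0) : ℝ))).mono_fun hFm.aestronglyMeasurable
      (Eventually.of_forall fun s => by
        rw [Real.norm_of_nonneg (NNReal.coe_nonneg _)]
        exact hFb s)
  have hchain : ∀ᵐ t, t ∈ Ioo 0 T → DifferentiableAt ℝ G (z p t) ∧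
      HasDerivAt (fun q => G (y t q)) (fderiv ℝ G (z p t) (W t)) p := by
    filter_upwards [hp, hGd p hpI] with t h1 h2 ht
    have h3 := h2 ht
    have ht' := Ioo_subset_Icc_self ht
    refine ⟨h3, ?_⟩
    rw [← hypz t ht'] at h3 ⊢
    exact h3.hasFDerivAt.comp_hasDerivAt p h1.hasDerivAt
  -- Differentiating the integral equation under the integral needs differentiability of the
  -- integrand only at almost every s, and yields it for the solution at every t.
  have hint : ∀ t ∈ Icc 0 T, HasDerivAt (y t) (deriv (y 0) p + ∫ s in (0 : ℝ)..t, F s) p := by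
    intro t ht
    have hy0 : HasDerivAt (y 0) (deriv (y 0) p) p :=
      ((hz0d p hpI).congr_of_eventuallyEq (hyz 0 (left_mem_Icc.2 hT.le))).hasDerivAt
    have hsub : Ioc 0 t ⊆ Icc 0 T := fun s hs => ⟨hs.1.le, hs.2.trans ht.2⟩
    have h1 := (hasDerivAt_integral_of_dominated_loc_of_lip (μ := volume.restrict (Ioc 0 t))
      (F := fun q s => G (y s q)) (F' := F) (x₀ := p) (s := univ)
      (bound := fun _ => ((LG * C : ℝ≥0) : ℝ)) univ_mem
      (Eventually.of_forall fun q => (hGyc.comp (by fun_prop :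
        Continuous fun s : ℝ => (s, q))).aestronglyMeasurable)
      (((hGyc.comp (by fun_prop : Continuous fun s : ℝ => (s, p))).intervalIntegrable 0 t).1)
      hFm.aestronglyMeasurable
      (Eventually.of_forall fun s => by
        rw [Real.nnabs_of_nonneg (NNReal.coe_nonneg _), Real.toNNReal_coe]
        exact (hGyp s).lipschitzOnWith)
      (intervalIntegrable_const (a := 0) (b := t)).1 ?_).2
    · have h2 := hy0.add h1
      rw [intervalIntegral.integral_of_le ht.1]
      refine h2.congr_of_eventuallyEq ?_
      filter_upwards [hnear] with q hq
      have hq' := Ioo_subset_Icc_self hq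
      have h3 : ∫ s in (0 : ℝ)..t, G (y s q) = z q t - z q 0 := by
        refine intervalIntegral.integral_eq_sub_of_hasDeriv_right_of_le ht.1
          ((hzt q hq').continuousOn.mono (Icc_subset_Icc_right ht.2)) (fun s hs => ?_)
          ((hGyc.comp (by fun_prop : Continuous fun s : ℝ => (s, q))).intervalIntegrable 0 t)
        have hs' : s ∈ Icc 0 T := hsub (Ioo_subset_Ioc_self hs)
        have h4 := hz q hq' s hs'
        rw [show G (y s q) = G (z q s) by simp only [hy, hpae q hq', hpte s hs']]
        exact (h4.hasDerivAt (Icc_mem_nhds hs.1 (hs.2.trans_le ht.2))).hasDerivWithinAt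
      rw [Pi.add_apply, ← intervalIntegral.integral_of_le ht.1, h3]
      simp only [hy, hpae q hq', hpte t ht, hpte 0 (left_mem_Icc.2 hT.le)]
      abel
    · rw [ae_restrict_iff' measurableSet_Ioc]
      have hne : ∀ᵐ s : ℝ, s ≠ T := by simp [ae_iff, measure_singleton]
      filter_upwards [hchain, hne] with s hs hsT hsI
      have := (hs ⟨hsI.1, lt_of_le_of_ne (hsI.2.trans ht.2) hsT⟩).2
      exact this.differentiableAt.hasDerivAt
  have hWF : ∀ t ∈ Icc 0 T, W t = W 0 + ∫ s in (0 : ℝ)..t, F s := fun t ht => (hint t ht).deriv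
  refine ⟨W, F, fun t ht => ?_, ⟨LG * C, LipschitzOnWith.of_dist_le_mul fun s hs t ht => ?_⟩,
    fun t => hFint 0 t, hWF, ?_⟩
  · have := hint t ht
    rw [← hWF t ht] at this
    exact this.congr_of_eventuallyEq (hyz t ht).symm
  · rw [hWF s hs, hWF t ht, dist_add_left, dist_eq_norm,
      intervalIntegral.integral_interval_sub_left (hFint 0 s) (hFint 0 t), Real.dist_eq]
    exact intervalIntegral.norm_integral_le_of_norm_le_const fun u _ => hFb u
  · have hloc : LocallyIntegrable F volume := by
      refine (locallyIntegrable_const ((LG * C : ℝ≥0) : ℝ)).mono hFm.aestronglyMeasurable ?_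
      exact Eventually.of_forall fun s => by
        rw [Real.norm_of_nonneg (NNReal.coe_nonneg _)]
        exact hFb s
    filter_upwards [hchain, LocallyIntegrable.ae_hasDerivAt_integral hloc] with t h1 h2 ht
    obtain ⟨h3, h4⟩ := h1 ht
    refine ⟨h3, h4.deriv, ?_⟩
    refine ((h2 0).const_add (W 0)).congr_of_eventuallyEq ?_
    filter_upwards [Ioo_mem_nhds ht.1 ht.2] with s hs
    exact hWF s (Ioo_subset_Icc_self hs)

end Variation

/-! ### Regularity of the geodesic field along trajectories -/

theorem exists_lipschitzOnWith_smul {X V : Type*} [PseudoMetricSpace X] [NormedAddCommGroup V]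
    [NormedSpace ℝ V] {f : X → ℝ} {g : X → V} {s : Set X} {Kf Kg : ℝ≥0} {Bf Bg : ℝ}
    (hf : LipschitzOnWith Kf f s) (hg : LipschitzOnWith Kg g s) (hBf : ∀ x ∈ s, |f x| ≤ Bf)
    (hBg : ∀ x ∈ s, ‖g x‖ ≤ Bg) : ∃ K : ℝ≥0, LipschitzOnWith K (fun x => f x • g x) s := by
  refine ⟨(Bf * Kg + Kf * Bg).toNNReal, LipschitzOnWith.of_dist_le_mul fun x hx y hy => ?_⟩
  have h1 := hf.dist_le_mul x hx y hy
  have h2 := hg.dist_le_mul x hx y hy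
  rw [dist_eq_norm] at h1 h2
  have h3 := (abs_nonneg _).trans (hBf x hx)
  have h4 := (norm_nonneg _).trans (hBg y hy)
  rw [Real.coe_toNNReal _ (by positivity), dist_eq_norm]
  calc ‖f x • g x - f y • g y‖ = ‖f x • (g x - g y) + (f x - f y) • g y‖ := by
        congr 1; module
    _ ≤ |f x| * ‖g x - g y‖ + ‖f x - f y‖ * ‖g y‖ := by
        refine (norm_add_le _ _).trans ?_
        rw [norm_smul, norm_smul, Real.norm_eq_abs (f x)]
    _ ≤ Bf * (Kg * dist x y) + Kf * dist x y * Bg := by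
        gcongr
        exacts [hBf x hx, hBg y hy]
    _ = _ := by ring

variable {R : ℝ} {c : ℝ → ℝ}

theorem Admissible.exists_lipschitz_coeff (h : Admissible R c) {r₁ : ℝ} (hr0 : 0 < r₁)
    (hr₁ : R ≤ r₁) : ∃ K : ℝ≥0,
      LipschitzOnWith K (fun r => derivWithin c (Icc R 1) r / (c r * r)) (Icc r₁ 1) := by
  obtain ⟨K, hK⟩ := h.c11.2
  have hsub : Icc r₁ 1 ⊆ Icc R 1 := Icc_subset_Icc_left hr₁
  have hpos : ∀ r ∈ Icc r₁ 1, 0 < c r * r := fun r hr =>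
    mul_pos (h.pos r (hsub hr)) (hr0.trans_le hr.1)
  have hcont : ContinuousOn (fun r => (c r * r)⁻¹) (Icc r₁ 1) :=
    ((h.continuousOn.mono hsub).mul continuousOn_id).inv₀ fun r hr => (hpos r hr).ne'
  set d : ℝ → ℝ := fun r => -(derivWithin c (Icc R 1) r * r + c r) / (c r * r) ^ 2 with hd
  have hdc : ContinuousOn d (Icc r₁ 1) :=
    (((h.continuousOn_deriv.mono hsub).mul continuousOn_id).add
      (h.continuousOn.mono hsub)).neg.div (((h.continuousOn.mono hsub).mul continuousOn_id).pow 2)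
      fun r hr => pow_ne_zero 2 (hpos r hr).ne'
  obtain ⟨B, hB⟩ := isCompact_Icc.exists_bound_of_continuousOn hdc
  obtain ⟨B', hB'⟩ := isCompact_Icc.exists_bound_of_continuousOn hcont
  obtain ⟨B'', hB''⟩ := isCompact_Icc.exists_bound_of_continuousOn (h.continuousOn_deriv.mono hsub)
  have hinv : LipschitzOnWith B.toNNReal (fun r => (c r * r)⁻¹) (Icc r₁ 1) := by
    refine (convex_Icc r₁ 1).lipschitzOnWith_of_nnnorm_hasDerivWithin_le (f' := d)
      (fun r hr => ?_) fun r hr => ?_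
    · have h1 := (((h.hasDeriv (hsub hr)).mono hsub).mul (hasDerivWithinAt_id r _)).inv
        (hpos r hr).ne'
      exact h1.congr_deriv (by simp [hd])
    · rw [← NNReal.coe_le_coe, coe_nnnorm]
      exact (hB r hr).trans (Real.le_coe_toNNReal B)
  obtain ⟨K', hK'⟩ := exists_lipschitzOnWith_smul (hK.mono hsub) hinv hB'' hB'
  exact ⟨K', by simpa [div_eq_mul_inv] using hK'⟩

/-- The phase space region in which the acceleration is Lipschitz. -/
def phaseRegion (n : ℕ) (r₁ M : ℝ) : Set (E n × E n) := {q | ‖q.1‖ ∈ Icc r₁ 1 ∧ ‖q.2‖ ≤ M}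

/-- The geodesic equation as a first order system. -/
noncomputable def geodesicField {n : ℕ} (R : ℝ) (c : ℝ → ℝ) (q : E n × E n) : E n × E n :=
  (q.2, accel R c q.1 q.2)

theorem isCompact_phaseRegion (n : ℕ) (r₁ M : ℝ) : IsCompact (phaseRegion n r₁ M) := by
  refine Metric.isCompact_of_isClosed_isBounded ?_ ?_
  · exact (isClosed_Icc.preimage (by fun_prop : Continuous fun q : E n × E n => ‖q.1‖)).inter
      (isClosed_le continuous_snd.norm continuous_const)
  · refine (Metric.isBounded_closedBall (x := (0 : E n × E n)) (r := max 1 M)).subset fun q hq => ?_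
    rw [mem_closedBall_zero_iff, Prod.norm_def]
    exact max_le_max hq.1.2 hq.2

/-- The radius is kept away from 0, where the coefficient c'/(c r) could fail to be Lipschitz;
geodesics with angular momentum bounded below stay in such a region. -/
theorem Admissible.exists_lipschitz_geodesicField (h : Admissible R c) (n : ℕ) {r₁ : ℝ}
    (hr0 : 0 < r₁) (hr₁ : R ≤ r₁) (M : ℝ) : ∃ K : ℝ≥0,
      LipschitzOnWith K (geodesicField (n := n) R c) (phaseRegion n r₁ M) := by
  obtain ⟨K, hK⟩ := h.exists_lipschitz_coeff hr0 hr₁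
  have hcompact := isCompact_phaseRegion n r₁ M
  have h1 : LipschitzOnWith (K * 1) (fun q : E n × E n =>
      derivWithin c (Icc R 1) ‖q.1‖ / (c ‖q.1‖ * ‖q.1‖)) (phaseRegion n r₁ M) :=
    hK.comp (g := fun r => derivWithin c (Icc R 1) r / (c r * r))
      (f := fun q : E n × E n => ‖q.1‖)
      ((lipschitzWith_one_norm.comp LipschitzWith.prod_fst).lipschitzOnWith.weaken (by simp))
      fun q hq => hq.1
  have hcd : ContDiff ℝ 1 fun q : E n × E n => (2 * inner ℝ q.1 q.2 : ℝ) • q.2 - ‖q.2‖ ^ 2 • q.1 :=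
    ((contDiff_const.mul (contDiff_fst.inner ℝ contDiff_snd)).smul contDiff_snd).sub
      ((contDiff_snd.norm_sq ℝ).smul contDiff_fst)
  obtain ⟨K₂, h2⟩ := (hcd.locallyLipschitz.locallyLipschitzOn
    (s := phaseRegion n r₁ M)).exists_lipschitzOnWith_of_compact hcompact
  obtain ⟨B₁, hB₁⟩ := hcompact.exists_bound_of_continuousOn h1.continuousOn
  obtain ⟨B₂, hB₂⟩ := hcompact.exists_bound_of_continuousOn h2.continuousOn
  obtain ⟨K₃, h3⟩ := exists_lipschitzOnWith_smul h1 h2 hB₁ hB₂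
  exact ⟨_, LipschitzWith.prod_snd.lipschitzOnWith.prodMk h3⟩

theorem Admissible.differentiableAt_accel (h : Admissible R c) {n : ℕ} {q : E n × E n}
    (hq : ‖q.1‖ ∈ Ioo R 1) (hd : DifferentiableAt ℝ (derivWithin c (Icc R 1)) ‖q.1‖) :
    DifferentiableAt ℝ (fun q : E n × E n => accel R c q.1 q.2) q := by
  have hpos := h.pos_of_mem_Ioo hq
  have h0 : q.1 ≠ 0 := norm_pos_iff.1 hpos
  have hnorm : DifferentiableAt ℝ (fun q : E n × E n => ‖q.1‖) q :=
    differentiableAt_fst.norm ℝ h0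
  have hc : DifferentiableAt ℝ c ‖q.1‖ :=
    ((h.hasDeriv (Ioo_subset_Icc_self hq)).hasDerivAt (Icc_mem_nhds hq.1 hq.2)).differentiableAt
  have h1 : DifferentiableAt ℝ (fun q : E n × E n => derivWithin c (Icc R 1) ‖q.1‖) q :=
    DifferentiableAt.comp (g := derivWithin c (Icc R 1)) (f := fun q : E n × E n => ‖q.1‖) q hd hnorm
  have h2 : DifferentiableAt ℝ (fun q : E n × E n => c ‖q.1‖) q :=
    DifferentiableAt.comp (g := c) (f := fun q : E n × E n => ‖q.1‖) q hc hnorm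
  have hne : c ‖q.1‖ * ‖q.1‖ ≠ 0 := (mul_pos (h.pos _ (Ioo_subset_Icc_self hq)) hpos).ne'
  simp only [accel, div_eq_mul_inv]
  refine (h1.fun_mul ((h2.fun_mul hnorm).fun_inv hne)).fun_smul ?_
  exact (((differentiableAt_const (2 : ℝ)).fun_mul (differentiableAt_fst.inner ℝ
    differentiableAt_snd)).fun_smul differentiableAt_snd).fun_sub
      ((differentiableAt_snd.norm_sq ℝ).fun_smul differentiableAt_fst)

theorem Admissible.volume_nondifferentiable (h : Admissible R c) :
    volume {r | r ∈ Ioo R 1 ∧ ¬DifferentiableAt ℝ (derivWithin c (Icc R 1)) r} = 0 := by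
  obtain ⟨K, hK⟩ := h.c11.2
  have h1 := hK.ae_differentiableWithinAt_of_mem_real
  rw [ae_iff] at h1
  refine measure_mono_null (fun r hr => ?_) h1
  intro h2
  exact hr.2 ((h2 (Ioo_subset_Icc_self hr.1)).differentiableAt (Icc_mem_nhds hr.1.1 hr.1.2))

/-- Change of variables for the indicator of a measurable null hull of N: its integral over the
image is 0, and the Jacobian vanishes nowhere. -/
theorem ae_notMem_of_hasDerivAt {f f' : ℝ → ℝ} {a b : ℝ}
    (hf : ∀ t ∈ Ioo a b, HasDerivAt f (f' t) t) (hf'c : ContinuousOn f' (Ioo a b))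
    (hne : ∀ t ∈ Ioo a b, f' t ≠ 0) (hinj : InjOn f (Ioo a b)) {N : Set ℝ} (hN : volume N = 0) :
    ∀ᵐ t, t ∈ Ioo a b → f t ∉ N := by
  set N' := toMeasurable volume N with hN'
  have hN'0 : volume N' = 0 := by rw [hN', measure_toMeasurable, hN]
  have hm : MeasurableSet N' := measurableSet_toMeasurable _ _
  set g : ℝ → ENNReal := N'.indicator 1 with hg
  have hgm : Measurable g := measurable_one.indicator hm
  have h1 := lintegral_image_eq_lintegral_abs_deriv_mul measurableSet_Ioo
    (fun t ht => (hf t ht).hasDerivWithinAt) hinj g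
  have h2 : ∫⁻ x in f '' Ioo a b, g x = 0 := by
    refine le_antisymm ((setLIntegral_le_lintegral _ _).trans ?_) (zero_le)
    rw [hg, lintegral_indicator_one hm, hN'0]
  have hfc : ContinuousOn f (Ioo a b) := fun t ht => (hf t ht).continuousAt.continuousWithinAt
  rw [h2, eq_comm, lintegral_eq_zero_iff'] at h1
  · rw [EventuallyEq, ae_restrict_iff' measurableSet_Ioo] at h1
    filter_upwards [h1] with t ht htI htN
    have h3 := ht htI
    have h4 : f t ∈ N' := subset_toMeasurable _ _ htN
    simp [hg, h4, hne t htI] at h3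
  · exact ((hf'c.aemeasurable measurableSet_Ioo).abs.ennreal_ofReal).mul
      (hgm.comp_aemeasurable (hfc.aemeasurable measurableSet_Ioo))

/-- On either side of the turning time the radius is injective with nonzero derivative, so it meets
the null set of radii where c' is not differentiable only at a null set of times. -/
theorem Profile.ae_differentiableAt {p T : ℝ} {r y φ : ℝ → ℝ} (hP : Profile R c p T r y φ)
    (h : Admissible R c) (hp : 0 < p) (hpR : rho c R < p) :
    ∀ᵐ t, t ∈ Ioo 0 T → r t ∈ Ioo R 1 ∧ DifferentiableAt ℝ (derivWithin c (Icc R 1)) (r t) := by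
  obtain ⟨t₀, ht₀, hturn⟩ := hP.turning
  have hy0 : y t₀ = 0 := by
    have := hP.rho_sq t₀ ht₀
    rw [hturn] at this
    nlinarith
  have hu : ∀ t, p ^ 2 + y t ^ 2 ≠ 0 := fun t => by positivity
  have key : ∀ a b : ℝ, 0 ≤ a → b ≤ T → ((∀ t ∈ Ioo a b, y t < 0) ∨ ∀ t ∈ Ioo a b, 0 < y t) →
      ∀ᵐ t, t ∈ Ioo a b →
        r t ∉ {r | r ∈ Ioo R 1 ∧ ¬DifferentiableAt ℝ (derivWithin c (Icc R 1)) r} := by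
    intro a b ha hb hs
    have hsub : Ioo a b ⊆ Icc 0 T := fun t ht => ⟨ha.trans ht.1.le, ht.2.le.trans hb⟩
    have hyc : ContinuousOn y (Ioo a b) := fun t ht =>
      (hP.hasDeriv_y t (hsub ht)).continuousAt.continuousWithinAt
    have hrc : ContinuousOn r (Ioo a b) := fun t ht =>
      (hP.hasDeriv_r t (hsub ht)).continuousAt.continuousWithinAt
    refine ae_notMem_of_hasDerivAt (fun t ht => hP.hasDeriv_r t (hsub ht))
      ((hyc.mul hrc).div (continuousOn_const.add (hyc.pow 2)) fun t _ => hu t)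
      (fun t ht => ?_) (fun s hs' t ht hst => ?_) h.volume_nondifferentiable
    · refine div_ne_zero (mul_ne_zero ?_ (hP.r_pos h hp (hsub ht)).ne') (hu t)
      rcases hs with hs | hs
      exacts [(hs t ht).ne, (hs t ht).ne']
    · have e1 := hP.rho_sq s (hsub hs')
      have e2 := hP.rho_sq t (hsub ht)
      rw [hst] at e1
      have h3 : (y s - y t) * (y s + y t) = 0 := by linarith
      refine hP.y_strictMono.injective ?_
      rcases mul_eq_zero.1 h3 with h4 | h4
      · linarith
      · exfalso
        rcases hs with hs | hs <;> linarith [hs s hs', hs t ht]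
  have hne : ∀ᵐ t : ℝ, t ≠ t₀ := by simp [ae_iff, measure_singleton]
  filter_upwards [key 0 t₀ le_rfl ht₀.2 (Or.inl fun t ht => hy0 ▸ hP.y_strictMono ht.2),
    key t₀ T ht₀.1 le_rfl (Or.inr fun t ht => hy0 ▸ hP.y_strictMono ht.1), hne] with t h1 h2 h3 ht
  have hrI : r t ∈ Ioo R 1 := by
    have hm := hP.mem t (Ioo_subset_Icc_self ht)
    refine ⟨lt_of_le_of_ne hm.1 fun heq => ?_, hP.interior t ht⟩
    have e1 := hP.rho_sq t (Ioo_subset_Icc_self ht)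
    rw [← heq] at e1
    have := h.rho_nonneg h.left_mem
    nlinarith [sq_nonneg (y t)]
  refine ⟨hrI, ?_⟩
  by_contra hnd
  rcases lt_or_gt_of_ne h3 with hlt | hgt
  · exact h1 ⟨ht.1, hlt⟩ ⟨hrI, hnd⟩
  · exact h2 ⟨hgt, ht.2⟩ ⟨hrI, hnd⟩

theorem Profile.hasRadius {n : ℕ} {e f : E n} {p T : ℝ} {r y φ : ℝ → ℝ}
    (hP : Profile R c p T r y φ) (h : Admissible R c) (ho : OrthoPair e f) (hp : 0 < p)
    {r₀ : ℝ} (hr₀ : r₀ ∈ Icc R 1) (hρ : rho c r₀ = p) (θ : ℝ) :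
    HasRadius T (position e f r φ θ) r₀ := by
  constructor
  · obtain ⟨t, ht, hturn⟩ := hP.turning
    refine ⟨t, ht, ?_⟩
    simp only [hP.norm_position h ho θ ht]
    exact h.strictMonoOn_rho.injOn (hP.mem t ht) hr₀ (hturn.trans hρ.symm)
  · rintro _ ⟨t, ht, rfl⟩
    simp only [hP.norm_position h ho θ ht]
    refine (h.strictMonoOn_rho.le_iff_le hr₀ (hP.mem t ht)).1 ?_
    rw [hρ]
    have h1 := hP.rho_sq t ht
    have h2 := h.rho_nonneg (hP.mem t ht)
    nlinarith [sq_nonneg (y t)]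

/-- If the opening angle is constant on an interval, so is the length. -/
theorem Admissible.travelTime_eq_of_const (h : Admissible R c) {a b : ℝ} (ha : 0 < a)
    (hA : ∀ p ∈ Icc a b, openingAngle R c p = openingAngle R c a) :
    ∀ p ∈ Icc a b, travelTime R c p = travelTime R c a := by
  intro p hp
  have hd : ∀ q ∈ Icc a b, HasDerivAt
      (fun q => interceptTime R c q + q * openingAngle R c a) 0 q := fun q hq => by
    refine ((h.hasDerivAt_interceptTime (ha.trans_le hq.1)).2.add
      ((hasDerivAt_id q).mul_const _)).congr_deriv ?_
    rw [hA q hq]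
    ring
  have h1 := constant_of_has_deriv_right_zero
    (fun q hq => (hd q hq).continuousAt.continuousWithinAt)
    (fun q hq => (hd q (Ico_subset_Icc_self hq)).hasDerivWithinAt) p hp
  rw [h.travelTime_eq (ha.trans_le hp.1), h.travelTime_eq ha, hA p hp]
  exact h1

/-! ### Jacobi fields and nonconstancy of the opening angle -/

variable {n : ℕ} {R : ℝ} {c : ℝ → ℝ}

/-- A derivative of the geodesic flow in a parameter is a Jacobi field. -/
theorem isJacobiField_of_variation {T : ℝ} {x v : ℝ → E n} {W F : ℝ → E n × E n}
    (hlip : ∃ C : ℝ≥0, LipschitzOnWith C W (Icc 0 T))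
    (hF : ∀ t, IntervalIntegrable F volume 0 t)
    (hW : ∀ t ∈ Icc 0 T, W t = W 0 + ∫ s in (0 : ℝ)..t, F s)
    (hae : ∀ᵐ t, t ∈ Ioo 0 T → DifferentiableAt ℝ (geodesicField R c) (x t, v t) ∧
      F t = fderiv ℝ (geodesicField R c) (x t, v t) (W t) ∧ HasDerivAt W (F t) t) :
    IsJacobiField R c T x v (fun t => (W t).1) (fun t => (W t).2) := by
  obtain ⟨C, hC⟩ := hlip
  have hC2 : LipschitzOnWith (1 * C) (fun t => (W t).2) (Icc 0 T) :=
    LipschitzWith.prod_snd.comp_lipschitzOnWith hC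
  have hfd : ∀ q : E n × E n, DifferentiableAt ℝ (geodesicField R c) q → ∀ w,
      fderiv ℝ (geodesicField R c) q w =
        (w.2, fderiv ℝ (fun q : E n × E n => accel R c q.1 q.2) q w) := by
    intro q hq w
    have h2 : DifferentiableAt ℝ (fun q : E n × E n => accel R c q.1 q.2) q := hq.snd
    have h3 : HasFDerivAt (geodesicField R c) _ q := differentiableAt_snd.hasFDerivAt.prodMk
      h2.hasFDerivAt
    rw [h3.fderiv]
    simp [fderiv_snd]
  refine ⟨fun t ht => ?_, ⟨_, hC2⟩, ?_⟩
  · have hT : 0 ≤ T := ht.1.trans ht.2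
    -- The first component of F equals the second component of W almost everywhere. The latter is
    -- continuous, so the integral is differentiable at every time, end points included.
    set g : ℝ → E n := IccExtend hT ((Icc 0 T).domRestrict fun t => (W t).2) with hg
    have hgc : Continuous g := hC2.continuousOn.domRestrict.Icc_extend'
    have hge : ∀ s ∈ Icc 0 T, g s = (W s).2 := fun s hs => by
      rw [hg, IccExtend_of_mem _ _ hs, domRestrict_apply]
    have h1 := ((hgc.integral_hasStrictDerivAt 0 t).hasDerivAt.const_add
      ((W 0).1)).hasDerivWithinAt (s := Icc 0 T)
    rw [hge t ht] at h1
    refine h1.congr_of_mem (fun u hu => ?_) ht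
    have h2 : (∫ s in (0 : ℝ)..u, F s).1 = ∫ s in (0 : ℝ)..u, (F s).1 := by
      have := (ContinuousLinearMap.fst ℝ (E n) (E n)).intervalIntegral_comp_comm (hF u)
      simpa using this.symm
    rw [hW u hu, Prod.fst_add, h2]
    congr 1
    refine intervalIntegral.integral_congr_ae ?_
    have hne : ∀ᵐ s : ℝ, s ≠ T := by simp [ae_iff, measure_singleton]
    filter_upwards [hae, hne] with s hs hsT hsu
    rw [uIoc_of_le hu.1] at hsu
    obtain ⟨h3, h4, -⟩ := hs ⟨hsu.1, lt_of_le_of_ne (hsu.2.trans hu.2) hsT⟩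
    rw [h4, hfd _ h3, hge s ⟨hsu.1.le, hsu.2.trans hu.2⟩]
  · filter_upwards [hae] with t ht htI
    obtain ⟨h3, h4, h5⟩ := ht htI
    rw [h4, hfd _ h3] at h5
    exact h5.snd

/-- The velocity at the outer boundary in terms of the angular momentum. -/
noncomputable def initialVelocity (c : ℝ → ℝ) (e f : E n) (p : ℝ) : E n :=
  (rho c 1 ^ 2)⁻¹ • (-√(rho c 1 ^ 2 - p ^ 2) • e + p • f)

theorem contDiffAt_initialVelocity {e f : E n} {p : ℝ} (hp0 : 0 ≤ p) (hp : p < rho c 1) :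
    ContDiffAt ℝ 1 (initialVelocity c e f) p := by
  have hpos : rho c 1 ^ 2 - p ^ 2 ≠ 0 := by nlinarith
  have h1 : ContDiffAt ℝ 1 (fun p : ℝ => √(rho c 1 ^ 2 - p ^ 2)) p :=
    (contDiffAt_const.sub (contDiffAt_id.pow 2)).sqrt hpos
  exact ((h1.neg.smul contDiffAt_const).add (contDiffAt_id.smul contDiffAt_const)).const_smul _

theorem Profile.initial_eq {e f : E n} {p T : ℝ} {r y φ : ℝ → ℝ} (hP : Profile R c p T r y φ) :
    position e f r φ 0 0 = e ∧ velocity e f p r y φ 0 0 = initialVelocity c e f p := by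
  have h1 := hP.rho_sq 0 (left_mem_Icc.2 hP.T_pos.le)
  rw [hP.start] at h1
  constructor
  · simp [position, radialVec, hP.start, hP.φ_zero]
  · rw [velocity, ← h1, initialVelocity, hP.start, hP.φ_zero, hP.y_zero]
    simp [radialVec, angularVec]

/-- Under the countable conjugacy condition the opening angle is not constant on any interval. -/
theorem Admissible.exists_openingAngle_ne (h : Admissible R c) (hn : 2 ≤ n)
    (hconj : CountableConjugacy n R c) {a b : ℝ} (hab : a < b) (ha : rho c R < a)
    (hb : b < rho c 1) : ∃ p ∈ Icc a b, openingAngle R c p ≠ openingAngle R c a := by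
  by_contra! hA
  have hρR := h.rho_nonneg h.left_mem
  have ha0 : 0 < a := hρR.trans_lt ha
  have hL := h.travelTime_eq_of_const ha0 hA
  obtain ⟨e, f, ho⟩ := exists_orthoPair hn
  -- Constancy of α and L gives all geodesics of the family the same duration and the same final
  -- angle.
  have hex : ∀ p : ℝ, ∃ (r y φ : ℝ → ℝ), p ∈ Icc a b →
      Profile R c p (travelTime R c a) r y φ ∧ φ (travelTime R c a) = openingAngle R c a := by
    intro p
    by_cases hp : p ∈ Icc a b
    · obtain ⟨T, r, y, φ, hP⟩ := h.exists_profile (ha0.trans_le hp.1) (ha.trans_le hp.1)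
        (hp.2.trans_lt hb)
      obtain ⟨h1, h2⟩ := hP.time_eq h ho (ha0.trans_le hp.1) (ha.trans_le hp.1)
      rw [h1, hL p hp] at hP
      rw [h1, hL p hp, hA p hp] at h2
      exact ⟨r, y, φ, fun _ => ⟨hP, h2⟩⟩
    · exact ⟨0, 0, 0, fun h' => absurd h' hp⟩
  choose r y φ hprof using hex
  set T := travelTime R c a with hTdef
  have hP : ∀ p ∈ Icc a b, Profile R c p T (r p) (y p) (φ p) := fun p hp => (hprof p hp).1
  have hpos : ∀ p ∈ Icc a b, 0 < p := fun p hp => ha0.trans_le hp.1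
  have hRp : ∀ p ∈ Icc a b, rho c R < p := fun p hp => ha.trans_le hp.1
  have hT : 0 < T := (hP a (left_mem_Icc.2 hab.le)).T_pos
  have m0 : (0 : ℝ) ∈ Icc 0 T := left_mem_Icc.2 hT.le
  have mT : T ∈ Icc 0 T := right_mem_Icc.2 hT.le
  set x : ℝ → ℝ → E n := fun p => position e f (r p) (φ p) 0 with hx
  set v : ℝ → ℝ → E n := fun p => velocity e f p (r p) (y p) (φ p) 0 with hv
  have hgeo : ∀ p ∈ Icc a b, IsMaximalGeodesic R c T (x p) (v p) := fun p hp =>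
    (hP p hp).isMaximalGeodesic h ho (hpos p hp) (hRp p hp) 0
  -- The turning radius for p = a, the smallest radius reached by the family.
  obtain ⟨r₁, hr₁, hρ₁⟩ := intermediate_value_Icc h.R_lt_one.le h.continuousOn_rho
    ⟨ha.le, (hab.trans hb).le⟩
  have hr₁pos : 0 < r₁ := by
    refine lt_of_le_of_ne (h.nonneg_of_mem hr₁) fun h0 => ?_
    rw [← h0, rho, zero_div] at hρ₁
    linarith
  obtain ⟨M, hM⟩ := isCompact_Icc.exists_bound_of_continuousOn h.continuousOn
  obtain ⟨LG, hLG⟩ := h.exists_lipschitz_geodesicField n hr₁pos hr₁.1 M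
  obtain ⟨B, hB⟩ := (isCompact_phaseRegion n r₁ M).exists_bound_of_continuousOn hLG.continuousOn
  set z : ℝ → ℝ → E n × E n := fun p t => (x p t, v p t) with hz
  have hnorm : ∀ p ∈ Icc a b, ∀ t ∈ Icc 0 T, ‖x p t‖ = r p t := fun p hp t ht =>
    (hP p hp).norm_position h ho 0 ht
  have hzK : ∀ p ∈ Icc a b, ∀ t ∈ Icc 0 T, z p t ∈ phaseRegion n r₁ M := by
    intro p hp t ht
    have hm := (hP p hp).mem t ht
    refine ⟨?_, ?_⟩
    · simp only [hz, hnorm p hp t ht]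
      refine ⟨(h.strictMonoOn_rho.le_iff_le hr₁ hm).1 ?_, hm.2⟩
      rw [hρ₁]
      have h1 := (hP p hp).rho_sq t ht
      have h2 := h.rho_nonneg hm
      have h3 := hp.1
      nlinarith [sq_nonneg (y p t)]
    · simp only [hz]
      rw [(hgeo p hp).unit_speed t ht, hnorm p hp t ht]
      exact (le_abs_self _).trans (hM _ hm)
  have hzd : ∀ p ∈ Icc a b, ∀ t ∈ Icc 0 T,
      HasDerivWithinAt (z p) (geodesicField R c (z p t)) (Icc 0 T) t := fun p hp t ht =>
    ((hgeo p hp).hasDeriv t ht).prodMk ((hgeo p hp).geodesic t ht)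
  have hz0 : ∀ p ∈ Icc a b, z p 0 = (e, initialVelocity c e f p) := fun p hp => by
    obtain ⟨h1, h2⟩ := (hP p hp).initial_eq (e := e) (f := f)
    simp only [hz, hx, hv, h1, h2]
  have hζ : ∀ p ∈ Icc a b, ContDiffAt ℝ 1 (fun p => (e, initialVelocity c e f p)) p := fun p hp =>
    contDiffAt_const.prodMk (contDiffAt_initialVelocity (hpos p hp).le (hp.2.trans_lt hb))
  obtain ⟨L₀, hL₀⟩ : ∃ L₀ : ℝ≥0, LipschitzOnWith L₀ (fun p => z p 0) (Icc a b) := by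
    have hloc : LocallyLipschitzOn (Icc a b) fun p => (e, initialVelocity c e f p) := by
      intro p hp
      obtain ⟨K, s, hs, hl⟩ := (hζ p hp).exists_lipschitzOnWith
      exact ⟨K, s, mem_nhdsWithin_of_mem_nhds hs, hl⟩
    obtain ⟨K, hK⟩ := hloc.exists_lipschitzOnWith_of_compact isCompact_Icc
    refine ⟨K, fun p hp q hq => ?_⟩
    have := hK hp hq
    simp only at this ⊢
    rwa [hz0 p hp, hz0 q hq]
  have hIoo : ∀ p ∈ Ioo a b, ∀ᶠ q in 𝓝 p, q ∈ Icc a b := fun p hp => Icc_mem_nhds hp.1 hp.2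
  have hvar := ae_exists_variation hLG hB hab hT hzK hzd hL₀
    (fun p hp => ((hζ p (Ioo_subset_Icc_self hp)).differentiableAt one_ne_zero
      ).congr_of_eventuallyEq (by filter_upwards [hIoo p hp] with q hq using hz0 q hq))
    (fun p hp => by
      have hp' := Ioo_subset_Icc_self hp
      filter_upwards [(hP p hp').ae_differentiableAt h (hpos p hp') (hRp p hp')] with t ht htI
      obtain ⟨h1, h2⟩ := ht htI
      rw [← hnorm p hp' t (Ioo_subset_Icc_self htI)] at h1 h2
      exact differentiableAt_snd.prodMk (h.differentiableAt_accel (q := z p t) h1 h2))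
  -- for almost every parameter the end points are conjugate
  have hsub : ∀ᵐ p, p ∈ Ioo a b → p ∈ rho c '' {r : ℝ | r ∈ Ioo R 1 ∧
      ∃ (T : ℝ) (x v : ℝ → E n), IsMaximalGeodesic R c T x v ∧ HasRadius T x r ∧
        EndpointsConjugate R c T x v} := by
    filter_upwards [hvar] with p hp hpI
    obtain ⟨W, F, hWd, hWl, hF, hWF, hWae⟩ := hp hpI
    have hpI' := Ioo_subset_Icc_self hpI
    obtain ⟨r₀, hr₀, hρ₀⟩ := intermediate_value_Ioo h.R_lt_one.le h.continuousOn_rho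
      ⟨hRp p hpI', hpI.2.trans hb⟩
    refine ⟨r₀, ⟨hr₀, T, x p, v p, hgeo p hpI', (hP p hpI').hasRadius h ho (hpos p hpI')
      (Ioo_subset_Icc_self hr₀) hρ₀ 0, fun t => (W t).1, fun t => (W t).2, ?_, ?_, ?_, ?_⟩, hρ₀⟩
    · exact isJacobiField_of_variation hWl hF hWF hWae
    · have h1 : HasDerivAt (fun q => (z q 0).1) (W 0).1 p := (hWd 0 m0).fst
      have h2 : HasDerivAt (fun q => (z q 0).1) 0 p :=
        (hasDerivAt_const p e).congr_of_eventuallyEq (by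
          filter_upwards [hIoo p hpI] with q hq
          rw [hz0 q hq])
      exact h1.unique h2
    -- At the common time T all geodesics are at the same point, at angle α(a).
    · have h1 : HasDerivAt (fun q => (z q T).1) (W T).1 p := (hWd T mT).fst
      have h2 : HasDerivAt (fun q => (z q T).1) 0 p :=
        (hasDerivAt_const p (radialVec e f (openingAngle R c a))).congr_of_eventuallyEq (by
          filter_upwards [hIoo p hpI] with q hq
          simp only [hz, hx, position, (hP q hq).finish, (hprof q hq).2, one_smul, add_zero])
      exact h1.unique h2
    -- A vanishing field would have J'(0) = 0, but the f-component of the initial velocity is p /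
    -- ρ(1)², whose derivative in p is not zero.
    · by_contra! hJ0
      have hJd : HasDerivWithinAt (fun t => (W t).1) (W 0).2 (Icc 0 T) 0 :=
        (isJacobiField_of_variation (x := x p) (v := v p) hWl hF hWF hWae).hasDeriv 0 m0
      have hJ0' : HasDerivWithinAt (fun t => (W t).1) 0 (Icc 0 T) 0 :=
        (hasDerivWithinAt_const 0 (Icc 0 T) (0 : E n)).congr_of_mem (fun t ht => hJ0 t ht) m0
      have hW0 : (W 0).2 = 0 :=
        (uniqueDiffOn_Icc hT 0 m0).eq_deriv _ hJd hJ0'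
      have h1 : HasDerivAt (fun q => (z q 0).2) (W 0).2 p := (hWd 0 m0).snd
      rw [hW0] at h1
      have h2 : HasDerivAt (fun q => (inner ℝ f (z q 0).2 : ℝ)) 0 p := by
        have := (hasDerivAt_const p f).inner ℝ h1
        simpa using this
      have h3 : HasDerivAt (fun q => (inner ℝ f (z q 0).2 : ℝ)) (rho c 1 ^ 2)⁻¹ p := by
        refine HasDerivAt.congr_of_eventuallyEq
          (((hasDerivAt_id p).const_mul (rho c 1 ^ 2)⁻¹).congr_deriv (mul_one _)) ?_
        filter_upwards [hIoo p hpI] with q hq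
        have hfe : inner ℝ f e = (0 : ℝ) := by rw [real_inner_comm]; exact ho.cross
        rw [hz0 q hq]
        simp only [initialVelocity, inner_smul_right, inner_add_right, hfe, ho.right]
        simp
      have h4 : (0 : ℝ) < rho c 1 := (hpos p hpI').trans (hpI.2.trans hb)
      have h5 := h2.unique h3
      have h6 : 0 < (rho c 1 ^ 2)⁻¹ := by positivity
      linarith
  have hnull : volume (rho c '' {r : ℝ | r ∈ Ioo R 1 ∧
      ∃ (T : ℝ) (x v : ℝ → E n), IsMaximalGeodesic R c T x v ∧ HasRadius T x r ∧
        EndpointsConjugate R c T x v}) = 0 :=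
    (Set.Countable.image hconj _).measure_zero _
  have hvol : volume (Ioo a b) = 0 := by
    refine measure_mono_null_ae ?_ hnull
    filter_upwards [hsub] with p hp hpI using hp hpI
  rw [Real.volume_Ioo, ENNReal.ofReal_eq_zero] at hvol
  linarith

/-! ### Injectivity of the Abel-type transform -/

/-- The primitive is half the arcsine of the affine function of p² that maps q, u to -1, 1. The
integral does not depend on q and u, which is what makes the transform invertible. -/
theorem abel_kernel {q u : ℝ} (hq : 0 ≤ q) (hu : q < u) :
    IntegrableOn (fun p => p / (√(p ^ 2 - q ^ 2) * √(u ^ 2 - p ^ 2))) (Ioo q u) ∧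
      ∫ p in Ioo q u, p / (√(p ^ 2 - q ^ 2) * √(u ^ 2 - p ^ 2)) = Real.pi / 2 := by
  have hD : 0 < u ^ 2 - q ^ 2 := by nlinarith
  set w : ℝ → ℝ := fun p => (2 * p ^ 2 - q ^ 2 - u ^ 2) / (u ^ 2 - q ^ 2) with hw
  set A : ℝ → ℝ := fun p => Real.arcsin (w p) / 2 with hA
  have hAc : ContinuousOn A (Icc q u) :=
    ((Real.continuous_arcsin.comp (by fun_prop : Continuous w)).div_const 2).continuousOn
  have hder : ∀ p ∈ Ioo q u, HasDerivAt A (p / (√(p ^ 2 - q ^ 2) * √(u ^ 2 - p ^ 2))) p := by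
    intro p hp
    have h1 : 0 < p ^ 2 - q ^ 2 := by nlinarith [hp.1]
    have h2 : 0 < u ^ 2 - p ^ 2 := by nlinarith [hp.1, hp.2]
    have hwd : HasDerivAt w (4 * p / (u ^ 2 - q ^ 2)) p := by
      refine HasDerivAt.congr_deriv (((((hasDerivAt_id p).pow 2).const_mul 2).sub_const
        (q ^ 2)).sub_const (u ^ 2) |>.div_const (u ^ 2 - q ^ 2)) ?_
      simp only [id, Nat.cast_ofNat, Nat.add_one_sub_one, pow_one, mul_one]
      ring
    have hs : 1 - w p ^ 2 = (2 * (√(p ^ 2 - q ^ 2) * √(u ^ 2 - p ^ 2)) / (u ^ 2 - q ^ 2)) ^ 2 := by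
      rw [show (2 * (√(p ^ 2 - q ^ 2) * √(u ^ 2 - p ^ 2)) / (u ^ 2 - q ^ 2)) ^ 2 =
        4 * (√(p ^ 2 - q ^ 2) ^ 2 * √(u ^ 2 - p ^ 2) ^ 2) / (u ^ 2 - q ^ 2) ^ 2 by
          rw [div_pow, mul_pow, mul_pow]; norm_num,
        Real.sq_sqrt h1.le, Real.sq_sqrt h2.le, hw]
      field_simp
      ring
    have hr : 0 < √(p ^ 2 - q ^ 2) * √(u ^ 2 - p ^ 2) :=
      mul_pos (Real.sqrt_pos.2 h1) (Real.sqrt_pos.2 h2)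
    have hpos : 0 < 1 - w p ^ 2 := by
      rw [hs]
      positivity
    have h3 := ((Real.hasDerivAt_arcsin (x := w p) (by nlinarith) (by nlinarith)).comp p
      hwd).div_const 2
    refine HasDerivAt.congr_deriv h3 ?_
    rw [hs, Real.sqrt_sq (by positivity)]
    field_simp
    ring
  have hint := intervalIntegral.integrableOn_deriv_of_nonneg hAc hder fun p hp =>
    div_nonneg (hq.trans hp.1.le) (by positivity)
  refine ⟨hint.mono_set Ioo_subset_Ioc_self, ?_⟩
  rw [← integral_Ioc_eq_integral_Ioo, ← intervalIntegral.integral_of_le hu.le,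
    intervalIntegral.integral_eq_sub_of_hasDerivAt_of_le hu.le hAc hder
      ((intervalIntegrable_iff_integrableOn_Ioc_of_le hu.le).2 hint)]
  have h1 : w u = 1 := by
    simp only [hw]
    rw [div_eq_one_iff_eq hD.ne']
    ring
  have h2 : w q = -1 := by
    simp only [hw]
    rw [div_eq_iff hD.ne']
    ring
  simp only [hA, h1, h2, Real.arcsin_one, Real.arcsin_neg_one]
  ring

theorem abel_kernel_extend {q u m : ℝ} (hq : 0 ≤ q) (hu : 0 ≤ u) (hum : u ≤ m) :
    IntegrableOn (fun p => p / (√(p ^ 2 - q ^ 2) * √(u ^ 2 - p ^ 2))) (Ioo q m) ∧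
      ∫ p in Ioo q m, p / (√(p ^ 2 - q ^ 2) * √(u ^ 2 - p ^ 2)) =
        if q < u then Real.pi / 2 else 0 := by
  have hz : ∀ p ∈ Ioo q m \ Ioo q u, p / (√(p ^ 2 - q ^ 2) * √(u ^ 2 - p ^ 2)) = 0 := by
    intro p hp
    have hup : u ≤ p := by
      by_contra! hlt
      exact hp.2 ⟨hp.1.1, hlt⟩
    rw [Real.sqrt_eq_zero_of_nonpos (by nlinarith : u ^ 2 - p ^ 2 ≤ 0)]
    simp
  rw [setIntegral_eq_of_subset_of_forall_sdiff_eq_zero measurableSet_Ioo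
    (Ioo_subset_Ioo_right hum) hz]
  split_ifs with hqu
  · obtain ⟨h1, h2⟩ := abel_kernel hq hqu
    exact ⟨h1.of_forall_sdiff_eq_zero measurableSet_Ioo hz, h2⟩
  · rw [Ioo_eq_empty hqu] at hz ⊢
    refine ⟨?_, by simp⟩
    exact (integrableOn_zero (s := Ioo q m)).congr_fun (fun p hp => (hz p (by simpa using hp)).symm)
      measurableSet_Ioo

variable {R : ℝ} {c : ℝ → ℝ}

/-- The Abel-type transform of a continuous function depends continuously on the radius. -/
theorem Admissible.continuousAt_abel (h : Admissible R c) {f : ℝ → ℝ}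
    (hf : ContinuousOn f (Icc R 1)) {r₀ : ℝ} (hr₀ : r₀ ∈ Ioo R 1) :
    ContinuousAt (fun r => ∫ s in Ioo R 1, f s / √(rho c s ^ 2 - rho c r ^ 2)) r₀ := by
  set g : ℝ → ℝ → ℝ := fun r => (Ioo R 1).indicator fun s => f s / √(rho c s ^ 2 - rho c r ^ 2)
    with hg
  -- The translation s = r + w fixes the singularity at w = 0 independently of r, so dominated
  -- convergence applies.
  have hshift : (fun r => ∫ s in Ioo R 1, f s / √(rho c s ^ 2 - rho c r ^ 2)) =
      fun r => ∫ w, g r (r + w) := by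
    funext r
    rw [integral_add_left_eq_self (μ := (volume : Measure ℝ)) (g r) r, hg,
      integral_indicator measurableSet_Ioo]
  rw [hshift]
  obtain ⟨δ, hδ, hle⟩ := h.exists_rho_sub_ge
  obtain ⟨B, hB⟩ := isCompact_Icc.exists_bound_of_continuousOn hf
  have hB0 : 0 ≤ B := (norm_nonneg _).trans (hB R h.left_mem)
  -- A radius strictly between R and r₀, so that ρ(r₁) > 0 even if R = 0; then ρ(r + w)² - ρ(r)² ≥ δ
  -- w ρ(r₁) for all r near r₀.
  set r₁ := (R + r₀) / 2 with hr₁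
  have hr₁m : r₁ ∈ Icc R 1 := ⟨by linarith [hr₀.1], by linarith [hr₀.1, hr₀.2]⟩
  have hκ : 0 < δ * rho c r₁ := by
    refine mul_pos hδ (lt_of_le_of_lt (h.rho_nonneg h.left_mem)
      (h.strictMonoOn_rho h.left_mem hr₁m ?_))
    linarith [hr₀.1]
  have hnear : ∀ᶠ r in 𝓝 r₀, r ∈ Ioo r₁ 1 := Ioo_mem_nhds (by linarith [hr₀.1]) hr₀.2
  have hz : ∀ r ∈ Ioo r₁ 1, ∀ w ≤ 0, g r (r + w) = 0 := by
    intro r hr w hw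
    by_cases hs : r + w ∈ Ioo R 1
    · have hrI : r ∈ Icc R 1 := ⟨hr₁m.1.trans hr.1.le, hr.2.le⟩
      have hsI := Ioo_subset_Icc_self hs
      have h1 := h.strictMonoOn_rho.monotoneOn hsI hrI (by linarith)
      have h2 := h.rho_nonneg hsI
      simp only [hg, indicator_of_mem hs]
      rw [Real.sqrt_eq_zero_of_nonpos (by nlinarith), div_zero]
    · exact indicator_of_notMem hs _
  refine continuousAt_of_dominated (bound := (Ioo (0 : ℝ) 1).indicator fun w =>
    B * (√(δ * rho c r₁))⁻¹ * (√|w - 0|)⁻¹) ?_ ?_ ?_ ?_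
  · refine Eventually.of_forall fun r => ?_
    have h1 : AEStronglyMeasurable (g r) volume := by
      rw [hg, aestronglyMeasurable_indicator_iff measurableSet_Ioo]
      exact (aestronglyMeasurable_of_continuousOn_Icc hf).div₀
        (aestronglyMeasurable_of_continuousOn_Icc
          (((h.continuousOn_rho.pow 2).sub continuousOn_const).sqrt))
    exact h1.comp_measurePreserving (measurePreserving_add_left volume r)
  · filter_upwards [hnear] with r hr
    refine Eventually.of_forall fun w => ?_
    have hbn : 0 ≤ (Ioo (0 : ℝ) 1).indicator (fun w =>
        B * (√(δ * rho c r₁))⁻¹ * (√|w - 0|)⁻¹) w :=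
      indicator_nonneg (fun w _ => by positivity) w
    rcases le_or_gt w 0 with hw | hw
    · rw [hz r hr w hw, norm_zero]
      exact hbn
    by_cases hs : r + w ∈ Ioo R 1
    · have hrI : r ∈ Icc R 1 := ⟨hr₁m.1.trans hr.1.le, hr.2.le⟩
      have hsI := Ioo_subset_Icc_self hs
      have hr1 : r₁ < r := hr.1
      have h1 := hle r hrI _ hsI (by linarith)
      rw [add_sub_cancel_left] at h1
      have h2 := h.strictMonoOn_rho.monotoneOn hr₁m hrI hr1.le
      have h3 := h.rho_nonneg hr₁m
      have hw1 : w ∈ Ioo (0 : ℝ) 1 := ⟨hw, by linarith [hs.2, h.nonneg_of_mem hr₁m]⟩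
      rw [indicator_of_mem hw1]
      simp only [hg, indicator_of_mem hs]
      rw [norm_div, Real.norm_of_nonneg (Real.sqrt_nonneg _), div_eq_mul_inv, mul_assoc,
        ← mul_inv, ← Real.sqrt_mul hκ.le, sub_zero, abs_of_pos hw]
      gcongr
      · exact hB _ hsI
      · have h4 : δ * w * rho c r₁ ≤ (rho c (r + w) - rho c r) * (rho c (r + w) + rho c r) := by
          have := mul_pos hδ hw
          gcongr
          · linarith
          · linarith
        nlinarith
    · rw [hg]
      simp only [indicator_of_notMem hs, norm_zero]
      exact hbn
  · rw [integrable_indicator_iff measurableSet_Ioo]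
    exact (integrableOn_inv_sqrt_abs 0 0 1).const_mul _
  · have hne0 : ∀ᵐ w : ℝ, w ≠ 0 := by simp [ae_iff, measure_singleton]
    have hne1 : ∀ᵐ w : ℝ, w ≠ 1 - r₀ := by simp [ae_iff, measure_singleton]
    filter_upwards [hne0, hne1] with w hw0 hw1
    rcases lt_or_gt_of_ne hw0 with hneg | hpos
    · refine (continuousAt_const (y := (0 : ℝ))).congr ?_
      filter_upwards [hnear] with r hr
      exact (hz r hr w hneg.le).symm
    rcases lt_or_gt_of_ne hw1 with hlt | hgt
    · have hs₀ : r₀ + w ∈ Ioo R 1 := ⟨by linarith [hr₀.1], by linarith⟩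
      have hcf : ContinuousAt (fun r => f (r + w)) r₀ :=
        ContinuousAt.comp (f := fun r => r + w) (g := f)
          (hf.continuousAt (Icc_mem_nhds hs₀.1 hs₀.2)) (by fun_prop)
      have hcρ : ContinuousAt (fun r => rho c (r + w)) r₀ :=
        ContinuousAt.comp (f := fun r => r + w) (g := rho c)
          (h.continuousOn_rho.continuousAt (Icc_mem_nhds hs₀.1 hs₀.2)) (by fun_prop)
      have hcρ₀ : ContinuousAt (rho c) r₀ :=
        h.continuousOn_rho.continuousAt (Icc_mem_nhds hr₀.1 hr₀.2)
      have hsq : 0 < rho c (r₀ + w) ^ 2 - rho c r₀ ^ 2 := by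
        have h1 := h.strictMonoOn_rho (Ioo_subset_Icc_self hr₀) (Ioo_subset_Icc_self hs₀)
          (by linarith)
        have h2 := h.rho_nonneg (Ioo_subset_Icc_self hr₀)
        nlinarith
      have hcont : ContinuousAt (fun r => f (r + w) / √(rho c (r + w) ^ 2 - rho c r ^ 2)) r₀ :=
        hcf.div (((hcρ.pow 2).sub (hcρ₀.pow 2)).sqrt) (Real.sqrt_pos.2 hsq).ne'
      refine hcont.congr ?_
      have : ∀ᶠ r in 𝓝 r₀, r + w ∈ Ioo R 1 :=
        (by fun_prop : ContinuousAt (fun r : ℝ => r + w) r₀).eventually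
          (Ioo_mem_nhds hs₀.1 hs₀.2)
      filter_upwards [this] with r hr
      simp only [hg, indicator_of_mem hr]
    · refine (continuousAt_const (y := (0 : ℝ))).congr ?_
      have : ∀ᶠ r in 𝓝 r₀, r + w ∈ Ioi 1 :=
        (by fun_prop : ContinuousAt (fun r : ℝ => r + w) r₀).eventually
          (Ioi_mem_nhds (by linarith))
      filter_upwards [this] with r hr
      exact (indicator_of_notMem (fun hm : r + w ∈ Ioo R 1 => lt_asymm hm.2 hr) _).symm

/-- Abel's inversion: the transform is multiplied by p / √(p² - q²) with q = ρ(r) and integrated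
over p in (q, ρ(1)). After Fubini the inner integral is π/2 for s > r and 0 otherwise. -/
theorem Admissible.setIntegral_eq_zero_of_abel (h : Admissible R c) {f : ℝ → ℝ}
    (hf : ContinuousOn f (Icc R 1))
    (hG : ∀ p ∈ Ioo (rho c R) (rho c 1), ∫ s in Ioo R 1, f s / √(rho c s ^ 2 - p ^ 2) = 0)
    {r : ℝ} (hr : r ∈ Ioo R 1) : ∫ s in Ioo r 1, f s = 0 := by
  set q := rho c r with hq
  set m := rho c 1 with hm
  have hrI := Ioo_subset_Icc_self hr
  have hq0 : 0 ≤ q := h.rho_nonneg hrI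
  have hqR : rho c R < q := h.strictMonoOn_rho h.left_mem hrI hr.1
  set K : ℝ → ℝ → ℝ := fun s p => f s * (p / (√(p ^ 2 - q ^ 2) * √(rho c s ^ 2 - p ^ 2))) with hK
  have hker : ∀ s ∈ Ioo R 1,
      IntegrableOn (fun p => p / (√(p ^ 2 - q ^ 2) * √(rho c s ^ 2 - p ^ 2))) (Ioo q m) ∧
      ∫ p in Ioo q m, p / (√(p ^ 2 - q ^ 2) * √(rho c s ^ 2 - p ^ 2)) =
        if q < rho c s then Real.pi / 2 else 0 := fun s hs =>
    abel_kernel_extend hq0 (h.rho_nonneg (Ioo_subset_Icc_self hs))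
      (h.strictMonoOn_rho.monotoneOn (Ioo_subset_Icc_self hs) h.right_mem hs.2.le)
  have hfm : AEMeasurable f (volume.restrict (Ioo R 1)) :=
    (aestronglyMeasurable_of_continuousOn_Icc hf).aemeasurable
  have hρm : AEMeasurable (rho c) (volume.restrict (Ioo R 1)) :=
    (aestronglyMeasurable_of_continuousOn_Icc h.continuousOn_rho).aemeasurable
  have hKm : AEStronglyMeasurable (Function.uncurry K)
      ((volume.restrict (Ioo R 1)).prod (volume.restrict (Ioo q m))) := by
    refine AEMeasurable.aestronglyMeasurable ?_
    have h1 : AEMeasurable (fun z : ℝ × ℝ => f z.1)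
        ((volume.restrict (Ioo R 1)).prod (volume.restrict (Ioo q m))) := hfm.comp_fst
    have h2 : AEMeasurable (fun z : ℝ × ℝ => rho c z.1)
        ((volume.restrict (Ioo R 1)).prod (volume.restrict (Ioo q m))) := hρm.comp_fst
    have h3 : Measurable fun z : ℝ × ℝ => √(z.2 ^ 2 - q ^ 2) := by fun_prop
    exact h1.mul (measurable_snd.aemeasurable.div (h3.aemeasurable.mul
      ((h2.pow_const 2).sub (measurable_snd.pow_const 2).aemeasurable).sqrt))
  obtain ⟨B, hB⟩ := isCompact_Icc.exists_bound_of_continuousOn hf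
  have hKint : Integrable (Function.uncurry K)
      ((volume.restrict (Ioo R 1)).prod (volume.restrict (Ioo q m))) := by
    rw [integrable_prod_iff hKm]
    constructor
    · filter_upwards [ae_restrict_mem measurableSet_Ioo] with s hs
      exact (hker s hs).1.const_mul (f s)
    · refine Integrable.of_bound (hKm.norm.integral_prod_right') (B * (Real.pi / 2)) ?_
      filter_upwards [ae_restrict_mem measurableSet_Ioo] with s hs
      have h1 : ∀ p ∈ Ioo q m, ‖Function.uncurry K (s, p)‖ =
          |f s| * (p / (√(p ^ 2 - q ^ 2) * √(rho c s ^ 2 - p ^ 2))) := fun p hp => by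
        simp only [Function.uncurry, hK]
        rw [norm_mul, Real.norm_eq_abs, Real.norm_of_nonneg]
        exact div_nonneg (hq0.trans hp.1.le) (by positivity)
      rw [setIntegral_congr_fun measurableSet_Ioo h1, integral_const_mul, (hker s hs).2, norm_mul,
        Real.norm_eq_abs, abs_abs]
      have h2 := hB s (Ioo_subset_Icc_self hs)
      have hpi := Real.pi_pos
      split_ifs
      · rw [Real.norm_of_nonneg (by positivity)]
        gcongr
        exact h2
      · rw [norm_zero, mul_zero]
        have := (norm_nonneg _).trans h2
        positivity
  have hswap := integral_integral_swap hKint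
  have hright : ∀ p ∈ Ioo q m, ∫ s in Ioo R 1, K s p = 0 := by
    intro p hp
    have h1 : ∀ s, K s p = p / √(p ^ 2 - q ^ 2) * (f s / √(rho c s ^ 2 - p ^ 2)) := fun s => by
      simp only [hK]
      rw [div_mul_div_comm, mul_div_assoc', mul_comm p (f s)]
    simp only [h1]
    rw [integral_const_mul, hG p ⟨hqR.trans hp.1, hp.2⟩, mul_zero]
  rw [setIntegral_congr_fun measurableSet_Ioo hright, integral_zero] at hswap
  have hleft : ∀ s ∈ Ioo R 1, ∫ p in Ioo q m, K s p =
      (Ioo r 1).indicator (fun s => f s * (Real.pi / 2)) s := by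
    intro s hs
    simp only [hK]
    rw [integral_const_mul, (hker s hs).2]
    have hiff : q < rho c s ↔ r < s := h.strictMonoOn_rho.lt_iff_lt hrI (Ioo_subset_Icc_self hs)
    by_cases hrs : r < s
    · rw [if_pos (hiff.2 hrs), indicator_of_mem (show s ∈ Ioo r 1 from ⟨hrs, hs.2⟩)]
    · rw [if_neg (fun hlt => hrs (hiff.1 hlt)),
        indicator_of_notMem (fun hm : s ∈ Ioo r 1 => hrs hm.1), mul_zero]
  rw [setIntegral_congr_fun measurableSet_Ioo hleft, setIntegral_indicator measurableSet_Ioo,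
    inter_eq_self_of_subset_right (Ioo_subset_Ioo_left hr.1.le), integral_mul_const] at hswap
  have := Real.pi_pos
  rcases mul_eq_zero.1 hswap with h1 | h1
  · exact h1
  · linarith

/-- Injectivity of the Abel transform; it suffices that it vanishes on a dense set. -/
theorem Admissible.eq_zero_of_abel (h : Admissible R c) {f : ℝ → ℝ}
    (hf : ContinuousOn f (Icc R 1))
    (hG : ∀ a b, rho c R < a → a < b → b < rho c 1 →
      ∃ p ∈ Icc a b, ∫ s in Ioo R 1, f s / √(rho c s ^ 2 - p ^ 2) = 0)
    {r : ℝ} (hr : r ∈ Ioo R 1) : f r = 0 := by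
  -- Continuity in the radius extends the vanishing from a dense set to all p.
  have hall : ∀ p ∈ Ioo (rho c R) (rho c 1),
      ∫ s in Ioo R 1, f s / √(rho c s ^ 2 - p ^ 2) = 0 := by
    intro p hp
    obtain ⟨r₀, hr₀, rfl⟩ := intermediate_value_Ioo h.R_lt_one.le h.continuousOn_rho hp
    have hcont := h.continuousAt_abel hf hr₀
    by_contra hne
    have hev := hcont.eventually_ne hne
    obtain ⟨l, u, hlu, hsub⟩ := mem_nhds_iff_exists_Ioo_subset.1
      (inter_mem hev (Ioo_mem_nhds hr₀.1 hr₀.2))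
    set a := (l + r₀) / 2 with ha
    have ha1 : a ∈ Ioo l u := ⟨by linarith [hlu.1], by linarith [hlu.1, hlu.2]⟩
    have ha2 := (hsub ha1).2
    obtain ⟨p, hp, hp0⟩ := hG (rho c a) (rho c r₀)
      (h.strictMonoOn_rho h.left_mem (Ioo_subset_Icc_self ha2) ha2.1)
      (h.strictMonoOn_rho (Ioo_subset_Icc_self ha2) (Ioo_subset_Icc_self hr₀) (by linarith [hlu.1]))
      hp.2
    have har : a ≤ r₀ := by linarith [hlu.1]
    obtain ⟨s, hs, rfl⟩ := intermediate_value_Icc har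
      (h.continuousOn_rho.mono (Icc_subset_Icc ha2.1.le hr₀.2.le)) hp
    exact (hsub (show s ∈ Ioo l u from ⟨ha1.1.trans_le hs.1, hs.2.trans_lt hlu.2⟩)).1 hp0
  have hR1 := h.R_lt_one.le
  set g : ℝ → ℝ := IccExtend hR1 ((Icc R 1).domRestrict f) with hg
  have hgc : Continuous g := hf.domRestrict.Icc_extend'
  have hge : ∀ s ∈ Icc R 1, g s = f s := fun s hs => by
    rw [hg, IccExtend_of_mem _ _ hs, domRestrict_apply]
  have h1 := (hgc.integral_hasStrictDerivAt 1 r).hasDerivAt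
  have h2 : HasDerivAt (fun u => ∫ s in (1 : ℝ)..u, g s) 0 r := by
    refine (hasDerivAt_const r (0 : ℝ)).congr_of_eventuallyEq ?_
    filter_upwards [Ioo_mem_nhds hr.1 hr.2] with u hu
    rw [intervalIntegral.integral_symm, intervalIntegral.integral_of_le hu.2.le,
      integral_Ioc_eq_integral_Ioo, setIntegral_congr_fun measurableSet_Ioo
      (fun s hs => hge s ⟨hu.1.le.trans hs.1.le, hs.2.le⟩),
      h.setIntegral_eq_zero_of_abel hf hall hu, neg_zero]
  rw [← hge r (Ioo_subset_Icc_self hr)]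
  exact h1.unique h2

/-! ### Maximum values confined to a null set -/

/-- A continuous function with values in a null set is constant. -/
theorem eq_of_mem_null {M : ℝ → ℝ} {x y : ℝ} (hM : ContinuousOn M (uIcc x y)) {Λ : Set ℝ}
    (hΛ : volume Λ = 0) (hmem : ∀ t ∈ uIcc x y, M t ∈ Λ) : M x = M y := by
  by_contra hne
  have h1 : uIcc (M x) (M y) ⊆ Λ :=
    (intermediate_value_uIcc hM).trans (image_subset_iff.2 hmem)
  have h2 := measure_mono_null h1 hΛ
  rw [uIcc, Real.volume_Icc, ENNReal.ofReal_eq_zero] at h2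
  exact hne (by
    rcases le_total (M x) (M y) with h3 | h3
    · rw [max_eq_right h3, min_eq_left h3] at h2
      linarith
    · rw [max_eq_left h3, min_eq_right h3] at h2
      linarith)

/-- If the local maximum values of the functions `Φ τ` lie in a null set, then a strict interior
maximum of `Φ τ₀` is also stationary in the parameter. -/
theorem exists_isLocalMax_param {Φ : ℝ → ℝ → ℝ} {I : Set ℝ} (hI : IsOpen I) {a b τ₀ : ℝ}
    (hτ₀ : τ₀ ∈ I) (hΦ : ∀ τ ∈ I, ∀ p, ContinuousAt (fun z : ℝ × ℝ => Φ z.1 z.2) (τ, p))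
    {q : ℝ} (hq : q ∈ Icc a b) (ha : Φ τ₀ a < Φ τ₀ q) (hb : Φ τ₀ b < Φ τ₀ q)
    {Λ : Set ℝ} (hΛ : volume Λ = 0)
    (hmem : ∀ᶠ τ in 𝓝 τ₀, ∀ p ∈ Ioo a b, IsLocalMax (Φ τ) p → Φ τ p ∈ Λ) :
    ∃ p ∈ Ioo a b, IsLocalMax (fun τ => Φ τ p) τ₀ := by
  have hcτ : ∀ p, ContinuousAt (fun τ => Φ τ p) τ₀ := fun p =>
    ContinuousAt.comp (f := fun τ : ℝ => (τ, p)) (g := fun z : ℝ × ℝ => Φ z.1 z.2)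
      (hΦ τ₀ hτ₀ p) (by fun_prop)
  have hcp : ∀ τ ∈ I, Continuous (Φ τ) := fun τ hτ => continuous_iff_continuousAt.2 fun p =>
    ContinuousAt.comp (f := fun p : ℝ => (τ, p)) (g := fun z : ℝ × ℝ => Φ z.1 z.2)
      (hΦ τ hτ p) (by fun_prop)
  set M : ℝ → ℝ := fun τ => sSup (Φ τ '' Icc a b) with hMdef
  have hMc : ContinuousOn M I := by
    rw [continuousOn_iff_continuous_domRestrict]
    refine IsCompact.continuous_sSup (f := fun (τ : I) p => Φ τ p) isCompact_Icc ?_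
    refine continuous_iff_continuousAt.2 fun z => ?_
    exact ContinuousAt.comp (f := fun z : I × ℝ => ((z.1 : ℝ), z.2))
      (g := fun z : ℝ × ℝ => Φ z.1 z.2) (hΦ z.1 z.1.2 z.2) (by fun_prop)
  have hne : (Icc a b).Nonempty := ⟨q, hq⟩
  have hle : ∀ τ ∈ I, ∀ p ∈ Icc a b, Φ τ p ≤ M τ := fun τ hτ p hp =>
    le_csSup (isCompact_Icc.image (hcp τ hτ)).bddAbove (mem_image_of_mem _ hp)
  have hmax : ∀ τ ∈ I, Φ τ a < Φ τ q → Φ τ b < Φ τ q →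
      ∃ p ∈ Ioo a b, Φ τ p = M τ ∧ IsLocalMax (Φ τ) p := by
    intro τ hτ hτa hτb
    obtain ⟨p, hp, hpM, hpmax⟩ := isCompact_Icc.exists_sSup_image_eq_and_ge hne
      (hcp τ hτ).continuousOn
    have h1 := hpmax q hq
    have hpa : p ≠ a := by rintro rfl; linarith
    have hpb : p ≠ b := by rintro rfl; linarith
    have hpI : p ∈ Ioo a b := ⟨lt_of_le_of_ne hp.1 hpa.symm, lt_of_le_of_ne hp.2 hpb⟩
    refine ⟨p, hpI, hpM.symm, ?_⟩
    filter_upwards [Icc_mem_nhds hpI.1 hpI.2] with y hy using hpmax y hy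
  have hev : ∀ᶠ τ in 𝓝 τ₀, τ ∈ I ∧ M τ ∈ Λ := by
    filter_upwards [hmem, hI.mem_nhds hτ₀, (hcτ a).eventually_lt (hcτ q) ha,
      (hcτ b).eventually_lt (hcτ q) hb] with τ h1 h2 h3 h4
    obtain ⟨p, hp, hpM, hpmax⟩ := hmax τ h2 h3 h4
    exact ⟨h2, hpM ▸ h1 p hp hpmax⟩
  obtain ⟨δ, hδ, hball⟩ := Metric.eventually_nhds_iff_ball.1 hev
  obtain ⟨p, hp, hpM, -⟩ := hmax τ₀ hτ₀ ha hb
  refine ⟨p, hp, ?_⟩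
  filter_upwards [Metric.ball_mem_nhds τ₀ hδ] with τ hτ
  have hsub : uIcc τ₀ τ ⊆ Metric.ball τ₀ δ := by
    rw [Real.ball_eq_Ioo] at hτ ⊢
    exact ordConnected_Ioo.uIcc_subset ⟨by linarith, by linarith⟩ hτ
  -- The maximum is constant near τ₀, hence Φ τ p ≤ M τ = M τ₀ = Φ τ₀ p for the maximizer p at τ₀.
  -- No dependence of maximizers on τ is needed.
  have hMeq : M τ₀ = M τ := eq_of_mem_null (hMc.mono fun t ht => (hball t (hsub ht)).1) hΛ
    fun t ht => (hball t (hsub ht)).2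
  show Φ τ p ≤ Φ τ₀ p
  rw [hpM, hMeq]
  exact hle τ (hball τ hτ).1 p (Ioo_subset_Icc_self hp)

/-- A function increasing at the left end and decreasing at the right end of an interval has values
in it which exceed those at both ends. -/
theorem exists_gt_endpoints {f : ℝ → ℝ} {a b fa fb : ℝ} (hab : a < b)
    (hf : ContinuousOn f (Icc a b)) (ha : HasDerivAt f fa a) (hb : HasDerivAt f fb b)
    (hfa : 0 < fa) (hfb : fb < 0) : ∃ q ∈ Icc a b, f a < f q ∧ f b < f q := by
  obtain ⟨q, hq, hmax⟩ := isCompact_Icc.exists_isMaxOn (nonempty_Icc.2 hab.le) hf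
  have haI : a ∈ Icc a b := left_mem_Icc.2 hab.le
  have hbI : b ∈ Icc a b := right_mem_Icc.2 hab.le
  refine ⟨q, hq, lt_of_le_of_ne (hmax haI) fun h => ?_, lt_of_le_of_ne (hmax hbI) fun h => ?_⟩
  · have h1 : IsMaxOn f (Icc a b) a := fun x hx => (hmax hx).trans_eq h.symm
    have h2 := h1.localize.hasFDerivWithinAt_nonpos ha.hasFDerivAt.hasFDerivWithinAt
      (sub_mem_posTangentConeAt_of_segment_subset ((convex_Icc a b).segment_subset haI hbI))
    simp only [ContinuousLinearMap.toSpanSingleton_apply, smul_eq_mul] at h2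
    nlinarith
  · have h1 : IsMaxOn f (Icc a b) b := fun x hx => (hmax hx).trans_eq h.symm
    have h2 := h1.localize.hasFDerivWithinAt_nonpos hb.hasFDerivAt.hasFDerivWithinAt
      (sub_mem_posTangentConeAt_of_segment_subset ((convex_Icc a b).segment_subset hbI haI))
    simp only [ContinuousLinearMap.toSpanSingleton_apply, smul_eq_mul] at h2
    nlinarith

/-! ### Families of sound speeds and rigidity -/

/-- The derivative of a family of sound speeds in the parameter. -/
noncomputable def paramDeriv (R ε : ℝ) (c : ℝ → ℝ → ℝ) (τ s : ℝ) : ℝ :=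
  fderivWithin ℝ (fun q : ℝ × ℝ => c q.1 q.2) (Ioo (-ε) ε ×ˢ Icc R 1) (τ, s) (1, 0)

section Family

variable {R ε : ℝ} {c : ℝ → ℝ → ℝ}

theorem continuousOn_paramDeriv (hR : R < 1)
    (hC1 : ContDiffOn ℝ 1 (fun q : ℝ × ℝ => c q.1 q.2) (Ioo (-ε) ε ×ˢ Icc R 1)) :
    ContinuousOn (fun q : ℝ × ℝ => paramDeriv R ε c q.1 q.2) (Ioo (-ε) ε ×ˢ Icc R 1) :=
  (hC1.continuousOn_fderivWithin (isOpen_Ioo.uniqueDiffOn.prod (uniqueDiffOn_Icc hR))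
    le_rfl).clm_apply continuousOn_const

theorem hasDerivAt_param
    (hC1 : ContDiffOn ℝ 1 (fun q : ℝ × ℝ => c q.1 q.2) (Ioo (-ε) ε ×ˢ Icc R 1))
    {τ s : ℝ} (hτ : τ ∈ Ioo (-ε) ε) (hs : s ∈ Icc R 1) :
    HasDerivAt (fun τ => c τ s) (paramDeriv R ε c τ s) τ := by
  have h1 := (hC1.differentiableOn one_ne_zero (τ, s) ⟨hτ, hs⟩).hasFDerivWithinAt
  have h2 : HasDerivWithinAt (fun t : ℝ => (t, s)) ((1 : ℝ), (0 : ℝ)) (Ioo (-ε) ε) τ :=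
    ((hasDerivAt_id τ).prodMk (hasDerivAt_const τ s)).hasDerivWithinAt
  exact (HasFDerivWithinAt.comp_hasDerivWithinAt (t := Ioo (-ε) ε ×ˢ Icc R 1) τ h1 h2
    fun t (ht : t ∈ Ioo (-ε) ε) => ⟨ht, hs⟩).hasDerivAt
    (Ioo_mem_nhds hτ.1 hτ.2)

/-- Locally uniform bounds for a family of sound speeds. -/
theorem exists_param_bounds (hadm : ∀ τ ∈ Ioo (-ε) ε, Admissible R (c τ))
    (hC1 : ContDiffOn ℝ 1 (fun q : ℝ × ℝ => c q.1 q.2) (Ioo (-ε) ε ×ˢ Icc R 1))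
    {τ₀ : ℝ} (hτ₀ : τ₀ ∈ Ioo (-ε) ε) :
    ∃ δ > 0, Icc (τ₀ - δ) (τ₀ + δ) ⊆ Ioo (-ε) ε ∧ ∃ m > 0, ∃ K,
      ∀ τ ∈ Icc (τ₀ - δ) (τ₀ + δ), ∀ s ∈ Icc R 1, m ≤ c τ s ∧ |paramDeriv R ε c τ s| ≤ K := by
  have hR := (hadm τ₀ hτ₀).R_lt_one
  obtain ⟨δ, hδ, hsub⟩ := (nhds_basis_Icc_pos τ₀).mem_iff.1 (Ioo_mem_nhds hτ₀.1 hτ₀.2)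
  have hsub2 : Icc (τ₀ - δ) (τ₀ + δ) ×ˢ Icc R 1 ⊆ Ioo (-ε) ε ×ˢ Icc R 1 := prod_mono_left hsub
  have hcomp : IsCompact (Icc (τ₀ - δ) (τ₀ + δ) ×ˢ Icc R 1) := isCompact_Icc.prod isCompact_Icc
  obtain ⟨z, hz, hmin⟩ := hcomp.exists_isMinOn
    ⟨(τ₀, R), ⟨by linarith, by linarith⟩, (hadm τ₀ hτ₀).left_mem⟩ (hC1.continuousOn.mono hsub2)
  obtain ⟨K, hK⟩ := hcomp.exists_bound_of_continuousOn
    ((continuousOn_paramDeriv hR hC1).mono hsub2)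
  exact ⟨δ, hδ, hsub, c z.1 z.2, (hadm z.1 (hsub hz.1)).pos _ hz.2, K,
    fun τ hτ s hs => ⟨isMinOn_iff.1 hmin (τ, s) ⟨hτ, hs⟩, hK (τ, s) ⟨hτ, hs⟩⟩⟩

theorem continuousAt_interceptTime (hadm : ∀ τ ∈ Ioo (-ε) ε, Admissible R (c τ))
    (hC1 : ContDiffOn ℝ 1 (fun q : ℝ × ℝ => c q.1 q.2) (Ioo (-ε) ε ×ˢ Icc R 1))
    {τ₀ : ℝ} (hτ₀ : τ₀ ∈ Ioo (-ε) ε) (p₀ : ℝ) :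
    ContinuousAt (fun z : ℝ × ℝ => interceptTime R (c z.1) z.2) (τ₀, p₀) := by
  obtain ⟨δ, hδ, hsub, m, hm, K, hb⟩ := exists_param_bounds hadm hC1 hτ₀
  have hnear : ∀ᶠ z : ℝ × ℝ in 𝓝 (τ₀, p₀), z.1 ∈ Icc (τ₀ - δ) (τ₀ + δ) :=
    continuousAt_fst.eventually (Icc_mem_nhds (by linarith) (by linarith))
  refine ContinuousAt.const_mul (continuousAt_of_dominated (bound := fun _ => m⁻¹) ?_ ?_ ?_ ?_) 2
  · filter_upwards [hnear] with z hz
    exact ((hadm z.1 (hsub hz)).continuousOn_intercept z.2).aestronglyMeasurable measurableSet_Ioo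
  · filter_upwards [hnear] with z hz
    have h := hadm z.1 (hsub hz)
    filter_upwards [ae_restrict_mem measurableSet_Ioo] with s hs
    have hs' := Ioo_subset_Icc_self hs
    have hs0 := h.pos_of_mem_Ioo hs
    have hc := h.pos s hs'
    rw [Real.norm_of_nonneg (by positivity)]
    calc √(rho (c z.1) s ^ 2 - z.2 ^ 2) / s ≤ rho (c z.1) s / s := by
          gcongr
          exact Real.sqrt_le_iff.2 ⟨h.rho_nonneg hs', by nlinarith⟩
      _ = (c z.1 s)⁻¹ := by unfold rho; field_simp
      _ ≤ m⁻¹ := by gcongr; exact (hb z.1 hz s hs').1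
  · exact integrable_const _
  · filter_upwards [ae_restrict_mem measurableSet_Ioo] with s hs
    have hs' := Ioo_subset_Icc_self hs
    have h1 : ContinuousAt (fun z : ℝ × ℝ => c z.1 s) (τ₀, p₀) :=
      ContinuousAt.comp (f := Prod.fst) (g := fun τ => c τ s)
        (hasDerivAt_param hC1 hτ₀ hs').continuousAt continuousAt_fst
    exact ((((continuousAt_const.div h1 ((hadm τ₀ hτ₀).pos s hs').ne').pow 2).sub
      (continuousAt_snd.pow 2)).sqrt).div_const s

/-- Since ∂ρ²/∂τ = -2 s² (∂c/∂τ) / c³, differentiating √(ρ² - p²) / s turns the intercept time into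
an Abel-type transform of a multiple of ∂c/∂τ. -/
theorem hasDerivAt_interceptTime_param (hadm : ∀ τ ∈ Ioo (-ε) ε, Admissible R (c τ))
    (hC1 : ContDiffOn ℝ 1 (fun q : ℝ × ℝ => c q.1 q.2) (Ioo (-ε) ε ×ˢ Icc R 1))
    {τ₀ : ℝ} (hτ₀ : τ₀ ∈ Ioo (-ε) ε) {p : ℝ} (hp : 0 < p) :
    HasDerivAt (fun τ => interceptTime R (c τ) p)
      (2 * ∫ s in Ioo R 1, (-(s * paramDeriv R ε c τ₀ s / c τ₀ s ^ 3)) /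
        √(rho (c τ₀) s ^ 2 - p ^ 2)) τ₀ := by
  obtain ⟨δ, hδ, hsub, m, hm, K, hb⟩ := exists_param_bounds hadm hC1 hτ₀
  have h := hadm τ₀ hτ₀
  have hc3 : ContinuousOn (fun s => -(s * paramDeriv R ε c τ₀ s / c τ₀ s ^ 3)) (Icc R 1) := by
    have h1 : ContinuousOn (paramDeriv R ε c τ₀) (Icc R 1) :=
      ContinuousOn.comp (f := fun s => (τ₀, s)) (t := Ioo (-ε) ε ×ˢ Icc R 1)
        (continuousOn_paramDeriv h.R_lt_one hC1) (by fun_prop) fun s hs => ⟨hτ₀, hs⟩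
    exact ((continuousOn_id.mul h1).div (h.continuousOn.pow 3)
      fun s hs => pow_ne_zero _ (h.pos s hs).ne').neg
  refine (hasDerivAt_integral_of_lip (μ := volume.restrict (Ioo R 1))
    (F := fun τ s => √(rho (c τ) s ^ 2 - p ^ 2) / s)
    -- Here |∂ρ²/∂τ| ≤ 2K s² / m³; one factor s cancels the 1/s of the integrand and the other is at
    -- most 1.
    (bound := fun s => 2 * K / m ^ 3 * (√|rho (c τ₀) s ^ 2 - p ^ 2|)⁻¹)
    (s := Icc (τ₀ - δ) (τ₀ + δ)) (Icc_mem_nhds (by linarith) (by linarith))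
    (fun τ hτ => ((hadm τ (hsub hτ)).continuousOn_intercept p).aestronglyMeasurable
      measurableSet_Ioo)
    (h.integrableOn_intercept p) ?_ ?_ ((h.integrableOn_inv_sqrt hp).const_mul _) ?_).2.const_mul 2
  · exact (Admissible.aestronglyMeasurable_of_continuousOn_Icc hc3).div₀
      (Admissible.aestronglyMeasurable_of_continuousOn_Icc
        ((h.continuousOn_rho.pow 2).sub continuousOn_const).sqrt)
  · filter_upwards [ae_restrict_mem measurableSet_Ioo, h.ae_rho_sq_ne hp] with s hs hne τ hτ
    have hs' := Ioo_subset_Icc_self hs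
    have hs0 := h.pos_of_mem_Ioo hs
    have hlip : |rho (c τ) s ^ 2 - rho (c τ₀) s ^ 2| ≤ s ^ 2 * (2 * K / m ^ 3) * |τ - τ₀| := by
      refine Convex.norm_image_sub_le_of_norm_hasDerivWithin_le
        (f := fun τ => rho (c τ) s ^ 2) (s := Icc (τ₀ - δ) (τ₀ + δ))
        (f' := fun τ => -(s ^ 2 * (2 * paramDeriv R ε c τ s / c τ s ^ 3)))
        (fun t ht => ?_) (fun t ht => ?_) (convex_Icc _ _) ⟨by linarith, by linarith⟩ hτ
      · have hcp := (hadm t (hsub ht)).pos s hs'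
        have h1 := (((hasDerivAt_const t s).fun_div (hasDerivAt_param hC1 (hsub ht) hs')
          hcp.ne').fun_pow 2).hasDerivWithinAt (s := Icc (τ₀ - δ) (τ₀ + δ))
        refine HasDerivWithinAt.congr_deriv h1 ?_
        rw [show 2 - 1 = 1 from rfl, Nat.cast_ofNat]
        field_simp
        ring
      · obtain ⟨h1, h2⟩ := hb t ht s hs'
        have hK0 := (abs_nonneg _).trans h2
        have hc0 := hm.trans_le h1
        rw [norm_neg, norm_mul, norm_div, norm_mul, Real.norm_eq_abs (paramDeriv R ε c t s),
          Real.norm_of_nonneg (by positivity), Real.norm_of_nonneg (by positivity),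
          Real.norm_of_nonneg (by positivity)]
        gcongr
    rw [← sub_div, abs_div, abs_of_pos hs0, div_le_iff₀ hs0]
    have hKn : 0 ≤ 2 * K / m ^ 3 := by
      have := (abs_nonneg _).trans (hb τ hτ s hs').2
      positivity
    calc |√(rho (c τ) s ^ 2 - p ^ 2) - √(rho (c τ₀) s ^ 2 - p ^ 2)|
        ≤ |(rho (c τ) s ^ 2 - p ^ 2) - (rho (c τ₀) s ^ 2 - p ^ 2)| /
            √|rho (c τ₀) s ^ 2 - p ^ 2| := abs_sqrt_sub_sqrt_le hne _
      _ ≤ (s * 1 * (2 * K / m ^ 3) * |τ - τ₀|) / √|rho (c τ₀) s ^ 2 - p ^ 2| := by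
          gcongr
          rw [sub_sub_sub_cancel_right]
          refine hlip.trans ?_
          rw [pow_two]
          gcongr
          exact hs.2.le
      _ = _ := by ring
  · filter_upwards [ae_restrict_mem measurableSet_Ioo, h.ae_rho_sq_ne hp] with s hs hne
    have hs' := Ioo_subset_Icc_self hs
    have hs0 := h.pos_of_mem_Ioo hs
    have hcp := h.pos s hs'
    have h1 : HasDerivAt (fun τ => rho (c τ) s ^ 2)
        (-(s ^ 2 * (2 * paramDeriv R ε c τ₀ s / c τ₀ s ^ 3))) τ₀ := by
      refine HasDerivAt.congr_deriv (((hasDerivAt_const τ₀ s).fun_div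
        (hasDerivAt_param hC1 hτ₀ hs') hcp.ne').fun_pow 2) ?_
      rw [show 2 - 1 = 1 from rfl, Nat.cast_ofNat]
      field_simp
      ring
    refine HasDerivAt.congr_deriv (((h1.sub_const (p ^ 2)).sqrt hne).div_const s) ?_
    rcases eq_or_ne √(rho (c τ₀) s ^ 2 - p ^ 2) 0 with h0 | h0
    · rw [h0]
      simp
    · field_simp

/-- The linearized travel time data of an isospectral family vanish on a dense set. -/
theorem exists_abel_eq_zero {n : ℕ} (hn : 2 ≤ n)
    (hadm : ∀ τ ∈ Ioo (-ε) ε, Admissible R (c τ))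
    (hconj : ∀ τ ∈ Ioo (-ε) ε, CountableConjugacy n R (c τ))
    (hC1 : ContDiffOn ℝ 1 (fun q : ℝ × ℝ => c q.1 q.2) (Ioo (-ε) ε ×ˢ Icc R 1))
    {Λ : Set ℝ} (hΛ : volume Λ = 0) (hsub : ∀ τ ∈ Ioo (-ε) ε, lsp n R (c τ) ⊆ Λ)
    {τ₀ : ℝ} (hτ₀ : τ₀ ∈ Ioo (-ε) ε) {a b : ℝ} (ha : rho (c τ₀) R < a) (hab : a < b)
    (hb : b < rho (c τ₀) 1) :
    ∃ p ∈ Icc a b, ∫ s in Ioo R 1, (-(s * paramDeriv R ε c τ₀ s / c τ₀ s ^ 3)) /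
      √(rho (c τ₀) s ^ 2 - p ^ 2) = 0 := by
  have h := hadm τ₀ hτ₀
  have ha0 : 0 < a := (h.rho_nonneg h.left_mem).trans_lt ha
  obtain ⟨b', hb', hne⟩ := h.exists_openingAngle_ne hn (hconj τ₀ hτ₀) hab ha hb
  have hab' : a < b' := lt_of_le_of_ne hb'.1 (by rintro rfl; exact hne rfl)
  have hb'0 : 0 < b' := ha0.trans hab'
  -- A rational m/(k + 1) strictly between α(a)/2π and α(b')/2π; the sign ξ makes Φ increase at a
  -- and decrease at b'.
  obtain ⟨ξ, hξ, k, m, hka, hkb⟩ : ∃ ξ : ℝ, (ξ = 1 ∨ ξ = -1) ∧ ∃ (k : ℕ) (m : ℤ),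
      0 < ξ * (m * (2 * Real.pi) - (k + 1) * openingAngle R (c τ₀) a) ∧
      ξ * (m * (2 * Real.pi) - (k + 1) * openingAngle R (c τ₀) b') < 0 := by
    have hfrac : ∀ x y : ℝ, x < y → ∃ (k : ℕ) (m : ℤ),
        (k + 1) * x < m * (2 * Real.pi) ∧ m * (2 * Real.pi) < (k + 1) * y := by
      intro x y hxy
      have hpi : 0 < 2 * Real.pi := Real.two_pi_pos
      obtain ⟨q, hq1, hq2⟩ := exists_rat_btwn ((div_lt_div_iff_of_pos_right hpi).2 hxy)
      have hden : ((q.den - 1 : ℕ) : ℝ) + 1 = q.den := by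
        exact_mod_cast Nat.sub_add_cancel q.den_pos
      have hd0 : (0 : ℝ) < q.den := by exact_mod_cast q.den_pos
      refine ⟨q.den - 1, q.num, ?_, ?_⟩
      · rw [hden]
        rw [div_lt_iff₀ hpi, Rat.cast_def, div_mul_eq_mul_div, lt_div_iff₀ hd0] at hq1
        linarith
      · rw [hden]
        rw [lt_div_iff₀ hpi, Rat.cast_def, div_mul_eq_mul_div, div_lt_iff₀ hd0] at hq2
        linarith
    rcases lt_or_gt_of_ne hne with hlt | hgt
    · obtain ⟨k, m, h1, h2⟩ := hfrac _ _ hlt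
      exact ⟨-1, Or.inr rfl, k, m, by linarith, by linarith⟩
    · obtain ⟨k, m, h1, h2⟩ := hfrac _ _ hgt
      exact ⟨1, Or.inl rfl, k, m, by linarith, by linarith⟩
  have hξ0 : ξ ≠ 0 := by rcases hξ with rfl | rfl <;> norm_num
  set Φ : ℝ → ℝ → ℝ := fun τ p =>
    ξ * ((k + 1) * interceptTime R (c τ) p + m * (2 * Real.pi) * p) with hΦ
  have hder : ∀ τ ∈ Ioo (-ε) ε, ∀ p, 0 < p →
      HasDerivAt (Φ τ) (ξ * (m * (2 * Real.pi) - (k + 1) * openingAngle R (c τ) p)) p := by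
    intro τ hτ p hp
    refine HasDerivAt.congr_deriv (((((hadm τ hτ).hasDerivAt_interceptTime hp).2.const_mul
      ((k : ℝ) + 1)).fun_add ((hasDerivAt_id p).const_mul (m * (2 * Real.pi)))).const_mul ξ) ?_
    ring
  have hcont : ∀ τ ∈ Ioo (-ε) ε, ∀ p, ContinuousAt (fun z : ℝ × ℝ => Φ z.1 z.2) (τ, p) := by
    intro τ hτ p
    exact ((continuousAt_interceptTime hadm hC1 hτ p).const_mul _ |>.add
      (continuousAt_snd.const_mul _)).const_mul ξ
  obtain ⟨q, hq, hqa, hqb⟩ := exists_gt_endpoints hab'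
    (fun p hp => (hder τ₀ hτ₀ p (ha0.trans_le hp.1)).continuousAt.continuousWithinAt)
    (hder τ₀ hτ₀ a ha0) (hder τ₀ hτ₀ b' hb'0) hka hkb
  have hρ : ∀ r ∈ Icc R 1, ContinuousAt (fun τ => rho (c τ) r) τ₀ := fun r hr =>
    continuousAt_const.div (hasDerivAt_param hC1 hτ₀ hr).continuousAt (h.pos r hr).ne'
  -- At a critical point (k + 1)α = 2πm, so a closed broken ray exists and Φ is ξ times its length.
  -- The restriction to τ near τ₀ keeps [a, b] inside the range of ρ for c τ.
  have hcrit : ∀ᶠ τ in 𝓝 τ₀, ∀ p ∈ Ioo a b', IsLocalMax (Φ τ) p → Φ τ p ∈ Λ ∪ -Λ := by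
    filter_upwards [Ioo_mem_nhds hτ₀.1 hτ₀.2,
      (hρ R h.left_mem).eventually_lt continuousAt_const ha,
      continuousAt_const.eventually_lt (hρ 1 h.right_mem) hb] with τ hτ h1 h2 p hp hmax
    have hp0 := ha0.trans hp.1
    have h3 := (mul_eq_zero.1 (hmax.hasDerivAt_eq_zero (hder τ hτ p hp0))).resolve_left hξ0
    have h4 := hsub τ hτ ((hadm τ hτ).mem_lsp hn hp0 (h1.trans hp.1)
      ((hp.2.trans_le hb'.2).trans h2) (k := k) (m := m) (by linarith))
    have h5 : Φ τ p = ξ * ((k + 1) * travelTime R (c τ) p) := by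
      simp only [hΦ]
      rw [(hadm τ hτ).travelTime_eq hp0, show (m : ℝ) * (2 * Real.pi) =
        (k + 1) * openingAngle R (c τ) p by linarith]
      ring
    rw [h5]
    rcases hξ with rfl | rfl
    · left
      rwa [one_mul]
    · right
      rwa [Set.mem_neg, neg_one_mul, neg_neg]
  have hnull : volume (Λ ∪ -Λ) = 0 :=
    measure_union_null hΛ (by rw [Measure.measure_neg, hΛ])
  obtain ⟨p, hp, hpmax⟩ := exists_isLocalMax_param isOpen_Ioo hτ₀ hcont hq hqa hqb hnull hcrit
  have hd := ((((hasDerivAt_interceptTime_param hadm hC1 hτ₀ (ha0.trans hp.1)).const_mul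
    ((k : ℝ) + 1)).add_const (m * (2 * Real.pi) * p)).const_mul ξ)
  have hz := (mul_eq_zero.1 (hpmax.hasDerivAt_eq_zero hd)).resolve_left hξ0
  have hk : (k : ℝ) + 1 ≠ 0 := by positivity
  exact ⟨p, ⟨hp.1.le, hp.2.le.trans hb'.2⟩,
    (mul_eq_zero.1 ((mul_eq_zero.1 hz).resolve_left hk)).resolve_left two_ne_zero⟩

/-- A family of sound speeds whose length spectra lie in a fixed null set is constant. -/
theorem eqOn_of_lsp_subset_null {n : ℕ} (hn : 2 ≤ n)
    (hadm : ∀ τ ∈ Ioo (-ε) ε, Admissible R (c τ))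
    (hconj : ∀ τ ∈ Ioo (-ε) ε, CountableConjugacy n R (c τ))
    (hC1 : ContDiffOn ℝ 1 (fun q : ℝ × ℝ => c q.1 q.2) (Ioo (-ε) ε ×ˢ Icc R 1))
    {Λ : Set ℝ} (hΛ : volume Λ = 0) (hsub : ∀ τ ∈ Ioo (-ε) ε, lsp n R (c τ) ⊆ Λ)
    {τ₀ τ : ℝ} (hτ₀ : τ₀ ∈ Ioo (-ε) ε) (hτ : τ ∈ Ioo (-ε) ε) :
    EqOn (c τ) (c τ₀) (Icc R 1) := by
  have hR := (hadm τ hτ).R_lt_one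
  have hzero : ∀ t ∈ Ioo (-ε) ε, ∀ s ∈ Ioo R 1, paramDeriv R ε c t s = 0 := by
    intro t ht s hs
    have h := hadm t ht
    have h1 : ContinuousOn (paramDeriv R ε c t) (Icc R 1) :=
      ContinuousOn.comp (f := fun s => (t, s)) (t := Ioo (-ε) ε ×ˢ Icc R 1)
        (continuousOn_paramDeriv hR hC1) (by fun_prop) fun s hs => ⟨ht, hs⟩
    have h2 : ContinuousOn (fun s => -(s * paramDeriv R ε c t s / c t s ^ 3)) (Icc R 1) :=
      ((continuousOn_id.mul h1).div (h.continuousOn.pow 3)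
        fun s hs => pow_ne_zero _ (h.pos s hs).ne').neg
    have h3 := h.eq_zero_of_abel h2 (fun a b ha hab hb =>
      exists_abel_eq_zero hn hadm hconj hC1 hΛ hsub ht ha hab hb) hs
    have hs0 := (h.pos_of_mem_Ioo hs).ne'
    have hc0 := (h.pos s (Ioo_subset_Icc_self hs)).ne'
    simpa [hs0, hc0] using h3
  -- The Abel argument determines ∂c/∂τ only on the open interval; continuity covers the end points.
  refine EqOn.of_subset_closure (s := Ioo R 1) (fun s hs => ?_) (hadm τ hτ).continuousOn
    (hadm τ₀ hτ₀).continuousOn Ioo_subset_Icc_self (closure_Ioo hR.ne).ge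
  have h1 := Convex.norm_image_sub_le_of_norm_hasDerivWithin_le (C := 0)
    (f := fun t => c t s) (s := Ioo (-ε) ε)
    (fun t ht => (hasDerivAt_param hC1 ht (Ioo_subset_Icc_self hs)).hasDerivWithinAt)
    (fun t ht => by rw [hzero t ht s hs, norm_zero]) (convex_Ioo _ _) hτ₀ hτ
  rw [zero_mul] at h1
  exact sub_eq_zero.1 (norm_le_zero_iff.1 h1)

end Family

end RadialSpeed


/-! ### The two rigidity statements -/

theorem theorem1p1 (n : ℕ) (hn : 2 ≤ n) (R ε : ℝ) (hR0 : 0 ≤ R) (hR1 : R < 1) (hε : 0 < ε)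
    (c : ℝ → ℝ → ℝ)
    (hpos : ∀ τ ∈ Set.Ioo (-ε) ε, ∀ r ∈ Set.Icc R 1, 0 < c τ r)
    (hC11 : ∀ τ ∈ Set.Ioo (-ε) ε, RadialSpeed.IsC11On (c τ) (Set.Icc R 1))
    (hHerglotz : ∀ τ ∈ Set.Ioo (-ε) ε, RadialSpeed.Herglotz R (c τ))
    (hconj : ∀ τ ∈ Set.Ioo (-ε) ε, RadialSpeed.CountableConjugacy n R (c τ))
    (hC1 : ContDiffOn ℝ 1 (fun q : ℝ × ℝ => c q.1 q.2) (Set.Ioo (-ε) ε ×ˢ Set.Icc R 1))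
    (hzero : R = 0 → ∀ τ ∈ Set.Ioo (-ε) ε, derivWithin (c τ) (Set.Icc R 1) 0 = 0) :
    ((∀ τ ∈ Set.Ioo (-ε) ε, RadialSpeed.lsp n R (c τ) = RadialSpeed.lsp n R (c 0)) →
      ∀ τ ∈ Set.Ioo (-ε) ε, Set.EqOn (c τ) (c 0) (Set.Icc R 1)) ∧
    (0 < R →
      (∀ τ ∈ Set.Ioo (-ε) ε,
        RadialSpeed.lspInner n R (c τ) = RadialSpeed.lspInner n R (c 0)) →
      ∀ τ ∈ Set.Ioo (-ε) ε, Set.EqOn (c τ) (c 0) (Set.Icc R 1)) := by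
  have hadm : ∀ τ ∈ Set.Ioo (-ε) ε, RadialSpeed.Admissible R (c τ) := fun τ hτ =>
    ⟨hR0, hR1, hpos τ hτ, hC11 τ hτ, hHerglotz τ hτ, fun h => hzero h τ hτ⟩
  have h0 : (0 : ℝ) ∈ Set.Ioo (-ε) ε := ⟨neg_lt_zero.2 hε, hε⟩
  have hnull := (hadm 0 h0).volume_lengths_eq_zero
  refine ⟨fun hspec τ hτ => ?_, fun hR hspec τ hτ => ?_⟩
  · exact RadialSpeed.eqOn_of_lsp_subset_null hn hadm hconj hC1
      (measure_mono_null (fun _ => RadialSpeed.exists_of_mem_lsp (hadm 0 h0)) hnull)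
      (fun t ht => (hspec t ht).le) h0 hτ
  -- Rays with inner reflections enter only through nullity of the larger spectrum; the variational
  -- argument still uses rays reflecting at the outer boundary alone.
  · exact RadialSpeed.eqOn_of_lsp_subset_null hn hadm hconj hC1
      (measure_mono_null (fun _ => RadialSpeed.exists_of_mem_lspInner (hadm 0 h0) hR) hnull)
      (fun t ht => (RadialSpeed.lsp_subset_lspInner hR).trans (hspec t ht).le) h0 hτ
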